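/- **Single impurity in a magnetic ring chain.** Let $A,\alpha\in\mathbb R$. Let $\Gamma$ be the infinite chain of rings of circumference $2\pi$ touching at the vertices $j\pi$, $j\in\mathbb Z$: its upper and lower semicircles are parametrized by two copies of $\mathbb R$, the $j$-th ring consisting of the two copies of $\mathcal I_j=[j\pi,(j+1)\pi]$, and $L^2(\Gamma)=L^2(\mathbb R)\oplus L^2(\mathbb R)$. Write elements of $L^2(\Gamma)$ as $(\psi,\varphi)$ with restrictions $\psi_j,\varphi_j$ to $\mathcal I_j$, and put $\mathcal D=\frac{d}{dx}+iA$ on the upper and $\mathcal D=\frac{d}{dx}-iA$ on the lower semicircles. For a real sequence $\boldsymbol\alpha=(\alpha_j)_{j\in\mathbb Z}$ let $-\Delta_{\boldsymbol\alpha}$ be the operator in $L^2(\Gamma)$ acting as $-\mathcal D^2$ on each edge, whose domain consists of all $(\psi,\varphi)\in L^2(\Gamma)$ that are $H^2$ on each edge, satisfy $(\mathcal D^2\psi,\mathcal D^2\varphi)\in L^2(\Gamma)$, and obey for all $j\in\mathbb Z$ the $\delta$-coupling conditions $$\psi_j(j\pi)=\varphi_j(j\pi)=\psi_{j-1}(j\pi)=\varphi_{j-1}(j\pi),$$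 $$\mathcal D\psi_j(j\pi)+\mathcal D\varphi_j(j\pi)-\mathcal D\psi_{j-1}(j\pi)-\mathcal D\varphi_{j-1}(j\pi)=\alpha_j\,\psi_j(j\pi).$$ Let $-\Delta_\alpha$ be this operator with $\alpha_j=\alpha$ for all $j$ and, for $\gamma_1\in\mathbb R$, let $-\Delta_{\boldsymbol\alpha+\boldsymbol\gamma^{(1)}}$ be this operator with $\alpha_1=\alpha+\gamma_1$ and $\alpha_j=\alpha$ for $j\ne1$. Assume $A\notin\mathbb Z$. Then the essential spectrum of $-\Delta_{\boldsymbol\alpha+\boldsymbol\gamma^{(1)}}$ coincides with the spectrum of $-\Delta_\alpha$. Its gaps, i.e. the connected components of the complement of the essential spectrum in $\mathbb R$, form an infinite sequence $G_1,G_2,G_3,\dots$ ordered from left to right. If $\gamma_1<0$, then $-\Delta_{\boldsymbol\alpha+\boldsymbol\gamma^{(1)}}$ has precisely one eigenvalue in every odd gap $G_1,G_3,G_5,\dots$, and it is simple. If $\gamma_1>0$, then it has precisely one eigenvalue in every even gap $G_2,G_4,G_6,\dots$, and it is simple. -/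

import Mathlib

open MeasureTheory Set

noncomputable section

namespace RingChain

/-! ### The chain graph

The upper and the lower semicircles of the chain are parametrized by two copies of `ℝ`, indexed
by `Fin 2` (`0` is the upper copy, `1` the lower one). The two copies are glued at the points
`j * π`, `j : ℤ`, and the `j`-th ring consists of the two copies of `[j * π, (j + 1) * π]`. -/

/-- The coordinate of the `j`-th vertex. -/
def vertex (j : ℤ) : ℝ := j * Real.pi

/-- The coordinate interval of (either of) the two edges of the `j`-th ring. -/
def edge (j : ℤ) : Set ℝ := Icc (vertex j) (vertex (j + 1))

/-- The Hilbert space `L²(Γ) = L²(ℝ) ⊕ L²(ℝ)`. -/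
abbrev L2Graph : Type := PiLp 2 (fun _ : Fin 2 => Lp ℂ 2 (volume : Measure ℝ))

/-- The tangential component of the vector potential: `-A` on the upper semicircles and `A` on the
lower ones. -/
def potential (A : ℝ) : Fin 2 → ℝ := ![-A, A]

/-- On the `j`-th edge with potential value `a`, the function `u` is absolutely continuous and
its quasiderivative `𝒟u = u' - i a u` equals `v` almost everywhere. -/
def HasQuasiDeriv (a : ℝ) (j : ℤ) (u v : ℝ → ℂ) : Prop :=
  ContinuousOn u (edge j) ∧ IntervalIntegrable v volume (vertex j) (vertex (j + 1)) ∧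
    ∀ x ∈ edge j, u x = u (vertex j) + ∫ t in vertex j..x, (v t + Complex.I * a * u t)

/-- `(f, g)` belongs to the graph of the magnetic Laplacian with `δ`-couplings of strengths `α j`
at the vertices: on each edge `f` is represented by an `H²` function `u s j` with quasiderivative
`p s j` (both continuous up to the end points of the edge), `-𝒟² f = g`, the function is continuous
at the vertices, and the sum of the outgoing quasiderivatives at the `j`-th vertex equals `α j`
times the value there. Since `g ∈ L²(Γ)`, this forces `f ∈ H²` on each edge. -/
def IsHamiltonianPair (A : ℝ) (α : ℤ → ℝ) (f g : L2Graph) : Prop :=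
  ∃ u p : Fin 2 → ℤ → ℝ → ℂ,
    (∀ s j, (f s : ℝ → ℂ) =ᵐ[volume.restrict (edge j)] u s j) ∧
    (∀ s j, HasQuasiDeriv (potential A s) j (u s j) (p s j)) ∧
    (∀ s j, HasQuasiDeriv (potential A s) j (p s j) (fun x => -(g s : ℝ → ℂ) x)) ∧
    (∀ s j, u s j (vertex j) = u 0 j (vertex j) ∧ u s (j - 1) (vertex j) = u 0 j (vertex j)) ∧
    ∀ j, ∑ s, (p s j (vertex j) - p s (j - 1) (vertex j)) = (α j : ℂ) * u 0 j (vertex j)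

theorem vertex_lt (j : ℤ) : vertex j < vertex (j + 1) := by
  unfold vertex
  have := Real.pi_pos
  push_cast
  nlinarith

theorem HasQuasiDeriv.integrand {a : ℝ} {j : ℤ} {u v : ℝ → ℂ} (h : HasQuasiDeriv a j u v)
    {x : ℝ} (hx : x ∈ edge j) :
    IntervalIntegrable (fun t => v t + Complex.I * a * u t) volume (vertex j) x := by
  have hle := (vertex_lt j).le
  have h1 : IntervalIntegrable (fun t => v t + Complex.I * a * u t) volume
      (vertex j) (vertex (j + 1)) := by
    refine h.2.1.add ?_
    have : ContinuousOn (fun t => Complex.I * a * u t) (uIcc (vertex j) (vertex (j + 1))) := by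
      rw [uIcc_of_le hle]
      exact continuousOn_const.mul h.1
    exact this.intervalIntegrable
  refine h1.mono_set ?_
  rw [uIcc_of_le hle, uIcc_of_le hx.1]
  exact Icc_subset_Icc le_rfl hx.2

theorem HasQuasiDeriv.add {a : ℝ} {j : ℤ} {u v u' v' : ℝ → ℂ} (h : HasQuasiDeriv a j u v)
    (h' : HasQuasiDeriv a j u' v') : HasQuasiDeriv a j (u + u') (v + v') := by
  refine ⟨h.1.add h'.1, h.2.1.add h'.2.1, fun x hx => ?_⟩
  have e : ∀ t, (v + v') t + Complex.I * a * (u + u') t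
      = (v t + Complex.I * a * u t) + (v' t + Complex.I * a * u' t) := by
    intro t
    simp only [Pi.add_apply]
    ring
  simp only [e]
  rw [intervalIntegral.integral_add (h.integrand hx) (h'.integrand hx)]
  simp only [Pi.add_apply]
  rw [h.2.2 x hx, h'.2.2 x hx]
  ring

theorem HasQuasiDeriv.smul {a : ℝ} {j : ℤ} {u v : ℝ → ℂ} (c : ℂ) (h : HasQuasiDeriv a j u v) :
    HasQuasiDeriv a j (c • u) (c • v) := by
  refine ⟨h.1.const_smul c, h.2.1.smul c, fun x hx => ?_⟩
  have e : ∀ t, (c • v) t + Complex.I * a * (c • u) t = c * (v t + Complex.I * a * u t) := by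
    intro t
    simp only [Pi.smul_apply, smul_eq_mul]
    ring
  simp only [e]
  rw [intervalIntegral.integral_const_mul]
  simp only [Pi.smul_apply, smul_eq_mul]
  rw [h.2.2 x hx]
  ring

theorem HasQuasiDeriv.congr {a : ℝ} {j : ℤ} {u v v' : ℝ → ℂ} (h : HasQuasiDeriv a j u v)
    (hv : v =ᵐ[volume] v') : HasQuasiDeriv a j u v' := by
  refine ⟨h.1, h.2.1.congr_ae (ae_restrict_of_ae hv), fun x hx => ?_⟩
  rw [h.2.2 x hx]
  congr 1
  refine intervalIntegral.integral_congr_ae ?_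
  filter_upwards [hv] with t ht _
  rw [ht]

theorem HasQuasiDeriv.ae_zero {a : ℝ} {j : ℤ} {u v : ℝ → ℂ} (h : HasQuasiDeriv a j u v)
    (hu : ∀ x ∈ edge j, u x = 0) : v =ᵐ[volume.restrict (edge j)] 0 := by
  have hle := (vertex_lt j).le
  have hl : vertex j ∈ edge j := ⟨le_rfl, hle⟩
  have key : ∀ x ∈ edge j, ∫ t in vertex j..x, v t = 0 := by
    intro x hx
    have h1 := h.2.2 x hx
    rw [hu x hx, hu _ hl, zero_add] at h1
    rw [h1]
    refine intervalIntegral.integral_congr fun t ht => ?_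
    rw [uIcc_of_le hx.1] at ht
    have : u t = 0 := hu t ⟨ht.1, ht.2.trans hx.2⟩
    simp [this]
  have hd := h.2.1.ae_hasDerivAt_integral
  have hIoo : v =ᵐ[volume.restrict (Ioo (vertex j) (vertex (j + 1)))] 0 := by
    rw [Filter.EventuallyEq, ae_restrict_iff' measurableSet_Ioo]
    filter_upwards [hd] with x hx hxm
    rw [uIcc_of_le hle] at hx
    have h2 := hx (Ioo_subset_Icc_self hxm) _ hl
    refine h2.unique ((hasDerivAt_const x (0 : ℂ)).congr_of_eventuallyEq ?_)
    filter_upwards [isOpen_Ioo.mem_nhds hxm] with y hy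
    exact key y (Ioo_subset_Icc_self hy)
  have : (volume : Measure ℝ).restrict (edge j)
      = volume.restrict (Ioo (vertex j) (vertex (j + 1))) :=
    (Measure.restrict_congr_set Ioo_ae_eq_Icc).symm
  rw [this]
  exact hIoo

theorem exists_mem_edge (x : ℝ) : ∃ j, x ∈ edge j := by
  have hpi := Real.pi_pos
  refine ⟨⌊x / Real.pi⌋, ?_, ?_⟩
  · have := Int.floor_le (x / Real.pi)
    rw [le_div_iff₀ hpi] at this
    exact this
  · have := (Int.lt_floor_add_one (x / Real.pi)).le
    rw [div_le_iff₀ hpi] at this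
    simpa [vertex] using this

/-- The graph of the Hamiltonian as a subspace of `L²(Γ) × L²(Γ)`. -/
def hamiltonianGraph (A : ℝ) (α : ℤ → ℝ) : Submodule ℂ (L2Graph × L2Graph) where
  carrier := {x | IsHamiltonianPair A α x.1 x.2}
  zero_mem' := by
    refine ⟨0, 0, fun s j => ?_, fun s j => ?_, fun s j => ?_, by simp, by simp⟩
    · exact ae_restrict_of_ae (Lp.coeFn_zero ℂ 2 volume)
    · refine ⟨continuousOn_const, ?_, fun x _ => by simp⟩
      simp only [Pi.zero_apply]
      exact intervalIntegrable_const (c := (0 : ℂ))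
    · have h0 : HasQuasiDeriv (potential A s) j 0 0 := by
        refine ⟨continuousOn_const, ?_, fun x _ => by simp⟩
        exact intervalIntegrable_const (c := (0 : ℂ))
      refine h0.congr ?_
      filter_upwards [Lp.coeFn_zero ℂ 2 (volume : Measure ℝ)] with x hx
      have hx' : (((0 : L2Graph × L2Graph).2 s : Lp ℂ 2 (volume : Measure ℝ)) : ℝ → ℂ) x = 0 := hx
      rw [hx']
      simp
  add_mem' := by
    rintro ⟨f, g⟩ ⟨f', g'⟩ ⟨u, p, h1, h2, h3, h4, h5⟩ ⟨u', p', h1', h2', h3', h4', h5'⟩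
    refine ⟨u + u', p + p', fun s j => ?_, fun s j => (h2 s j).add (h2' s j), fun s j => ?_,
      fun s j => ?_, fun j => ?_⟩
    · filter_upwards [ae_restrict_of_ae (Lp.coeFn_add (f s) (f' s)), h1 s j, h1' s j]
        with x e1 e2 e3
      refine e1.trans ?_
      simp only [Pi.add_apply, e2, e3]
    · refine ((h3 s j).add (h3' s j)).congr ?_
      filter_upwards [Lp.coeFn_add (g s) (g' s)] with x e1
      have e1' : (((f, g) + (f', g') : L2Graph × L2Graph).2 s : ℝ → ℂ) x
          = (g s : ℝ → ℂ) x + (g' s : ℝ → ℂ) x := e1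
      rw [e1']
      simp only [Pi.add_apply]
      ring
    · simp only [Pi.add_apply]
      rw [(h4 s j).1, (h4 s j).2, (h4' s j).1, (h4' s j).2]
      exact ⟨rfl, rfl⟩
    · have a1 := h5 j
      have a2 := h5' j
      simp only [Fin.sum_univ_two, Pi.add_apply] at a1 a2 ⊢
      linear_combination a1 + a2
  smul_mem' := by
    rintro c ⟨f, g⟩ ⟨u, p, h1, h2, h3, h4, h5⟩
    refine ⟨c • u, c • p, fun s j => ?_, fun s j => (h2 s j).smul c, fun s j => ?_,
      fun s j => ?_, fun j => ?_⟩
    · filter_upwards [ae_restrict_of_ae (Lp.coeFn_smul c (f s)), h1 s j] with x e1 e2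
      refine e1.trans ?_
      simp only [Pi.smul_apply, e2]
    · refine ((h3 s j).smul c).congr ?_
      filter_upwards [Lp.coeFn_smul c (g s)] with x e1
      have e1' : ((c • (f, g) : L2Graph × L2Graph).2 s : ℝ → ℂ) x = c • (g s : ℝ → ℂ) x := e1
      rw [e1']
      simp
    · simp only [Pi.smul_apply]
      rw [(h4 s j).1, (h4 s j).2]
      exact ⟨rfl, rfl⟩
    · have a1 := h5 j
      simp only [Fin.sum_univ_two, Pi.smul_apply, smul_eq_mul] at a1 ⊢
      linear_combination c * a1

theorem hamiltonianGraph_single_valued (A : ℝ) (α : ℤ → ℝ) :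
    ∀ x ∈ hamiltonianGraph A α, x.1 = 0 → x.2 = 0 := by
  rintro ⟨f, g⟩ ⟨u, p, h1, h2, h3, -, -⟩ hf
  have hf' : f = 0 := hf
  subst hf'
  change g = 0
  have hu : ∀ s j, ∀ x ∈ edge j, u s j x = 0 := by
    intro s j
    have e : u s j =ᵐ[volume.restrict (edge j)] 0 :=
      (h1 s j).symm.trans (ae_restrict_of_ae (Lp.coeFn_zero ℂ 2 volume))
    exact Measure.eqOn_Icc_of_ae_eq volume (vertex_lt j).ne e (h2 s j).1 continuousOn_const
  have hp : ∀ s j, ∀ x ∈ edge j, p s j x = 0 := by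
    intro s j
    exact Measure.eqOn_Icc_of_ae_eq volume (vertex_lt j).ne ((h2 s j).ae_zero (hu s j))
      (h3 s j).1 continuousOn_const
  ext s : 1
  refine (Lp.eq_zero_iff_ae_eq_zero).2 ?_
  have hall : ∀ᵐ x, ∀ j, x ∈ edge j → -(g s : ℝ → ℂ) x = 0 := by
    rw [ae_all_iff]
    intro j
    exact (ae_restrict_iff' measurableSet_Icc).1 ((h3 s j).ae_zero (hp s j))
  filter_upwards [hall] with x hx
  obtain ⟨j, hj⟩ := exists_mem_edge x
  exact neg_eq_zero.1 (hx j hj)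

/-- The magnetic Hamiltonian of the ring chain with `δ`-couplings of strengths `α j`, as an
unbounded operator in `L²(Γ)`. -/
def hamiltonian (A : ℝ) (α : ℤ → ℝ) : L2Graph →ₗ.[ℂ] L2Graph :=
  (hamiltonianGraph A α).toLinearPMap

theorem mem_graph_hamiltonian (A : ℝ) (α : ℤ → ℝ) (f g : L2Graph) :
    (f, g) ∈ (hamiltonian A α).graph ↔ IsHamiltonianPair A α f g := by
  unfold hamiltonian
  rw [Submodule.toLinearPMap_graph_eq _ (hamiltonianGraph_single_valued A α)]
  exact Iff.rfl

/-! ### Spectral notions for unbounded operators -/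

section Spectrum

variable {H : Type*} [NormedAddCommGroup H] [NormedSpace ℂ H]

/-- The linear map `T - z` on the domain of `T`. -/
def shifted (T : H →ₗ.[ℂ] H) (z : ℂ) : T.domain →ₗ[ℂ] H := T.toFun - z • T.domain.subtype

/-- The spectrum: the set of `z` for which `T - z` is not a bijection from the domain of `T` onto
the whole space with a bounded inverse. -/
def spectrumSet (T : H →ₗ.[ℂ] H) : Set ℂ :=
  {z | ¬ (Function.Bijective (shifted T z) ∧
    ∃ C : ℝ, ∀ x : T.domain, ‖(x : H)‖ ≤ C * ‖shifted T z x‖)}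

/-- The eigenspace of `T` for `z` (the zero space if `z` is not an eigenvalue). -/
def eigenspace (T : H →ₗ.[ℂ] H) (z : ℂ) : Submodule ℂ T.domain := LinearMap.ker (shifted T z)

/-- The essential spectrum: the set of `z` for which `T - z` is not a Fredholm operator, that is,
its kernel has infinite dimension, or its range is not closed or has infinite codimension. For a
self-adjoint operator it is the spectrum without the isolated eigenvalues of finite multiplicity. -/
def essentialSpectrum (T : H →ₗ.[ℂ] H) : Set ℂ :=
  {z | ¬ (FiniteDimensional ℂ (LinearMap.ker (shifted T z)) ∧
    IsClosed (LinearMap.range (shifted T z) : Set H) ∧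
    FiniteDimensional ℂ (H ⧸ LinearMap.range (shifted T z)))}

/-- There is precisely one eigenvalue of `T` in the set `G` of real numbers, and it is simple. -/
def HasUniqueSimpleEigenvalueIn (T : H →ₗ.[ℂ] H) (G : Set ℝ) : Prop :=
  ∃ E ∈ G, Module.finrank ℂ (eigenspace T (E : ℂ)) = 1 ∧
    ∀ E' ∈ G, eigenspace T (E' : ℂ) ≠ ⊥ → E' = E

end Spectrum

/-- The gaps of `S ⊆ ℂ` on the real line: the connected components of `ℝ \ S`. -/
def IsGap (S : Set ℂ) (G : Set ℝ) : Prop :=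
  ∃ x : ℝ, (x : ℂ) ∉ S ∧ G = connectedComponentIn {y : ℝ | (y : ℂ) ∉ S} x

/-- `G 0, G 1, G 2, …` is the list of all gaps of `S`, ordered from the left to the right; thus
`G n` is the gap number `n + 1`. -/
def IsGapEnumeration (S : Set ℂ) (G : ℕ → Set ℝ) : Prop :=
  (∀ I : Set ℝ, IsGap S I ↔ ∃ n, I = G n) ∧
    ∀ m n, m < n → ∀ x ∈ G m, ∀ y ∈ G n, x < y

/-- The constant sequence of coupling strengths `α`. -/
def periodicCoupling (α : ℝ) : ℤ → ℝ := fun _ => α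

/-- The coupling strengths with a single impurity of strength `γ` at the vertex number `1`. -/
def impurityCoupling (α γ : ℝ) : ℤ → ℝ := fun j => if j = 1 then α + γ else α

end RingChain

end

open MeasureTheory Set

noncomputable section

namespace RingChain

section Edge

/-! ### Integration by parts for primitives of integrable functions -/

theorem absolutelyContinuousOnInterval_primitive {f : ℝ → ℂ} {a b c : ℝ}
    (hf : IntervalIntegrable f volume a b) (hc : c ∈ uIcc a b) :
    AbsolutelyContinuousOnInterval (fun x => ∫ t in c..x, f t) a b := by
  have hconst : ∀ w : ℂ, AbsolutelyContinuousOnInterval (fun _ : ℝ => w) a b := fun w =>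
    (LipschitzOnWith.of_dist_le_mul (K := 0) (by simp)).absolutelyContinuousOnInterval
  have hre : IntervalIntegrable (fun t => (f t).re) volume a b :=
    ⟨hf.1.re, hf.2.re⟩
  have him : IntervalIntegrable (fun t => (f t).im) volume a b :=
    ⟨hf.1.im, hf.2.im⟩
  have h1 := (hre.absolutelyContinuousOnInterval_intervalIntegral hc).smul (hconst 1)
  have h2 := (him.absolutelyContinuousOnInterval_intervalIntegral hc).smul (hconst Complex.I)
  have h3 := h1.add h2
  rw [absolutelyContinuousOnInterval_iff] at h3 ⊢
  intro ε hε
  obtain ⟨δ, hδ, h⟩ := h3 ε hε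
  refine ⟨δ, hδ, fun E hE hlt => ?_⟩
  have key : ∀ x ∈ uIcc a b, (∫ t in c..x, f t) = ((fun x => ∫ t in c..x, (f t).re) •
      (fun _ : ℝ => (1 : ℂ)) + (fun x => ∫ t in c..x, (f t).im) • (fun _ : ℝ => Complex.I)) x := by
    intro x hx
    have hfx : IntervalIntegrable f volume c x := hf.mono_set (uIcc_subset_uIcc hc hx)
    have e1 := Complex.reCLM.intervalIntegral_comp_comm hfx
    have e2 := Complex.imCLM.intervalIntegral_comp_comm hfx
    simp only [Complex.reCLM_apply, Complex.imCLM_apply] at e1 e2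
    apply Complex.ext <;> simp [e1, e2]
  refine lt_of_eq_of_lt ?_ (h E hE hlt)
  refine Finset.sum_congr rfl fun i hi => ?_
  rw [key _ (hE.1 i hi).1, key _ (hE.1 i hi).2]

theorem primitive_mul_eq {a b : ℝ} (hab : a ≤ b) {m χ χ' U : ℝ → ℂ}
    (hm : IntervalIntegrable m volume a b) (hχ : ∀ x, HasDerivAt χ (χ' x) x)
    (hχ' : Continuous χ') (hU : ∀ x ∈ Icc a b, U x = U a + ∫ t in a..x, m t)
    {y : ℝ} (hy : y ∈ Icc a b) :
    χ y * U y = χ a * U a + ∫ t in a..y, (χ' t * U t + χ t * m t) := by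
  have hu : uIcc a b = Icc a b := uIcc_of_le hab
  have ha : a ∈ uIcc a b := left_mem_uIcc
  have hχc : Continuous χ := continuous_iff_continuousAt.2 fun x => (hχ x).continuousAt
  have hχac : AbsolutelyContinuousOnInterval χ a b := by
    refine ContDiffOn.absolutelyContinuousOnInterval (ContDiff.contDiffOn ?_)
    rw [contDiff_one_iff_deriv]
    refine ⟨fun x => (hχ x).differentiableAt, ?_⟩
    rwa [show deriv χ = χ' from funext fun x => (hχ x).deriv]
  have hconst : AbsolutelyContinuousOnInterval (fun _ : ℝ => U a) a b :=
    (LipschitzOnWith.of_dist_le_mul (K := 0) (by simp)).absolutelyContinuousOnInterval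
  have hVac := hconst.add (absolutelyContinuousOnInterval_primitive hm ha)
  set V : ℝ → ℂ := (fun _ : ℝ => U a) + fun x => ∫ t in a..x, m t with hV
  have hVU : ∀ x ∈ Icc a b, V x = U x := fun x hx => (hU x hx).symm
  have hint : IntervalIntegrable (fun t => χ' t * V t + χ t * m t) volume a b :=
    ((hχ'.continuousOn.mul hVac.continuousOn).intervalIntegrable).add
      (hm.continuousOn_mul hχc.continuousOn)
  have hD := (hχac.smul hVac).sub (absolutelyContinuousOnInterval_primitive hint ha)
  obtain ⟨K, hK⟩ := hD.const_of_ae_hasDerivAt_zero (by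
    filter_upwards [hm.ae_hasDerivAt_integral, hint.ae_hasDerivAt_integral] with x h1 h2 hx
    have e1 : HasDerivAt V (m x) x := (h1 hx a ha).const_add (U a)
    have e2 := ((hχ x).mul e1).sub (h2 hx a ha)
    rw [sub_self] at e2
    exact e2)
  have k1 := hK y (hu ▸ hy)
  have k2 := hK a ha
  simp only [Pi.sub_apply, smul_eq_mul, Pi.mul_apply, intervalIntegral.integral_same,
    sub_zero] at k1 k2
  have hVa : V a = U a := hVU a ⟨le_rfl, hab⟩
  rw [hVa] at k2
  rw [hVU y hy, ← k2] at k1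
  have : ∫ t in a..y, (χ' t * U t + χ t * m t) = ∫ t in a..y, (χ' t * V t + χ t * m t) := by
    refine intervalIntegral.integral_congr fun t ht => ?_
    rw [uIcc_of_le hy.1] at ht
    rw [hVU t ⟨ht.1, ht.2.trans hy.2⟩]
  rw [this, ← k1]
  ring

/-! ### Gauge phases and the fundamental solutions -/

/-- The gauge factor `exp (-i a x)`. -/
def phase (a x : ℝ) : ℂ := Complex.exp (-(Complex.I * a * x))

@[simp] theorem phase_zero (a : ℝ) : phase a 0 = 1 := by simp [phase]

@[simp] theorem norm_phase (a x : ℝ) : ‖phase a x‖ = 1 := by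
  rw [phase, show -(Complex.I * a * x) = ((-(a * x) : ℝ) : ℂ) * Complex.I by push_cast; ring]
  exact Complex.norm_exp_ofReal_mul_I _

theorem phase_neg_mul (a x : ℝ) : phase (-a) x * phase a x = 1 := by
  rw [phase, phase, ← Complex.exp_add]
  simp

theorem phase_ne_zero (a x : ℝ) : phase a x ≠ 0 := Complex.exp_ne_zero _

theorem hasDerivAt_phase (a v x : ℝ) :
    HasDerivAt (fun t => phase a (t - v)) (-(Complex.I * a) * phase a (x - v)) x := by
  have h1 : HasDerivAt (fun t : ℝ => ((t - v : ℝ) : ℂ)) 1 x :=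
    ((hasDerivAt_id x).sub_const v).ofReal_comp
  have h2 := (h1.const_mul (-(Complex.I * a))).cexp
  have e : ∀ t : ℝ, phase a (t - v) = Complex.exp (-(Complex.I * a) * ((t - v : ℝ) : ℂ)) := by
    intro t
    rw [phase, neg_mul]
  simp only [e]
  refine h2.congr_deriv ?_
  ring

theorem continuous_phase (a : ℝ) : Continuous (phase a) := by
  unfold phase
  fun_prop

/-- A square root of `z`. -/
def root (z : ℂ) : ℂ := (IsAlgClosed.exists_pow_nat_eq z two_pos).choose

theorem root_sq (z : ℂ) : root z ^ 2 = z := (IsAlgClosed.exists_pow_nat_eq z two_pos).choose_spec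

/-- The solution of `-w'' = z w` with `w 0 = 1`, `w' 0 = 0`. -/
def csol (z : ℂ) (x : ℝ) : ℂ := Complex.cos (root z * x)

/-- The solution of `-w'' = z w` with `w 0 = 0`, `w' 0 = 1`. -/
def ssol (z : ℂ) (x : ℝ) : ℂ := if root z = 0 then x else Complex.sin (root z * x) / root z

theorem root_mul_ssol (z : ℂ) (x : ℝ) : root z * ssol z x = Complex.sin (root z * x) := by
  unfold ssol
  split_ifs with h
  · simp [h]
  · field_simp

@[simp] theorem csol_zero (z : ℂ) : csol z 0 = 1 := by simp [csol]

@[simp] theorem ssol_zero (z : ℂ) : ssol z 0 = 0 := by simp [ssol]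

theorem csol_eq {z k : ℂ} (h : k ^ 2 = z) (x : ℝ) : csol z x = Complex.cos (k * x) := by
  rcases sq_eq_sq_iff_eq_or_eq_neg.1 ((root_sq z).trans h.symm) with h | h <;> simp [csol, h]

theorem ssol_eq {z k : ℂ} (h : k ^ 2 = z) (x : ℝ) : k * ssol z x = Complex.sin (k * x) := by
  rcases sq_eq_sq_iff_eq_or_eq_neg.1 ((root_sq z).trans h.symm) with h | h
  · rw [← h, root_mul_ssol]
  · have := root_mul_ssol z x
    rw [h] at this
    simpa using this

theorem csol_sq_add (z : ℂ) (x : ℝ) : csol z x ^ 2 + z * ssol z x ^ 2 = 1 := by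
  have h := root_mul_ssol z x
  have h2 := Complex.sin_sq_add_cos_sq (root z * x)
  rw [← h, mul_pow, root_sq] at h2
  rw [csol, add_comm]
  exact h2

theorem hasDerivAt_csol (z : ℂ) (x : ℝ) : HasDerivAt (csol z) (-(z * ssol z x)) x := by
  have h1 : HasDerivAt (fun t : ℂ => root z * t) (root z * 1) x :=
    (hasDerivAt_id (x : ℂ)).const_mul _
  refine h1.ccos.comp_ofReal.congr_deriv ?_
  rw [← root_mul_ssol]
  linear_combination (-ssol z x) * root_sq z

theorem hasDerivAt_ssol (z : ℂ) (x : ℝ) : HasDerivAt (ssol z) (csol z x) x := by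
  have h1 : HasDerivAt (fun t : ℂ => root z * t) (root z * 1) x :=
    (hasDerivAt_id (x : ℂ)).const_mul _
  by_cases h : root z = 0
  · have e : ssol z = fun t : ℝ => (t : ℂ) := by
      funext t
      simp [ssol, h]
    rw [e, csol, h, zero_mul, Complex.cos_zero]
    exact (hasDerivAt_id x).ofReal_comp
  · have e : ssol z = fun t : ℝ => Complex.sin (root z * t) / root z := by
      funext t
      simp [ssol, h]
    rw [e]
    refine (h1.csin.div_const (root z)).comp_ofReal.congr_deriv ?_
    rw [csol]
    field_simp

theorem continuous_csol (z : ℂ) : Continuous (csol z) :=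
  continuous_iff_continuousAt.2 fun x => (hasDerivAt_csol z x).continuousAt

theorem continuous_ssol (z : ℂ) : Continuous (ssol z) :=
  continuous_iff_continuousAt.2 fun x => (hasDerivAt_ssol z x).continuousAt

/-! ### Solutions on a single edge -/

theorem left_mem_edge (j : ℤ) : vertex j ∈ edge j := ⟨le_rfl, (vertex_lt j).le⟩

theorem right_mem_edge (j : ℤ) : vertex (j + 1) ∈ edge j := ⟨(vertex_lt j).le, le_rfl⟩

theorem vertex_succ_sub (j : ℤ) : vertex (j + 1) - vertex j = Real.pi := by
  unfold vertex
  push_cast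
  ring

theorem HasQuasiDeriv.by_parts {a : ℝ} {j : ℤ} {u v χ χ' : ℝ → ℂ} (h : HasQuasiDeriv a j u v)
    (hχ : ∀ x, HasDerivAt χ (χ' x) x) (hχ' : Continuous χ') {y : ℝ} (hy : y ∈ edge j) :
    phase a (y - vertex j) * u y * χ y = u (vertex j) * χ (vertex j) +
      ∫ t in vertex j..y, phase a (t - vertex j) * (v t * χ t + u t * χ' t) := by
  have hχc : Continuous χ := continuous_iff_continuousAt.2 fun x => (hχ x).continuousAt
  have hp : Continuous fun t => phase a (t - vertex j) :=
    (continuous_phase a).comp (continuous_id.sub continuous_const)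
  have key := primitive_mul_eq (vertex_lt j).le (h.integrand (right_mem_edge j))
    (χ := fun t => phase a (t - vertex j) * χ t)
    (χ' := fun t => -(Complex.I * a) * phase a (t - vertex j) * χ t + phase a (t - vertex j) * χ' t)
    (fun x => (hasDerivAt_phase a (vertex j) x).mul (hχ x)) (by fun_prop) h.2.2 hy
  simp only [sub_self, phase_zero, one_mul] at key
  calc phase a (y - vertex j) * u y * χ y = phase a (y - vertex j) * χ y * u y := by ring
    _ = _ := by
      rw [key, mul_comm (χ _)]
      congr 1
      refine intervalIntegral.integral_congr fun t _ => ?_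
      ring

theorem HasQuasiDeriv.congr_edge {a : ℝ} {j : ℤ} {u v v' : ℝ → ℂ} (h : HasQuasiDeriv a j u v)
    (hv : v =ᵐ[volume.restrict (edge j)] v') : HasQuasiDeriv a j u v' := by
  have hv2 : ∀ᵐ x, x ∈ edge j → v x = v' x := (ae_restrict_iff' measurableSet_Icc).1 hv
  refine ⟨h.1, h.2.1.congr_ae ?_, fun x hx => ?_⟩
  · rw [uIoc_of_le (vertex_lt j).le]
    exact ae_restrict_of_ae_restrict_of_subset Ioc_subset_Icc_self hv
  · rw [h.2.2 x hx]
    congr 1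
    refine intervalIntegral.integral_congr_ae ?_
    filter_upwards [hv2] with t ht htm
    rw [uIoc_of_le hx.1] at htm
    rw [ht ⟨htm.1.le, htm.2.trans hx.2⟩]

theorem HasQuasiDeriv.source_integrable {a : ℝ} {j : ℤ} {z : ℂ} {u p h : ℝ → ℂ}
    (hu : ContinuousOn u (edge j)) (hp : HasQuasiDeriv a j p fun x => -(z * u x + h x)) :
    IntervalIntegrable h volume (vertex j) (vertex (j + 1)) := by
  have h1 : IntervalIntegrable (fun x => z * u x) volume (vertex j) (vertex (j + 1)) := by
    refine ContinuousOn.intervalIntegrable ?_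
    rw [uIcc_of_le (vertex_lt j).le]
    exact continuousOn_const.mul hu
  refine (hp.2.1.neg.sub h1).congr_ae (ae_of_all _ fun x => ?_)
  simp

variable {a : ℝ} {j : ℤ} {z : ℂ} {u p h : ℝ → ℂ}

theorem intervalIntegrable_sub_edge {m : ℝ → ℂ} {y : ℝ}
    (hm : IntervalIntegrable m volume (vertex j) (vertex (j + 1))) (hy : y ∈ edge j) :
    IntervalIntegrable m volume (vertex j) y := by
  refine hm.mono_set ?_
  rw [uIcc_of_le (vertex_lt j).le, uIcc_of_le hy.1]
  exact Icc_subset_Icc le_rfl hy.2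

theorem solution_value (hu : HasQuasiDeriv a j u p)
    (hp : HasQuasiDeriv a j p fun x => -(z * u x + h x)) {y : ℝ} (hy : y ∈ edge j) :
    phase a (y - vertex j) * u y = u (vertex j) * csol z (y - vertex j)
      + p (vertex j) * ssol z (y - vertex j)
      - ∫ t in vertex j..y, phase a (t - vertex j) * h t * ssol z (y - t) := by
  have hc := continuous_csol z
  have hs := continuous_ssol z
  have hph := continuous_phase a
  have dsub : ∀ x : ℝ, HasDerivAt (fun t => y - t) (-1) x := fun x =>
    (hasDerivAt_id x).const_sub y
  have k1 := hu.by_parts (χ := fun t => csol z (y - t)) (χ' := fun t => z * ssol z (y - t))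
    (fun x => ((hasDerivAt_csol z (y - x)).scomp x (dsub x)).congr_deriv (by simp))
    (by fun_prop) hy
  have k2 := hp.by_parts (χ := fun t => ssol z (y - t)) (χ' := fun t => -csol z (y - t))
    (fun x => ((hasDerivAt_ssol z (y - x)).scomp x (dsub x)).congr_deriv (by simp))
    (by fun_prop) hy
  simp only [sub_self, csol_zero, ssol_zero, mul_one, mul_zero] at k1 k2
  have hh := intervalIntegrable_sub_edge (hp.source_integrable hu.1) hy
  have hsrc : IntervalIntegrable (fun t => phase a (t - vertex j) * h t * ssol z (y - t)) volume
      (vertex j) y := by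
    refine (hh.continuousOn_mul (g := fun t => phase a (t - vertex j))
      (by fun_prop)).mul_continuousOn (by fun_prop)
  have hpi : IntervalIntegrable p volume (vertex j) y := intervalIntegrable_sub_edge hu.2.1 hy
  have hui : IntervalIntegrable u volume (vertex j) y := by
    refine intervalIntegrable_sub_edge (ContinuousOn.intervalIntegrable ?_) hy
    rw [uIcc_of_le (vertex_lt j).le]
    exact hu.1
  have i1 : IntervalIntegrable (fun t => phase a (t - vertex j) *
      (p t * csol z (y - t) + u t * (z * ssol z (y - t)))) volume (vertex j) y :=
    (((hpi.mul_continuousOn (by fun_prop)).add (hui.mul_continuousOn (by fun_prop)))).continuousOn_mul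
      (by fun_prop)
  have e : (∫ t in vertex j..y, phase a (t - vertex j) *
      (-(z * u t + h t) * ssol z (y - t) + p t * -csol z (y - t))) =
      -((∫ t in vertex j..y, phase a (t - vertex j) *
      (p t * csol z (y - t) + u t * (z * ssol z (y - t)))) +
      ∫ t in vertex j..y, phase a (t - vertex j) * h t * ssol z (y - t)) := by
    rw [← intervalIntegral.integral_add i1 hsrc, ← intervalIntegral.integral_neg]
    refine intervalIntegral.integral_congr fun t _ => ?_
    ring
  rw [e] at k2
  linear_combination k1 + k2

theorem solution_deriv (hu : HasQuasiDeriv a j u p)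
    (hp : HasQuasiDeriv a j p fun x => -(z * u x + h x)) {y : ℝ} (hy : y ∈ edge j) :
    phase a (y - vertex j) * p y = -(z * u (vertex j) * ssol z (y - vertex j))
      + p (vertex j) * csol z (y - vertex j)
      - ∫ t in vertex j..y, phase a (t - vertex j) * h t * csol z (y - t) := by
  have hc := continuous_csol z
  have hs := continuous_ssol z
  have hph := continuous_phase a
  have dsub : ∀ x : ℝ, HasDerivAt (fun t => y - t) (-1) x := fun x =>
    (hasDerivAt_id x).const_sub y
  have k1 := hp.by_parts (χ := fun t => csol z (y - t)) (χ' := fun t => z * ssol z (y - t))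
    (fun x => ((hasDerivAt_csol z (y - x)).scomp x (dsub x)).congr_deriv (by simp))
    (by fun_prop) hy
  have k2 := hu.by_parts (χ := fun t => ssol z (y - t)) (χ' := fun t => -csol z (y - t))
    (fun x => ((hasDerivAt_ssol z (y - x)).scomp x (dsub x)).congr_deriv (by simp))
    (by fun_prop) hy
  simp only [sub_self, csol_zero, ssol_zero, mul_one, mul_zero] at k1 k2
  have hh := intervalIntegrable_sub_edge (hp.source_integrable hu.1) hy
  have hsrc : IntervalIntegrable (fun t => phase a (t - vertex j) * h t * csol z (y - t)) volume
      (vertex j) y := by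
    refine (hh.continuousOn_mul (g := fun t => phase a (t - vertex j))
      (by fun_prop)).mul_continuousOn (by fun_prop)
  have hpi : IntervalIntegrable p volume (vertex j) y := intervalIntegrable_sub_edge hu.2.1 hy
  have hui : IntervalIntegrable u volume (vertex j) y := by
    refine intervalIntegrable_sub_edge (ContinuousOn.intervalIntegrable ?_) hy
    rw [uIcc_of_le (vertex_lt j).le]
    exact hu.1
  have i1 : IntervalIntegrable (fun t => phase a (t - vertex j) *
      (p t * ssol z (y - t) + u t * -csol z (y - t))) volume (vertex j) y :=
    (((hpi.mul_continuousOn (by fun_prop)).add (hui.mul_continuousOn (by fun_prop)))).continuousOn_mul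
      (by fun_prop)
  have e : (∫ t in vertex j..y, phase a (t - vertex j) *
      (-(z * u t + h t) * csol z (y - t) + p t * (z * ssol z (y - t)))) =
      z * (∫ t in vertex j..y, phase a (t - vertex j) *
      (p t * ssol z (y - t) + u t * -csol z (y - t))) -
      ∫ t in vertex j..y, phase a (t - vertex j) * h t * csol z (y - t) := by
    rw [← intervalIntegral.integral_const_mul,
      ← intervalIntegral.integral_sub (i1.const_mul z) hsrc]
    refine intervalIntegral.integral_congr fun t _ => ?_
    ring
  rw [e] at k1
  linear_combination k1 - z * k2

/-- The initial value problem on an edge is solvable for integrable sources. -/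
theorem exists_solution (a : ℝ) (j : ℤ) (z P q : ℂ) {h : ℝ → ℂ}
    (hh : IntervalIntegrable h volume (vertex j) (vertex (j + 1))) :
    ∃ u p : ℝ → ℂ, HasQuasiDeriv a j u p ∧ (HasQuasiDeriv a j p fun x => -(z * u x + h x)) ∧
      u (vertex j) = P ∧ p (vertex j) = q := by
  have hc := continuous_csol z
  have hs := continuous_ssol z
  have hph := continuous_phase a
  have hph' := continuous_phase (-a)
  set v := vertex j with hv
  set m₁ : ℝ → ℂ := fun t => phase a (t - v) * h t * ssol z (t - v) with hm₁
  set m₂ : ℝ → ℂ := fun t => -(phase a (t - v) * h t * csol z (t - v)) with hm₂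
  have hm₁i : IntervalIntegrable m₁ volume v (vertex (j + 1)) :=
    (hh.continuousOn_mul (g := fun t => phase a (t - v)) (by fun_prop)).mul_continuousOn
      (by fun_prop)
  have hm₂i : IntervalIntegrable m₂ volume v (vertex (j + 1)) :=
    ((hh.continuousOn_mul (g := fun t => phase a (t - v)) (by fun_prop)).mul_continuousOn
      (by fun_prop)).neg
  set H₁ : ℝ → ℂ := fun x => P + ∫ t in v..x, m₁ t with hH₁
  set H₂ : ℝ → ℂ := fun x => q + ∫ t in v..x, m₂ t with hH₂
  have hu : uIcc v (vertex (j + 1)) = edge j := uIcc_of_le (vertex_lt j).le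
  have hH₁c : ContinuousOn H₁ (edge j) := by
    rw [← hu]
    exact continuousOn_const.add
      (absolutelyContinuousOnInterval_primitive hm₁i left_mem_uIcc).continuousOn
  have hH₂c : ContinuousOn H₂ (edge j) := by
    rw [← hu]
    exact continuousOn_const.add
      (absolutelyContinuousOnInterval_primitive hm₂i left_mem_uIcc).continuousOn
  have hH₁v : H₁ v = P := by simp [hH₁]
  have hH₂v : H₂ v = q := by simp [hH₂]
  have dph : ∀ x, HasDerivAt (fun t => phase (-a) (t - v))
      (Complex.I * a * phase (-a) (x - v)) x := fun x =>
    (hasDerivAt_phase (-a) v x).congr_deriv (by push_cast; ring)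
  have dc : ∀ x, HasDerivAt (fun t => csol z (t - v)) (-(z * ssol z (x - v))) x := fun x =>
    (hasDerivAt_csol z (x - v)).comp_sub_const x v
  have ds : ∀ x, HasDerivAt (fun t => ssol z (t - v)) (csol z (x - v)) x := fun x =>
    (hasDerivAt_ssol z (x - v)).comp_sub_const x v
  set u : ℝ → ℂ := fun x => phase (-a) (x - v) * csol z (x - v) * H₁ x
    + phase (-a) (x - v) * ssol z (x - v) * H₂ x with hudef
  set p : ℝ → ℂ := fun x => phase (-a) (x - v) * -(z * ssol z (x - v)) * H₁ x
    + phase (-a) (x - v) * csol z (x - v) * H₂ x with hpdef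
  have huc : ContinuousOn u (edge j) := by fun_prop
  have hpc : ContinuousOn p (edge j) := by fun_prop
  have huv : u v = P := by simp [hudef, hH₁v]
  have hpv : p v = q := by simp [hpdef, hH₂v]
  have prod : ∀ (ζ ζ' m : ℝ → ℂ) (H : ℝ → ℂ), (∀ x, HasDerivAt ζ (ζ' x) x) → Continuous ζ' →
      IntervalIntegrable m volume v (vertex (j + 1)) → ContinuousOn H (edge j) →
      (∀ x ∈ edge j, H x = H v + ∫ t in v..x, m t) → ∀ y ∈ edge j,
      IntervalIntegrable (fun t => (Complex.I * a * phase (-a) (t - v) * ζ t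
        + phase (-a) (t - v) * ζ' t) * H t + phase (-a) (t - v) * ζ t * m t) volume v y ∧
      phase (-a) (y - v) * ζ y * H y = ζ v * H v + ∫ t in v..y, ((Complex.I * a *
        phase (-a) (t - v) * ζ t + phase (-a) (t - v) * ζ' t) * H t
        + phase (-a) (t - v) * ζ t * m t) := by
    intro ζ ζ' m H hζ hζ' hm hHc hH y hy
    have hζc : Continuous ζ := continuous_iff_continuousAt.2 fun x => (hζ x).continuousAt
    constructor
    · refine intervalIntegrable_sub_edge ?_ hy
      refine (ContinuousOn.intervalIntegrable ?_).add (hm.continuousOn_mul (by fun_prop))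
      rw [hu]
      fun_prop
    · have := primitive_mul_eq (vertex_lt j).le hm (χ := fun t => phase (-a) (t - v) * ζ t)
        (χ' := fun t => Complex.I * a * phase (-a) (t - v) * ζ t + phase (-a) (t - v) * ζ' t)
        (fun x => (dph x).mul (hζ x)) (by fun_prop) hH hy
      simpa only [← hv, sub_self, phase_zero, one_mul] using this
  have hH₁r : ∀ x ∈ edge j, H₁ x = H₁ v + ∫ t in v..x, m₁ t := fun x _ => by rw [hH₁v]
  have hH₂r : ∀ x ∈ edge j, H₂ x = H₂ v + ∫ t in v..x, m₂ t := fun x _ => by rw [hH₂v]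
  refine ⟨u, p, ⟨huc, ?_, fun y hy => ?_⟩, ⟨hpc, ?_, fun y hy => ?_⟩, huv, hpv⟩
  · rw [← hu] at hpc
    exact hpc.intervalIntegrable
  · obtain ⟨i1, e1⟩ := prod _ _ m₁ H₁ dc (by fun_prop) hm₁i hH₁c hH₁r y hy
    obtain ⟨i2, e2⟩ := prod _ _ m₂ H₂ ds (by fun_prop) hm₂i hH₂c hH₂r y hy
    change _ + _ = _
    rw [e1, e2]
    change _ = u v + _
    rw [huv, hH₁v, hH₂v, sub_self, csol_zero, ssol_zero, one_mul, zero_mul, zero_add, add_assoc,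
      ← intervalIntegral.integral_add i1 i2]
    congr 1
    refine intervalIntegral.integral_congr fun t _ => ?_
    simp only [hudef, hpdef, hm₁, hm₂]
    ring
  · refine (IntervalIntegrable.add (ContinuousOn.intervalIntegrable (u := fun x => z * u x) ?_)
      hh).neg
    rw [hu]
    fun_prop
  · obtain ⟨i1, e1⟩ := prod (fun t => -(z * ssol z (t - v))) _ m₁ H₁
      (fun x => ((ds x).const_mul z).neg) (by fun_prop) hm₁i hH₁c hH₁r y hy
    obtain ⟨i2, e2⟩ := prod _ _ m₂ H₂ dc (by fun_prop) hm₂i hH₂c hH₂r y hy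
    change _ + _ = _
    rw [e1, e2]
    change _ = p v + _
    rw [hpv, hH₁v, hH₂v, sub_self, csol_zero, ssol_zero, one_mul, mul_zero, neg_zero, zero_mul,
      zero_add, add_left_comm, ← intervalIntegral.integral_add i1 i2]
    congr 1
    refine intervalIntegral.integral_congr fun t _ => ?_
    simp only [hudef, hpdef, hm₁, hm₂]
    have k1 := phase_neg_mul a (t - v)
    have k2 := csol_sq_add z (t - v)
    linear_combination (-h t * (csol z (t - v) ^ 2 + z * ssol z (t - v) ^ 2)) * k1 - h t * k2

end Edge

/-! ### Square integrals over edges -/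

/-- The square integral of the component `s` of `f` over the `j`-th edge. -/
def edgeSq (f : L2Graph) (s : Fin 2) (j : ℤ) : ℝ := ∫ x in edge j, ‖(f s : ℝ → ℂ) x‖ ^ 2

theorem measurableSet_edge (j : ℤ) : MeasurableSet (edge j) := measurableSet_Icc

theorem isCompact_edge (j : ℤ) : IsCompact (edge j) := isCompact_Icc

theorem volume_real_edge (j : ℤ) : (volume : Measure ℝ).real (edge j) = Real.pi := by
  rw [edge, Real.volume_real_Icc_of_le (vertex_lt j).le, vertex_succ_sub]

theorem edge_ae_eq_Ico (j : ℤ) : edge j =ᵐ[volume] Ico (vertex j) (vertex (j + 1)) :=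
  Ico_ae_eq_Icc.symm

theorem iUnion_Ico_vertex : ⋃ j : ℤ, Ico (vertex j) (vertex (j + 1)) = univ := by
  have := iUnion_Ico_zsmul Real.pi_pos
  simpa [vertex] using this

theorem pairwise_disjoint_Ico_vertex :
    Pairwise (Function.onFun Disjoint fun j : ℤ => Ico (vertex j) (vertex (j + 1))) := by
  have := pairwise_disjoint_Ico_zsmul Real.pi
  simpa [vertex] using this

theorem memLp_coe (g : Lp ℂ 2 (volume : Measure ℝ)) : MemLp (g : ℝ → ℂ) 2 volume := Lp.memLp g

theorem integrable_sq (g : Lp ℂ 2 (volume : Measure ℝ)) :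
    Integrable (fun x => ‖(g : ℝ → ℂ) x‖ ^ 2) volume :=
  (memLp_two_iff_integrable_sq_norm (memLp_coe g).1).1 (memLp_coe g)

theorem norm_sq_eq_integral (g : Lp ℂ 2 (volume : Measure ℝ)) :
    ‖g‖ ^ 2 = ∫ x, ‖(g : ℝ → ℂ) x‖ ^ 2 := by
  have h := L2.inner_def (𝕜 := ℂ) g g
  rw [inner_self_eq_norm_sq_to_K] at h
  simp only [inner_self_eq_norm_sq_to_K] at h
  have h2 : ((‖g‖ ^ 2 : ℝ) : ℂ) = ((∫ x, ‖(g : ℝ → ℂ) x‖ ^ 2 : ℝ) : ℂ) := by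
    rw [← integral_complex_ofReal]
    push_cast
    exact h
  exact_mod_cast h2

theorem hasSum_edge_sq (g : Lp ℂ 2 (volume : Measure ℝ)) :
    HasSum (fun j : ℤ => ∫ x in edge j, ‖(g : ℝ → ℂ) x‖ ^ 2) (‖g‖ ^ 2) := by
  have h := hasSum_integral_iUnion (μ := volume) (f := fun x => ‖(g : ℝ → ℂ) x‖ ^ 2)
    (fun j : ℤ => measurableSet_Ico) pairwise_disjoint_Ico_vertex (integrable_sq g).integrableOn
  rw [iUnion_Ico_vertex, Measure.restrict_univ, ← norm_sq_eq_integral] at h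
  rwa [← funext fun j => setIntegral_congr_set (edge_ae_eq_Ico j)] at h

theorem hasSum_edgeSq (f : L2Graph) : HasSum (fun j => ∑ s, edgeSq f s j) (‖f‖ ^ 2) := by
  rw [PiLp.norm_sq_eq_of_L2]
  exact hasSum_sum fun s _ => hasSum_edge_sq (f s)

theorem edgeSq_nonneg (f : L2Graph) (s : Fin 2) (j : ℤ) : 0 ≤ edgeSq f s j :=
  integral_nonneg fun _ => sq_nonneg _

theorem edgeSq_le_sum (f : L2Graph) (s : Fin 2) (j : ℤ) : edgeSq f s j ≤ ∑ s, edgeSq f s j :=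
  Finset.single_le_sum (f := fun s => edgeSq f s j) (fun s _ => edgeSq_nonneg f s j)
    (Finset.mem_univ s)

theorem integrableOn_edge (g : Lp ℂ 2 (volume : Measure ℝ)) (j : ℤ) :
    IntegrableOn (g : ℝ → ℂ) (edge j) volume := by
  have hfin : IsFiniteMeasure (volume.restrict (edge j)) :=
    ⟨by rw [Measure.restrict_apply_univ]; exact (isCompact_edge j).measure_lt_top⟩
  exact ((memLp_coe g).restrict (edge j)).integrable (by norm_num)

theorem intervalIntegrable_edge (g : Lp ℂ 2 (volume : Measure ℝ)) (j : ℤ) :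
    IntervalIntegrable (g : ℝ → ℂ) volume (vertex j) (vertex (j + 1)) := by
  rw [intervalIntegrable_iff, uIoc_of_le (vertex_lt j).le]
  exact (integrableOn_edge g j).mono_set Ioc_subset_Icc_self

theorem sq_integral_norm_le {h : ℝ → ℂ} {j : ℤ} (h1 : IntegrableOn h (edge j) volume)
    (h2 : IntegrableOn (fun x => ‖h x‖ ^ 2) (edge j) volume) :
    (∫ x in edge j, ‖h x‖) ^ 2 ≤ Real.pi * ∫ x in edge j, ‖h x‖ ^ 2 := by
  have hπ := Real.pi_pos
  set m := (∫ x in edge j, ‖h x‖) / Real.pi with hm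
  have e : ∫ x in edge j, (‖h x‖ - m) ^ 2 =
      (∫ x in edge j, ‖h x‖ ^ 2) - 2 * m * (∫ x in edge j, ‖h x‖) + Real.pi * m ^ 2 := by
    have e1 : ∀ x, (‖h x‖ - m) ^ 2 = ‖h x‖ ^ 2 - 2 * m * ‖h x‖ + m ^ 2 := fun x => by ring
    have hc : IntegrableOn (fun _ : ℝ => m ^ 2) (edge j) volume :=
      integrableOn_const (isCompact_edge j).measure_lt_top.ne
    have hd : IntegrableOn (fun x => ‖h x‖ ^ 2 - 2 * m * ‖h x‖) (edge j) volume :=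
      h2.sub (h1.norm.const_mul _)
    simp only [e1]
    rw [integral_add hd hc, integral_sub h2 (h1.norm.const_mul _),
      integral_const_mul, setIntegral_const, volume_real_edge, smul_eq_mul]
  have h0 : 0 ≤ ∫ x in edge j, (‖h x‖ - m) ^ 2 := integral_nonneg fun _ => sq_nonneg _
  have hI : ∫ x in edge j, ‖h x‖ = Real.pi * m := by rw [hm]; field_simp
  rw [e, hI] at h0
  rw [hI]
  nlinarith

theorem sq_integral_edge_le (f : L2Graph) (s : Fin 2) (j : ℤ) :
    (∫ x in edge j, ‖(f s : ℝ → ℂ) x‖) ^ 2 ≤ Real.pi * edgeSq f s j :=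
  sq_integral_norm_le (integrableOn_edge _ j) (integrable_sq _).integrableOn

theorem norm_intervalIntegral_edge_le {m g : ℝ → ℂ} {j : ℤ} {K y : ℝ} (hy : y ∈ edge j)
    (hg : IntegrableOn g (edge j) volume) (hK : 0 ≤ K)
    (hm : ∀ t ∈ Icc (vertex j) y, ‖m t‖ ≤ K * ‖g t‖) :
    ‖∫ t in vertex j..y, m t‖ ≤ K * ∫ x in edge j, ‖g x‖ := by
  have hg' : IntegrableOn (fun t => K * ‖g t‖) (edge j) volume := hg.norm.const_mul K
  have hsub : Ioc (vertex j) y ⊆ edge j := fun t ht => ⟨ht.1.le, ht.2.trans hy.2⟩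
  rw [intervalIntegral.integral_of_le hy.1, ← integral_const_mul]
  refine (norm_integral_le_of_norm_le (hg'.mono_set hsub)
    ((ae_restrict_iff' measurableSet_Ioc).2 (ae_of_all _ fun t ht => hm t ⟨ht.1.le, ht.2⟩))).trans ?_
  exact setIntegral_mono_set hg' (ae_of_all _ fun t => mul_nonneg hK (norm_nonneg _))
    (LE.le.eventuallyLE hsub)

/-- Continuous functions on the edges with square summable suprema are glued to an `L²` function. -/
theorem exists_glue {u : ℤ → ℝ → ℂ} (hu : ∀ j, ContinuousOn (u j) (edge j)) {M : ℤ → ℝ}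
    (hM : Summable M) (huM : ∀ j, ∀ x ∈ edge j, ‖u j x‖ ^ 2 ≤ M j) :
    ∃ g : Lp ℂ 2 (volume : Measure ℝ), ∀ j, (g : ℝ → ℂ) =ᵐ[volume.restrict (edge j)] u j := by
  set F : ℝ → ℂ := fun x => u ⌊x / Real.pi⌋ x with hF
  have hFu : ∀ j, ∀ x ∈ Ico (vertex j) (vertex (j + 1)), F x = u j x := by
    intro j x hx
    have : ⌊x / Real.pi⌋ = j := by
      rw [Int.floor_eq_iff, le_div_iff₀ Real.pi_pos, div_lt_iff₀ Real.pi_pos]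
      have h1 := hx.1
      have h2 := hx.2
      unfold vertex at h1 h2
      push_cast at h2
      exact ⟨h1, h2⟩
    simp only [hF, this]
  have hIco : ∀ j, Ico (vertex j) (vertex (j + 1)) ⊆ edge j := fun j => Ico_subset_Icc_self
  have hmeas : AEStronglyMeasurable F volume := by
    rw [← Measure.restrict_univ (μ := (volume : Measure ℝ)), ← iUnion_Ico_vertex,
      aestronglyMeasurable_iUnion_iff]
    intro j
    refine (((hu j).mono (hIco j)).aestronglyMeasurable measurableSet_Ico).congr ?_
    exact (ae_restrict_iff' measurableSet_Ico).2 (ae_of_all _ fun x hx => (hFu j x hx).symm)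
  have hmem : MemLp F 2 volume := by
    rw [memLp_two_iff_integrable_sq_norm hmeas, ← integrableOn_univ, ← iUnion_Ico_vertex]
    have hint : ∀ j : ℤ, IntegrableOn (fun x => ‖F x‖ ^ 2) (Ico (vertex j) (vertex (j + 1)))
        volume := by
      intro j
      have h1 : IntegrableOn (fun x => ‖u j x‖ ^ 2) (Ico (vertex j) (vertex (j + 1))) volume :=
        (((hu j).norm.pow 2).integrableOn_compact (isCompact_edge j)).mono_set (hIco j)
      refine h1.congr_fun (fun x hx => ?_) measurableSet_Ico
      simp only [hFu j x hx]
    refine integrableOn_iUnion_of_summable_integral_norm hint ?_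
    refine Summable.of_nonneg_of_le (fun j => integral_nonneg fun _ => norm_nonneg _) (fun j => ?_)
      (hM.mul_left Real.pi)
    have hle : ∀ x ∈ Ico (vertex j) (vertex (j + 1)), ‖‖F x‖ ^ 2‖ ≤ M j := by
      intro x hx
      rw [hFu j x hx, norm_pow, norm_norm]
      exact huM j x (hIco j hx)
    have := setIntegral_mono_on (hint j).norm
      (integrableOn_const (C := M j) (μ := volume) (measure_Ico_lt_top.ne)) measurableSet_Ico hle
    refine this.trans (le_of_eq ?_)
    rw [setIntegral_const, Real.volume_real_Ico_of_le (vertex_lt j).le, vertex_succ_sub,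
      smul_eq_mul]
  refine ⟨hmem.toLp F, fun j => ?_⟩
  refine Filter.EventuallyEq.trans (ae_restrict_of_ae hmem.coeFn_toLp) ?_
  rw [Measure.restrict_congr_set (edge_ae_eq_Ico j)]
  exact (ae_restrict_iff' measurableSet_Ico).2 (ae_of_all _ fun x hx => hFu j x hx)

theorem edgeSq_le_of_bound {f : L2Graph} {s : Fin 2} {j : ℤ} {u : ℝ → ℂ} {M : ℝ}
    (hfu : (f s : ℝ → ℂ) =ᵐ[volume.restrict (edge j)] u)
    (hM : ∀ x ∈ edge j, ‖u x‖ ^ 2 ≤ M) : edgeSq f s j ≤ Real.pi * M := by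
  have h1 : edgeSq f s j ≤ ∫ _ in edge j, M := by
    refine integral_mono_ae (integrable_sq _).integrableOn
      (integrableOn_const (isCompact_edge j).measure_lt_top.ne) ?_
    filter_upwards [hfu, ae_restrict_mem (measurableSet_edge j)] with x hx hxm
    rw [hx]
    exact hM x hxm
  refine h1.trans (le_of_eq ?_)
  rw [setIntegral_const, volume_real_edge, smul_eq_mul]

/-! ### Estimates for solutions on an edge -/

theorem exists_bound_sol (z : ℂ) :
    ∃ K : ℝ, 0 < K ∧ ∀ x ∈ Icc 0 Real.pi, ‖csol z x‖ ≤ K ∧ ‖ssol z x‖ ≤ K := by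
  obtain ⟨K₁, h1⟩ := isCompact_Icc.exists_bound_of_continuousOn
    (continuous_csol z).continuousOn (s := Icc 0 Real.pi)
  obtain ⟨K₂, h2⟩ := isCompact_Icc.exists_bound_of_continuousOn
    (continuous_ssol z).continuousOn (s := Icc 0 Real.pi)
  refine ⟨max 1 (max K₁ K₂), by positivity, fun x hx => ⟨(h1 x hx).trans ?_, (h2 x hx).trans ?_⟩⟩
  · exact (le_max_left _ _).trans (le_max_right _ _)
  · exact (le_max_right _ _).trans (le_max_right _ _)

theorem sub_mem_Icc_pi {j : ℤ} {y t : ℝ} (hy : y ∈ edge j) (ht : t ∈ Icc (vertex j) y) :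
    y - t ∈ Icc 0 Real.pi := by
  have := vertex_succ_sub j
  have h1 := ht.1
  have h2 := ht.2
  have h3 := hy.2
  constructor <;> linarith

/-- Solutions on an edge are controlled by the initial data and the source. -/
theorem exists_solution_bound (z : ℂ) :
    ∃ K : ℝ, 0 < K ∧ ∀ (a : ℝ) (j : ℤ) (u p h : ℝ → ℂ), HasQuasiDeriv a j u p →
      (HasQuasiDeriv a j p fun x => -(z * u x + h x)) → IntegrableOn h (edge j) volume →
      ∀ y ∈ edge j, ‖u y‖ ^ 2 ≤
        K * (‖u (vertex j)‖ ^ 2 + ‖p (vertex j)‖ ^ 2 + (∫ x in edge j, ‖h x‖) ^ 2) := by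
  obtain ⟨K, hK, hb⟩ := exists_bound_sol z
  refine ⟨3 * K ^ 2, by positivity, fun a j u p h hu hp hh y hy => ?_⟩
  have e := solution_value hu hp hy
  have b := hb _ (sub_mem_Icc_pi hy ⟨le_rfl, hy.1⟩)
  have i : ‖∫ t in vertex j..y, phase a (t - vertex j) * h t * ssol z (y - t)‖
      ≤ K * ∫ x in edge j, ‖h x‖ := by
    refine norm_intervalIntegral_edge_le hy hh hK.le fun t ht => ?_
    rw [norm_mul, norm_mul, norm_phase, one_mul, mul_comm]
    exact mul_le_mul_of_nonneg_right (hb _ (sub_mem_Icc_pi hy ht)).2 (norm_nonneg _)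
  have hn : ‖u y‖ ≤ K * (‖u (vertex j)‖ + ‖p (vertex j)‖ + ∫ x in edge j, ‖h x‖) := by
    calc ‖u y‖ = ‖phase a (y - vertex j) * u y‖ := by rw [norm_mul, norm_phase, one_mul]
      _ ≤ ‖u (vertex j)‖ * ‖csol z (y - vertex j)‖ + ‖p (vertex j)‖ * ‖ssol z (y - vertex j)‖
          + ‖∫ t in vertex j..y, phase a (t - vertex j) * h t * ssol z (y - t)‖ := by
        rw [e, ← norm_mul, ← norm_mul]
        exact (norm_sub_le _ _).trans (add_le_add_left (norm_add_le _ _) _)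
      _ ≤ ‖u (vertex j)‖ * K + ‖p (vertex j)‖ * K + K * ∫ x in edge j, ‖h x‖ := by
        gcongr
        · exact b.1
        · exact b.2
      _ = _ := by ring
  have h3 : (‖u (vertex j)‖ + ‖p (vertex j)‖ + ∫ x in edge j, ‖h x‖) ^ 2 ≤
      3 * (‖u (vertex j)‖ ^ 2 + ‖p (vertex j)‖ ^ 2 + (∫ x in edge j, ‖h x‖) ^ 2) := by
    nlinarith [sq_nonneg (‖u (vertex j)‖ - ‖p (vertex j)‖),
      sq_nonneg (‖u (vertex j)‖ - ∫ x in edge j, ‖h x‖),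
      sq_nonneg (‖p (vertex j)‖ - ∫ x in edge j, ‖h x‖)]
  calc ‖u y‖ ^ 2 ≤ (K * (‖u (vertex j)‖ + ‖p (vertex j)‖ + ∫ x in edge j, ‖h x‖)) ^ 2 := by
        gcongr
    _ = K ^ 2 * (‖u (vertex j)‖ + ‖p (vertex j)‖ + ∫ x in edge j, ‖h x‖) ^ 2 := by ring
    _ ≤ K ^ 2 * (3 * (‖u (vertex j)‖ ^ 2 + ‖p (vertex j)‖ ^ 2
          + (∫ x in edge j, ‖h x‖) ^ 2)) := by gcongr
    _ = _ := by ring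

/-- A cubic with a simple zero at `0` and a double zero at `π`. -/
def bump (x : ℝ) : ℂ := x * (Real.pi - x) ^ 2

/-- The derivative of `bump`. -/
def bump' (x : ℝ) : ℂ := (Real.pi - x) ^ 2 - 2 * x * (Real.pi - x)

/-- The second derivative of `bump`. -/
def bump'' (x : ℝ) : ℂ := 6 * x - 4 * Real.pi

theorem hasDerivAt_bump (x : ℝ) : HasDerivAt bump (bump' x) x := by
  have h : HasDerivAt (fun t : ℝ => (t : ℂ)) 1 x := (hasDerivAt_id x).ofReal_comp
  refine (h.mul ((h.const_sub (Real.pi : ℂ)).pow 2)).congr_deriv ?_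
  simp only [bump', Pi.pow_apply]
  push_cast
  ring

theorem hasDerivAt_bump' (x : ℝ) : HasDerivAt bump' (bump'' x) x := by
  have h : HasDerivAt (fun t : ℝ => (t : ℂ)) 1 x := (hasDerivAt_id x).ofReal_comp
  have h1 := h.const_sub (Real.pi : ℂ)
  refine ((h1.pow 2).sub ((h.const_mul 2).mul h1)).congr_deriv ?_
  simp only [bump'']
  push_cast
  ring

theorem continuous_bump : Continuous bump := by unfold bump; fun_prop

theorem continuous_bump' : Continuous bump' := by unfold bump'; fun_prop

theorem continuous_bump'' : Continuous bump'' := by unfold bump''; fun_prop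

/-- The trace estimate: the value at the left end of an edge is controlled by the `L¹` norms of the
function and of its second quasiderivative. -/
theorem exists_trace_bound :
    ∃ K : ℝ, 0 < K ∧ ∀ (a : ℝ) (j : ℤ) (u p g : ℝ → ℂ), HasQuasiDeriv a j u p →
      (HasQuasiDeriv a j p fun x => -g x) → IntegrableOn g (edge j) volume →
      ‖u (vertex j)‖ ^ 2 ≤ K * ((∫ x in edge j, ‖u x‖) ^ 2 + (∫ x in edge j, ‖g x‖) ^ 2) := by
  obtain ⟨K₁, h1⟩ := isCompact_Icc.exists_bound_of_continuousOn
    continuous_bump.continuousOn (s := Icc 0 Real.pi)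
  obtain ⟨K₂, h2⟩ := isCompact_Icc.exists_bound_of_continuousOn
    continuous_bump''.continuousOn (s := Icc 0 Real.pi)
  have hπ := Real.pi_pos
  set K := max 1 (max K₁ K₂) with hKdef
  have hK : 0 < K := by positivity
  have hK1 : K₁ ≤ K := (le_max_left _ _).trans (le_max_right _ _)
  have hK2 : K₂ ≤ K := (le_max_right _ _).trans (le_max_right _ _)
  refine ⟨2 * K ^ 2 / Real.pi ^ 4, by positivity, fun a j u p g hu hp hg => ?_⟩
  have hb := continuous_bump
  have hb' := continuous_bump'
  have hb'' := continuous_bump''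
  have hph := continuous_phase a
  have hr := right_mem_edge j
  have k1 := hp.by_parts (χ := fun t => bump (t - vertex j)) (χ' := fun t => bump' (t - vertex j))
    (fun x => (hasDerivAt_bump _).comp_sub_const x (vertex j)) (by fun_prop) hr
  have k2 := hu.by_parts (χ := fun t => bump' (t - vertex j))
    (χ' := fun t => bump'' (t - vertex j))
    (fun x => (hasDerivAt_bump' _).comp_sub_const x (vertex j)) (by fun_prop) hr
  have e0 : bump 0 = 0 := by simp [bump]
  have e1 : bump Real.pi = 0 := by simp [bump]
  have e2 : bump' Real.pi = 0 := by simp [bump']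
  have e3 : bump' 0 = (Real.pi : ℂ) ^ 2 := by simp [bump']
  simp only [sub_self, vertex_succ_sub, e0, e1, e2, e3, mul_zero, zero_add] at k1 k2
  have hgi : IntervalIntegrable g volume (vertex j) (vertex (j + 1)) := by
    rw [intervalIntegrable_iff, uIoc_of_le (vertex_lt j).le]
    exact hg.mono_set Ioc_subset_Icc_self
  have hui : IntervalIntegrable u volume (vertex j) (vertex (j + 1)) := by
    refine ContinuousOn.intervalIntegrable ?_
    rw [uIcc_of_le (vertex_lt j).le]
    exact hu.1
  have huI : IntegrableOn u (edge j) volume := hu.1.integrableOn_compact (isCompact_edge j)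
  have i1 : IntervalIntegrable (fun t => phase a (t - vertex j) * g t * bump (t - vertex j)) volume
      (vertex j) (vertex (j + 1)) :=
    (hgi.continuousOn_mul (g := fun t => phase a (t - vertex j)) (by fun_prop)).mul_continuousOn
      (by fun_prop)
  have i2 : IntervalIntegrable (fun t => phase a (t - vertex j) * u t * bump'' (t - vertex j))
      volume (vertex j) (vertex (j + 1)) :=
    (hui.continuousOn_mul (g := fun t => phase a (t - vertex j)) (by fun_prop)).mul_continuousOn
      (by fun_prop)
  have i3 : IntervalIntegrable (fun t => phase a (t - vertex j) * p t * bump' (t - vertex j))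
      volume (vertex j) (vertex (j + 1)) :=
    (hu.2.1.continuousOn_mul (g := fun t => phase a (t - vertex j)) (by fun_prop)).mul_continuousOn
      (by fun_prop)
  have s1 : (∫ t in vertex j..vertex (j + 1), phase a (t - vertex j) *
      (-g t * bump (t - vertex j) + p t * bump' (t - vertex j))) =
      (∫ t in vertex j..vertex (j + 1), phase a (t - vertex j) * p t * bump' (t - vertex j)) -
      ∫ t in vertex j..vertex (j + 1), phase a (t - vertex j) * g t * bump (t - vertex j) := by
    rw [← intervalIntegral.integral_sub i3 i1]
    refine intervalIntegral.integral_congr fun t _ => ?_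
    ring
  have s2 : (∫ t in vertex j..vertex (j + 1), phase a (t - vertex j) *
      (p t * bump' (t - vertex j) + u t * bump'' (t - vertex j))) =
      (∫ t in vertex j..vertex (j + 1), phase a (t - vertex j) * p t * bump' (t - vertex j)) +
      ∫ t in vertex j..vertex (j + 1), phase a (t - vertex j) * u t * bump'' (t - vertex j) := by
    rw [← intervalIntegral.integral_add i3 i2]
    refine intervalIntegral.integral_congr fun t _ => ?_
    ring
  rw [s1] at k1
  rw [s2] at k2
  have hmem : ∀ t ∈ Icc (vertex j) (vertex (j + 1)), t - vertex j ∈ Icc 0 Real.pi := by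
    intro t ht
    have h1 := ht.1
    have h2 := ht.2
    have := vertex_succ_sub j
    constructor <;> linarith
  have n1 : ‖∫ t in vertex j..vertex (j + 1), phase a (t - vertex j) * g t * bump (t - vertex j)‖
      ≤ K * ∫ x in edge j, ‖g x‖ := by
    refine norm_intervalIntegral_edge_le hr hg hK.le fun t ht => ?_
    rw [norm_mul, norm_mul, norm_phase, one_mul, mul_comm]
    exact mul_le_mul_of_nonneg_right ((h1 _ (hmem t ht)).trans hK1) (norm_nonneg _)
  have n2 : ‖∫ t in vertex j..vertex (j + 1), phase a (t - vertex j) * u t * bump'' (t - vertex j)‖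
      ≤ K * ∫ x in edge j, ‖u x‖ := by
    refine norm_intervalIntegral_edge_le hr huI hK.le fun t ht => ?_
    rw [norm_mul, norm_mul, norm_phase, one_mul, mul_comm]
    exact mul_le_mul_of_nonneg_right ((h2 _ (hmem t ht)).trans hK2) (norm_nonneg _)
  have key : u (vertex j) * (Real.pi : ℂ) ^ 2 =
      -((∫ t in vertex j..vertex (j + 1), phase a (t - vertex j) * g t * bump (t - vertex j)) +
      ∫ t in vertex j..vertex (j + 1), phase a (t - vertex j) * u t * bump'' (t - vertex j)) := by
    linear_combination k1 - k2
  have hn : ‖u (vertex j)‖ * Real.pi ^ 2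
      ≤ K * ((∫ x in edge j, ‖u x‖) + ∫ x in edge j, ‖g x‖) := by
    calc ‖u (vertex j)‖ * Real.pi ^ 2 = ‖u (vertex j) * (Real.pi : ℂ) ^ 2‖ := by
          rw [norm_mul, norm_pow, Complex.norm_real, Real.norm_of_nonneg hπ.le]
      _ ≤ _ := by
          rw [key, norm_neg]
          refine (norm_add_le _ _).trans ?_
          linarith
  rw [div_mul_eq_mul_div, le_div_iff₀ (by positivity)]
  calc ‖u (vertex j)‖ ^ 2 * Real.pi ^ 4 = (‖u (vertex j)‖ * Real.pi ^ 2) ^ 2 := by ring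
    _ ≤ (K * ((∫ x in edge j, ‖u x‖) + ∫ x in edge j, ‖g x‖)) ^ 2 := by gcongr
    _ = K ^ 2 * ((∫ x in edge j, ‖u x‖) + ∫ x in edge j, ‖g x‖) ^ 2 := by ring
    _ ≤ K ^ 2 * (2 * ((∫ x in edge j, ‖u x‖) ^ 2 + (∫ x in edge j, ‖g x‖) ^ 2)) := by
        gcongr
        nlinarith [sq_nonneg ((∫ x in edge j, ‖u x‖) - ∫ x in edge j, ‖g x‖)]
    _ = _ := by ring

/-! ### Moments of the source -/

/-- The integral over the `j`-th edge of the gauged component `s` of `h` against the profile `χ`,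
reflected so that its origin is the right end of the edge. -/
def moment (A : ℝ) (χ : ℝ → ℂ) (s : Fin 2) (j : ℤ) (h : L2Graph) : ℂ :=
  ∫ t in vertex j..vertex (j + 1),
    phase (potential A s) (t - vertex j) * (h s : ℝ → ℂ) t * χ (vertex (j + 1) - t)

theorem moment_integrable (A : ℝ) {χ : ℝ → ℂ} (hχ : Continuous χ) (s : Fin 2) (j : ℤ)
    (h : L2Graph) : IntervalIntegrable (fun t => phase (potential A s) (t - vertex j) *
      (h s : ℝ → ℂ) t * χ (vertex (j + 1) - t)) volume (vertex j) (vertex (j + 1)) := by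
  have hph := continuous_phase (potential A s)
  exact ((intervalIntegrable_edge (h s) j).continuousOn_mul
    (g := fun t => phase (potential A s) (t - vertex j)) (by fun_prop)).mul_continuousOn
      (by fun_prop)

theorem moment_add (A : ℝ) {χ : ℝ → ℂ} (hχ : Continuous χ) (s : Fin 2) (j : ℤ) (h h' : L2Graph) :
    moment A χ s j (h + h') = moment A χ s j h + moment A χ s j h' := by
  unfold moment
  rw [← intervalIntegral.integral_add (moment_integrable A hχ s j h)
    (moment_integrable A hχ s j h')]
  refine intervalIntegral.integral_congr_ae ?_
  filter_upwards [Lp.coeFn_add (h s) (h' s)] with t ht _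
  have ht' : ((h + h') s : ℝ → ℂ) t = (h s : ℝ → ℂ) t + (h' s : ℝ → ℂ) t := ht
  rw [ht']
  ring

theorem moment_smul (A : ℝ) (χ : ℝ → ℂ) (s : Fin 2) (j : ℤ) (c : ℂ) (h : L2Graph) :
    moment A χ s j (c • h) = c * moment A χ s j h := by
  unfold moment
  rw [← intervalIntegral.integral_const_mul]
  refine intervalIntegral.integral_congr_ae ?_
  filter_upwards [Lp.coeFn_smul c (h s)] with t ht _
  have ht' : ((c • h) s : ℝ → ℂ) t = c * (h s : ℝ → ℂ) t := ht
  rw [ht']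
  ring

theorem exists_moment_bound {χ : ℝ → ℂ} (hχ : Continuous χ) :
    ∃ K : ℝ, 0 < K ∧ ∀ (A : ℝ) (s : Fin 2) (j : ℤ) (h : L2Graph),
      ‖moment A χ s j h‖ ^ 2 ≤ K * edgeSq h s j := by
  obtain ⟨K, hK⟩ := isCompact_Icc.exists_bound_of_continuousOn
    hχ.continuousOn (s := Icc 0 Real.pi)
  have hK0 : 0 ≤ K := (norm_nonneg _).trans (hK 0 ⟨le_rfl, Real.pi_pos.le⟩)
  refine ⟨K ^ 2 * Real.pi + 1, by positivity, fun A s j h => ?_⟩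
  have h1 : ‖moment A χ s j h‖ ≤ K * ∫ x in edge j, ‖(h s : ℝ → ℂ) x‖ := by
    refine norm_intervalIntegral_edge_le (right_mem_edge j) (integrableOn_edge _ j) hK0
      fun t ht => ?_
    rw [norm_mul, norm_mul, norm_phase, one_mul, mul_comm]
    exact mul_le_mul_of_nonneg_right (hK _ (sub_mem_Icc_pi (right_mem_edge j) ht)) (norm_nonneg _)
  have h2 := sq_integral_edge_le h s j
  have h3 := edgeSq_nonneg h s j
  calc ‖moment A χ s j h‖ ^ 2 ≤ (K * ∫ x in edge j, ‖(h s : ℝ → ℂ) x‖) ^ 2 := by gcongr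
    _ = K ^ 2 * (∫ x in edge j, ‖(h s : ℝ → ℂ) x‖) ^ 2 := by ring
    _ ≤ K ^ 2 * (Real.pi * edgeSq h s j) := by gcongr
    _ ≤ _ := by linarith

/-! ### The sequence space and the Jacobi operator -/

/-- The Hilbert space of square summable sequences of vertex values. -/
abbrev Seq : Type := lp (fun _ : ℤ => ℂ) 2

theorem memℓp_two_iff {b : ℤ → ℂ} : Memℓp b 2 ↔ Summable fun j => ‖b j‖ ^ 2 := by
  rw [memℓp_gen_iff (by norm_num)]
  simp

theorem Seq.hasSum (x : Seq) : HasSum (fun j => ‖x j‖ ^ 2) (‖x‖ ^ 2) := by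
  have := lp.hasSum_norm (p := 2) (by norm_num) x
  simpa using this

/-- The sequence with the given square summable terms. -/
def Seq.mk (b : ℤ → ℂ) (hb : Summable fun j => ‖b j‖ ^ 2) : Seq := ⟨b, memℓp_two_iff.2 hb⟩

@[simp] theorem Seq.mk_apply (b : ℤ → ℂ) (hb : Summable fun j => ‖b j‖ ^ 2) (j : ℤ) :
    Seq.mk b hb j = b j := rfl

theorem Seq.ext {x y : Seq} (h : ∀ j, x j = y j) : x = y := lp.ext (funext h)

theorem Seq.add_apply (x y : Seq) (j : ℤ) : (x + y) j = x j + y j := rfl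

theorem Seq.smul_apply (c : ℂ) (x : Seq) (j : ℤ) : (c • x) j = c * x j := rfl

instance : Nontrivial Seq :=
  ⟨⟨lp.single 2 0 1, 0, fun h => by
    have := congrArg (fun x : Seq => x 0) h
    simp at this⟩⟩

theorem summable_shift (n : ℤ) (x : Seq) : Summable fun j => ‖x (j + n)‖ ^ 2 :=
  ((Equiv.addRight n).summable_iff (f := fun j => ‖x j‖ ^ 2)).2 (Seq.hasSum x).summable

/-- The shift of sequences, as a linear map. -/
def shiftₗ (n : ℤ) : Seq →ₗ[ℂ] Seq where
  toFun x := Seq.mk (fun j => x (j + n)) (summable_shift n x)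
  map_add' _ _ := Seq.ext fun _ => rfl
  map_smul' _ _ := Seq.ext fun _ => rfl

theorem norm_shiftₗ (n : ℤ) (x : Seq) : ‖shiftₗ n x‖ = ‖x‖ := by
  rw [← sq_eq_sq₀ (norm_nonneg _) (norm_nonneg _)]
  have h1 := Seq.hasSum (shiftₗ n x)
  have h2 : HasSum (fun j => ‖x (j + n)‖ ^ 2) (‖x‖ ^ 2) :=
    ((Equiv.addRight n).hasSum_iff (f := fun j => ‖x j‖ ^ 2)).2 (Seq.hasSum x)
  exact h1.unique h2

/-- The shift of sequences. -/
def shift (n : ℤ) : Seq →L[ℂ] Seq :=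
  (shiftₗ n).mkContinuous 1 fun x => by rw [one_mul, norm_shiftₗ]

@[simp] theorem shift_apply (n : ℤ) (x : Seq) (j : ℤ) : shift n x j = x (j + n) := rfl

theorem norm_shift_le (n : ℤ) : ‖shift n‖ ≤ 1 :=
  (shiftₗ n).mkContinuous_norm_le zero_le_one _

theorem adjoint_shift (n : ℤ) : ContinuousLinearMap.adjoint (shift n) = shift (-n) := by
  symm
  rw [ContinuousLinearMap.eq_adjoint_iff]
  intro x y
  rw [lp.inner_eq_tsum, lp.inner_eq_tsum, ← (Equiv.addRight n).tsum_eq]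
  simp

/-- The projection onto the coordinate number `1`. -/
def proj : Seq →L[ℂ] Seq :=
  (lp.singleContinuousLinearMap ℂ (fun _ : ℤ => ℂ) 2 1).comp (lp.evalCLM ℂ (fun _ : ℤ => ℂ) 2 1)

theorem proj_apply (x : Seq) : proj x = lp.single 2 1 (x 1) := rfl

theorem proj_apply_apply (x : Seq) (j : ℤ) : proj x j = if j = 1 then x 1 else 0 := by
  rw [proj_apply, lp.single_apply]
  by_cases h : j = 1
  · subst h
    simp
  · simp [h]

/-- The value of the cosine-like solution at the end of an edge. -/
def cosEnd (z : ℂ) : ℂ := csol z Real.pi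

/-- The value of the sine-like solution at the end of an edge. -/
def sinEnd (z : ℂ) : ℂ := ssol z Real.pi

/-- One half of the trace of the transfer matrix of the chain in the absence of the field. -/
def discr (α : ℝ) (z : ℂ) : ℂ := cosEnd z + α / 4 * sinEnd z

/-- The Jacobi operator on vertex values. -/
def jacobi (A α γ : ℝ) (z : ℂ) : Seq →L[ℂ] Seq :=
  (Real.cos (A * Real.pi) : ℂ) • (shift 1 + shift (-1)) - (2 * discr α z) • 1
    - (γ / 2 * sinEnd z) • proj

theorem jacobi_apply (A α γ : ℝ) (z : ℂ) (x : Seq) (j : ℤ) :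
    jacobi A α γ z x j = Real.cos (A * Real.pi) * (x (j + 1) + x (j - 1))
      - (2 * cosEnd z + impurityCoupling α γ j / 2 * sinEnd z) * x j := by
  have h : jacobi A α γ z x j = Real.cos (A * Real.pi) * (x (j + 1) + x (j + -1))
      - 2 * discr α z * x j - (γ / 2 * sinEnd z) * proj x j := rfl
  rw [h, proj_apply_apply, discr, impurityCoupling]
  split_ifs with hj
  · subst hj
    push_cast
    ring_nf
  · ring_nf

theorem jacobi_eq_sub (A α γ : ℝ) (z : ℂ) :
    jacobi A α γ z = jacobi A α 0 z - (γ / 2 * sinEnd z) • proj := by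
  simp [jacobi]

/-- The set which turns out to be the spectrum. -/
def bandSet (A α : ℝ) : Set ℂ :=
  {z | sinEnd z = 0 ∨ ∃ t : ℝ, |t| ≤ |Real.cos (A * Real.pi)| ∧ discr α z = t}

theorem isSelfAdjoint_hopping (c : ℝ) : IsSelfAdjoint ((c : ℂ) • (shift 1 + shift (-1))) := by
  rw [ContinuousLinearMap.isSelfAdjoint_iff', map_smulₛₗ, map_add, adjoint_shift, adjoint_shift,
    neg_neg, add_comm]
  simp

theorem norm_hopping_le (c : ℝ) : ‖(c : ℂ) • (shift 1 + shift (-1))‖ ≤ 2 * |c| := by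
  have h : ‖shift 1 + shift (-1)‖ ≤ 2 := by
    have := norm_add_le (shift 1) (shift (-1))
    linarith [norm_shift_le 1, norm_shift_le (-1)]
  rw [norm_smul, Complex.norm_real, Real.norm_eq_abs, mul_comm]
  exact mul_le_mul_of_nonneg_right h (abs_nonneg c)

theorem isUnit_jacobi {A α : ℝ} {z : ℂ} (hz : z ∉ bandSet A α) : IsUnit (jacobi A α 0 z) := by
  set c := Real.cos (A * Real.pi) with hc
  by_contra hu
  have hmem : 2 * discr α z ∈ spectrum ℂ ((c : ℂ) • (shift 1 + shift (-1))) := by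
    rw [spectrum.mem_iff]
    intro h
    refine hu ?_
    have := h.neg
    rw [neg_sub, Algebra.algebraMap_eq_smul_one] at this
    simpa [jacobi, ← hc] using this
  have h1 := (isSelfAdjoint_hopping c).mem_spectrum_eq_re hmem
  have h2 := (spectrum.norm_le_norm_of_mem hmem).trans (norm_hopping_le c)
  refine hz (Or.inr ⟨(2 * discr α z).re / 2, ?_, ?_⟩)
  · rw [h1, Complex.norm_real, Real.norm_eq_abs] at h2
    rw [abs_div, abs_two]
    linarith
  · push_cast
    rw [← h1]
    ring

theorem isUnit_jacobi_of_large {A α γ : ℝ} {z : ℂ}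
    (h : 2 * |Real.cos (A * Real.pi)| + ‖γ / 2 * sinEnd z‖ * ‖proj‖ < ‖2 * discr α z‖) :
    IsUnit (jacobi A α γ z) := by
  set c := Real.cos (A * Real.pi) with hc
  by_contra hu
  have hmem : 2 * discr α z ∈
      spectrum ℂ ((c : ℂ) • (shift 1 + shift (-1)) - (γ / 2 * sinEnd z) • proj) := by
    rw [spectrum.mem_iff]
    intro h
    refine hu ?_
    have := h.neg
    rw [neg_sub, Algebra.algebraMap_eq_smul_one] at this
    rw [jacobi, sub_right_comm]
    exact this
  have h2 := spectrum.norm_le_norm_of_mem hmem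
  have h3 := norm_sub_le ((c : ℂ) • (shift 1 + shift (-1))) ((γ / 2 * sinEnd z) • proj)
  rw [norm_smul (γ / 2 * sinEnd z)] at h3
  linarith [norm_hopping_le c]

section Reduction

/-! ### Reduction to the vertex values -/

/-- The functions `u`, `p` represent the element `f` of the domain and its quasiderivative. -/
def IsWitness (A : ℝ) (α : ℤ → ℝ) (f g : L2Graph) (u p : Fin 2 → ℤ → ℝ → ℂ) : Prop :=
  (∀ s j, (f s : ℝ → ℂ) =ᵐ[volume.restrict (edge j)] u s j) ∧
    (∀ s j, HasQuasiDeriv (potential A s) j (u s j) (p s j)) ∧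
    (∀ s j, HasQuasiDeriv (potential A s) j (p s j) (fun x => -(g s : ℝ → ℂ) x)) ∧
    (∀ s j, u s j (vertex j) = u 0 j (vertex j) ∧ u s (j - 1) (vertex j) = u 0 j (vertex j)) ∧
    ∀ j, ∑ s, (p s j (vertex j) - p s (j - 1) (vertex j)) = (α j : ℂ) * u 0 j (vertex j)

theorem isHamiltonianPair_iff {A : ℝ} {α : ℤ → ℝ} {f g : L2Graph} :
    IsHamiltonianPair A α f g ↔ ∃ u p, IsWitness A α f g u p := Iff.rfl

/-- The matching conditions at the vertices, in terms of the values `P` and the quasiderivatives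
`q` at the left ends of the edges, for solutions of `-𝒟² f = z f + h`. -/
structure VertexEquations (A : ℝ) (α : ℤ → ℝ) (z : ℂ) (h : L2Graph) (P : ℤ → ℂ)
    (q : Fin 2 → ℤ → ℂ) : Prop where
  continuity : ∀ s j, phase (potential A s) Real.pi * P (j + 1) =
    P j * cosEnd z + q s j * sinEnd z - moment A (ssol z) s j h
  flux : ∀ j, ∑ s, (q s j - phase (-potential A s) Real.pi *
    (-(z * P (j - 1) * sinEnd z) + q s (j - 1) * cosEnd z - moment A (csol z) s (j - 1) h))
      = (α j : ℂ) * P j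

variable {A : ℝ} {α : ℤ → ℝ} {z : ℂ} {f g h : L2Graph} {u p : Fin 2 → ℤ → ℝ → ℂ}

theorem coe_smul_add_ae (z : ℂ) (f h : L2Graph) (s : Fin 2) :
    ((z • f + h) s : ℝ → ℂ) =ᵐ[volume] fun x => z * (f s : ℝ → ℂ) x + (h s : ℝ → ℂ) x := by
  filter_upwards [Lp.coeFn_add (z • f s) (h s), Lp.coeFn_smul z (f s)] with x h1 h2
  have h1' : ((z • f + h) s : ℝ → ℂ) x = (z • f s : Lp ℂ 2 (volume : Measure ℝ)) x
    + (h s : ℝ → ℂ) x := h1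
  rw [h1', h2]
  rfl

theorem IsWitness.hasQuasiDeriv (w : IsWitness A α f (z • f + h) u p) (s : Fin 2) (j : ℤ) :
    HasQuasiDeriv (potential A s) j (p s j) fun x => -(z * u s j x + (h s : ℝ → ℂ) x) := by
  refine (w.2.2.1 s j).congr_edge ?_
  filter_upwards [ae_restrict_of_ae (coe_smul_add_ae z f h s), w.1 s j] with x h1 h2
  rw [h1, h2]

theorem IsWitness.vertexEquations (w : IsWitness A α f (z • f + h) u p) :
    VertexEquations A α z h (fun j => u 0 j (vertex j)) (fun s j => p s j (vertex j)) := by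
  have hval : ∀ s j, u s j (vertex (j + 1)) = u 0 (j + 1) (vertex (j + 1)) := by
    intro s j
    have := (w.2.2.2.1 s (j + 1)).2
    rwa [add_sub_cancel_right] at this
  refine ⟨fun s j => ?_, fun j => ?_⟩
  · have e := solution_value (w.2.1 s j) (w.hasQuasiDeriv s j) (right_mem_edge j)
    rw [vertex_succ_sub, hval, (w.2.2.2.1 s j).1] at e
    exact e
  · rw [← w.2.2.2.2 j]
    refine Finset.sum_congr rfl fun s _ => ?_
    have e := solution_deriv (w.2.1 s (j - 1)) (w.hasQuasiDeriv s (j - 1)) (right_mem_edge (j - 1))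
    rw [vertex_succ_sub, (w.2.2.2.1 s (j - 1)).1] at e
    have hm : moment A (csol z) s (j - 1) h = ∫ t in vertex (j - 1)..vertex (j - 1 + 1),
      phase (potential A s) (t - vertex (j - 1)) * (h s : ℝ → ℂ) t
        * csol z (vertex (j - 1 + 1) - t) := rfl
    rw [← hm, sub_add_cancel] at e
    have k := phase_neg_mul (potential A s) Real.pi
    rw [cosEnd, sinEnd]
    linear_combination phase (-potential A s) Real.pi * e - p s (j - 1) (vertex j) * k

theorem exists_edgeSq_bound (z : ℂ) : ∃ K : ℝ, 0 < K ∧ ∀ (A : ℝ) (α : ℤ → ℝ) (f h : L2Graph)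
    (u p : Fin 2 → ℤ → ℝ → ℂ), IsWitness A α f (z • f + h) u p → ∀ s j,
      edgeSq f s j ≤ K * (‖u 0 j (vertex j)‖ ^ 2 + ‖p s j (vertex j)‖ ^ 2 + edgeSq h s j) := by
  obtain ⟨K, hK, hb⟩ := exists_solution_bound z
  have hπ := Real.pi_pos
  refine ⟨Real.pi * K * (1 + Real.pi), by positivity, fun A α f h u p w s j => ?_⟩
  have h1 := edgeSq_le_of_bound (w.1 s j) (hb _ j _ _ _ (w.2.1 s j) (w.hasQuasiDeriv s j)
    (integrableOn_edge _ j))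
  rw [(w.2.2.2.1 s j).1] at h1
  have h2 := sq_integral_edge_le h s j
  have h3 := edgeSq_nonneg h s j
  refine h1.trans ?_
  rw [mul_assoc, mul_assoc]
  refine mul_le_mul_of_nonneg_left ?_ hπ.le
  refine mul_le_mul_of_nonneg_left ?_ hK.le
  nlinarith [sq_nonneg ‖u 0 j (vertex j)‖, sq_nonneg ‖p s j (vertex j)‖]

theorem exists_trace_sq_bound : ∃ K : ℝ, 0 < K ∧ ∀ (A : ℝ) (α : ℤ → ℝ) (f g : L2Graph)
    (u p : Fin 2 → ℤ → ℝ → ℂ), IsWitness A α f g u p → ∀ j,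
      ‖u 0 j (vertex j)‖ ^ 2 ≤ K * (edgeSq f 0 j + edgeSq g 0 j) := by
  obtain ⟨K, hK, hb⟩ := exists_trace_bound
  have hπ := Real.pi_pos
  refine ⟨K * Real.pi, by positivity, fun A α f g u p w j => ?_⟩
  have h1 := hb _ j _ _ _ (w.2.1 0 j) (w.2.2.1 0 j) (integrableOn_edge _ j)
  have e : ∫ x in edge j, ‖u 0 j x‖ = ∫ x in edge j, ‖(f 0 : ℝ → ℂ) x‖ := by
    refine integral_congr_ae ?_
    filter_upwards [w.1 0 j] with x hx
    rw [hx]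
  rw [e] at h1
  refine h1.trans ?_
  rw [mul_assoc]
  refine mul_le_mul_of_nonneg_left ?_ hK.le
  linarith [sq_integral_edge_le f 0 j, sq_integral_edge_le g 0 j]

theorem exists_witness {P : ℤ → ℂ} {q : Fin 2 → ℤ → ℂ} (V : VertexEquations A α z h P q)
    (hP : Summable fun j => ‖P j‖ ^ 2) (hq : ∀ s, Summable fun j => ‖q s j‖ ^ 2) :
    ∃ f u p, IsWitness A α f (z • f + h) u p ∧ (∀ j, u 0 j (vertex j) = P j) ∧
      ∀ s j, p s j (vertex j) = q s j := by
  choose u p hu hp huP hpq using fun (s : Fin 2) (j : ℤ) =>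
    exists_solution (potential A s) j z (P j) (q s j) (intervalIntegrable_edge (h s) j)
  obtain ⟨K, hK, hb⟩ := exists_solution_bound z
  have hglue : ∀ s, ∃ g : Lp ℂ 2 (volume : Measure ℝ),
      ∀ j, (g : ℝ → ℂ) =ᵐ[volume.restrict (edge j)] u s j := by
    intro s
    refine exists_glue (fun j => (hu s j).1)
      (M := fun j => K * (‖P j‖ ^ 2 + ‖q s j‖ ^ 2 + Real.pi * edgeSq h s j)) ?_ fun j x hx => ?_
    · exact (((hP.add (hq s)).add ((hasSum_edge_sq (h s)).summable.mul_left _)).mul_left _)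
    · refine (hb _ j _ _ _ (hu s j) (hp s j) (integrableOn_edge _ j) x hx).trans ?_
      rw [huP, hpq]
      refine mul_le_mul_of_nonneg_left ?_ hK.le
      linarith [sq_integral_edge_le h s j]
  choose F hF using hglue
  refine ⟨WithLp.toLp 2 F, u, p, ⟨hF, hu, fun s j => ?_, fun s j => ⟨?_, ?_⟩, fun j => ?_⟩,
    fun j => huP 0 j, hpq⟩
  · refine (hp s j).congr_edge ?_
    filter_upwards [ae_restrict_of_ae (coe_smul_add_ae z (WithLp.toLp 2 F) h s), hF s j]
      with x h1 h2
    rw [h1, ← h2]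
  · rw [huP, huP]
  · have e := solution_value (hu s (j - 1)) (hp s (j - 1)) (right_mem_edge (j - 1))
    have c := V.continuity s (j - 1)
    have hm : moment A (ssol z) s (j - 1) h = ∫ t in vertex (j - 1)..vertex (j - 1 + 1),
      phase (potential A s) (t - vertex (j - 1)) * (h s : ℝ → ℂ) t
        * ssol z (vertex (j - 1 + 1) - t) := rfl
    rw [vertex_succ_sub, ← hm, huP, hpq] at e
    rw [cosEnd, sinEnd, ← e, sub_add_cancel] at c
    rw [huP 0 j]
    exact (mul_left_cancel₀ (phase_ne_zero _ _) c).symm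
  · rw [huP, ← V.flux j]
    refine Finset.sum_congr rfl fun s _ => ?_
    have e := solution_deriv (hu s (j - 1)) (hp s (j - 1)) (right_mem_edge (j - 1))
    have hm : moment A (csol z) s (j - 1) h = ∫ t in vertex (j - 1)..vertex (j - 1 + 1),
      phase (potential A s) (t - vertex (j - 1)) * (h s : ℝ → ℂ) t
        * csol z (vertex (j - 1 + 1) - t) := rfl
    rw [vertex_succ_sub, ← hm, huP, hpq, sub_add_cancel] at e
    have k := phase_neg_mul (potential A s) Real.pi
    rw [hpq, cosEnd, sinEnd]
    linear_combination -phase (-potential A s) Real.pi * e + p s (j - 1) (vertex j) * k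

theorem sum_phase (A : ℝ) :
    ∑ s, phase (potential A s) Real.pi = 2 * (Real.cos (A * Real.pi) : ℂ) := by
  rw [Fin.sum_univ_two, Complex.ofReal_cos, Complex.two_cos]
  simp only [potential, phase, Matrix.cons_val_zero, Matrix.cons_val_one]
  push_cast
  ring_nf

theorem sum_phase_neg (A : ℝ) :
    ∑ s, phase (-potential A s) Real.pi = 2 * (Real.cos (A * Real.pi) : ℂ) := by
  rw [Fin.sum_univ_two, Complex.ofReal_cos, Complex.two_cos]
  simp only [potential, phase, Matrix.cons_val_zero, Matrix.cons_val_one]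
  push_cast
  ring_nf

/-- The right-hand side of the equation for the vertex values produced by the source `h`. -/
def sourceTerm (A : ℝ) (z : ℂ) (h : L2Graph) (j : ℤ) : ℂ :=
  -(1 / 2) * ∑ s, (moment A (ssol z) s j h + phase (-potential A s) Real.pi *
    (sinEnd z * moment A (csol z) s (j - 1) h - cosEnd z * moment A (ssol z) s (j - 1) h))

/-- The quasiderivatives at the left ends of the edges in terms of the vertex values. -/
def slope (A : ℝ) (z : ℂ) (h : L2Graph) (P : ℤ → ℂ) (s : Fin 2) (j : ℤ) : ℂ :=
  (phase (potential A s) Real.pi * P (j + 1) - P j * cosEnd z + moment A (ssol z) s j h) / sinEnd z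

theorem slope_flux (hz : sinEnd z ≠ 0) (P : ℤ → ℂ) (j : ℤ) :
    sinEnd z * ∑ s, (slope A z h P s j - phase (-potential A s) Real.pi *
      (-(z * P (j - 1) * sinEnd z) + slope A z h P s (j - 1) * cosEnd z
        - moment A (csol z) s (j - 1) h)) =
      2 * (Real.cos (A * Real.pi) * (P (j + 1) + P (j - 1)) - 2 * cosEnd z * P j
        - sourceTerm A z h j) := by
  have k : ∀ s, phase (-potential A s) Real.pi * phase (potential A s) Real.pi = 1 := fun s =>
    phase_neg_mul _ _
  have k2 : cosEnd z ^ 2 + z * sinEnd z ^ 2 = 1 := csol_sq_add z Real.pi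
  have e : ∀ s, sinEnd z * (slope A z h P s j - phase (-potential A s) Real.pi *
      (-(z * P (j - 1) * sinEnd z) + slope A z h P s (j - 1) * cosEnd z
        - moment A (csol z) s (j - 1) h)) =
      phase (potential A s) Real.pi * P (j + 1) + phase (-potential A s) Real.pi * P (j - 1)
        - 2 * cosEnd z * P j + (moment A (ssol z) s j h + phase (-potential A s) Real.pi *
    (sinEnd z * moment A (csol z) s (j - 1) h - cosEnd z * moment A (ssol z) s (j - 1) h)) := by
    intro s
    have d : ∀ i, sinEnd z * slope A z h P s i = phase (potential A s) Real.pi * P (i + 1)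
        - P i * cosEnd z + moment A (ssol z) s i h := fun i => by
      rw [slope]
      field_simp
    have d1 := d j
    have d2 := d (j - 1)
    rw [sub_add_cancel] at d2
    linear_combination d1 - phase (-potential A s) Real.pi * cosEnd z * d2
      - cosEnd z * P j * k s + phase (-potential A s) Real.pi * P (j - 1) * k2
  rw [Finset.mul_sum, Finset.sum_congr rfl fun s _ => e s, Finset.sum_add_distrib,
    Finset.sum_sub_distrib, Finset.sum_add_distrib, ← Finset.sum_mul, ← Finset.sum_mul, sum_phase,
    sum_phase_neg, sourceTerm]
  simp only [Finset.sum_const, Finset.card_univ, Fintype.card_fin]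
  ring

theorem vertexEquations_iff (hz : sinEnd z ≠ 0) {P : ℤ → ℂ} {q : Fin 2 → ℤ → ℂ} :
    VertexEquations A α z h P q ↔ (q = slope A z h P ∧ ∀ j, Real.cos (A * Real.pi) *
      (P (j + 1) + P (j - 1)) - (2 * cosEnd z + α j / 2 * sinEnd z) * P j
        = sourceTerm A z h j) := by
  constructor
  · intro V
    have hq : q = slope A z h P := by
      funext s j
      rw [slope, eq_div_iff hz]
      linear_combination -V.continuity s j
    refine ⟨hq, fun j => ?_⟩
    have e1 := slope_flux (A := A) (h := h) hz P j
    have e2 := V.flux j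
    rw [hq] at e2
    rw [e2] at e1
    linear_combination -(1 / 2) * e1
  · rintro ⟨rfl, hrec⟩
    refine ⟨fun s j => ?_, fun j => ?_⟩
    · rw [slope]
      field_simp
      ring
    · refine mul_left_cancel₀ hz ?_
      rw [slope_flux hz]
      linear_combination 2 * hrec j

theorem exists_slope_bound (z : ℂ) : ∃ K : ℝ, 0 < K ∧ ∀ (A : ℝ) (h : L2Graph) (P : ℤ → ℂ)
    (s : Fin 2) (j : ℤ), ‖slope A z h P s j‖ ^ 2
      ≤ K * (‖P j‖ ^ 2 + ‖P (j + 1)‖ ^ 2 + edgeSq h s j) := by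
  obtain ⟨K, hK, hb⟩ := exists_moment_bound (continuous_ssol z)
  set d := ‖(sinEnd z)⁻¹‖ with hd
  have hd0 : 0 ≤ d := norm_nonneg _
  refine ⟨3 * d ^ 2 * (1 + ‖cosEnd z‖ ^ 2 + K) + 1, by positivity, fun A h P s j => ?_⟩
  have h1 : ‖slope A z h P s j‖ ≤ d * (‖P (j + 1)‖ + ‖P j‖ * ‖cosEnd z‖
      + ‖moment A (ssol z) s j h‖) := by
    rw [slope, div_eq_mul_inv, norm_mul, mul_comm]
    refine mul_le_mul_of_nonneg_left ?_ hd0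
    refine (norm_add_le _ _).trans (add_le_add_left ((norm_sub_le _ _).trans ?_) _)
    rw [norm_mul, norm_mul, norm_phase, one_mul]
  have h2 := hb A s j h
  have h3 := edgeSq_nonneg h s j
  have h4 : (‖P (j + 1)‖ + ‖P j‖ * ‖cosEnd z‖ + ‖moment A (ssol z) s j h‖) ^ 2 ≤
      3 * (‖P (j + 1)‖ ^ 2 + ‖P j‖ ^ 2 * ‖cosEnd z‖ ^ 2 + ‖moment A (ssol z) s j h‖ ^ 2) := by
    nlinarith [sq_nonneg (‖P (j + 1)‖ - ‖P j‖ * ‖cosEnd z‖),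
      sq_nonneg (‖P (j + 1)‖ - ‖moment A (ssol z) s j h‖),
      sq_nonneg (‖P j‖ * ‖cosEnd z‖ - ‖moment A (ssol z) s j h‖)]
  have h5 : ‖P (j + 1)‖ ^ 2 + ‖P j‖ ^ 2 * ‖cosEnd z‖ ^ 2 + K * edgeSq h s j ≤
      (1 + ‖cosEnd z‖ ^ 2 + K) * (‖P j‖ ^ 2 + ‖P (j + 1)‖ ^ 2 + edgeSq h s j) := by
    have a1 := sq_nonneg ‖P j‖
    have a2 := sq_nonneg ‖P (j + 1)‖
    have a3 := sq_nonneg ‖cosEnd z‖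
    have b1 := mul_nonneg a3 a2
    have b2 := mul_nonneg a3 h3
    have b3 := mul_nonneg hK.le a1
    have b4 := mul_nonneg hK.le a2
    nlinarith
  calc ‖slope A z h P s j‖ ^ 2 ≤ (d * (‖P (j + 1)‖ + ‖P j‖ * ‖cosEnd z‖
        + ‖moment A (ssol z) s j h‖)) ^ 2 := by gcongr
    _ = d ^ 2 * (‖P (j + 1)‖ + ‖P j‖ * ‖cosEnd z‖ + ‖moment A (ssol z) s j h‖) ^ 2 := by ring
    _ ≤ d ^ 2 * (3 * ((1 + ‖cosEnd z‖ ^ 2 + K) *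
        (‖P j‖ ^ 2 + ‖P (j + 1)‖ ^ 2 + edgeSq h s j))) := by
        refine mul_le_mul_of_nonneg_left (h4.trans ?_) (sq_nonneg d)
        linarith
    _ ≤ _ := by
        have : 0 ≤ ‖P j‖ ^ 2 + ‖P (j + 1)‖ ^ 2 + edgeSq h s j := by positivity
        linarith

theorem exists_sourceTerm_bound (A : ℝ) (z : ℂ) : ∃ K : ℝ, 0 < K ∧ ∀ (h : L2Graph) (j : ℤ),
    ‖sourceTerm A z h j‖ ^ 2 ≤ K * (∑ s, edgeSq h s j + ∑ s, edgeSq h s (j - 1)) := by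
  obtain ⟨K₁, hK₁, hb₁⟩ := exists_moment_bound (continuous_ssol z)
  obtain ⟨K₂, hK₂, hb₂⟩ := exists_moment_bound (continuous_csol z)
  set S := ‖sinEnd z‖ with hS
  set C := ‖cosEnd z‖ with hC
  refine ⟨3 * (K₁ + S ^ 2 * K₂ + C ^ 2 * K₁), by positivity, fun h j => ?_⟩
  set m₁ := fun s => moment A (ssol z) s j h
  set m₂ := fun s => moment A (csol z) s (j - 1) h
  set m₃ := fun s => moment A (ssol z) s (j - 1) h
  have h1 : ‖sourceTerm A z h j‖ ≤ 1 / 2 * ∑ s, (‖m₁ s‖ + S * ‖m₂ s‖ + C * ‖m₃ s‖) := by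
    rw [sourceTerm, norm_mul, norm_neg]
    have : ‖(1 / 2 : ℂ)‖ = 1 / 2 := by norm_num
    rw [this]
    refine mul_le_mul_of_nonneg_left (norm_sum_le_of_le _ fun s _ => ?_) (by norm_num)
    refine (norm_add_le _ _).trans ?_
    rw [norm_mul, norm_phase, one_mul, add_assoc]
    refine add_le_add_right ((norm_sub_le _ _).trans ?_) _
    rw [norm_mul, norm_mul]
  have h2 : ∀ s, (‖m₁ s‖ + S * ‖m₂ s‖ + C * ‖m₃ s‖) ^ 2 ≤
      3 * (K₁ + S ^ 2 * K₂ + C ^ 2 * K₁) * (edgeSq h s j + edgeSq h s (j - 1)) := by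
    intro s
    have e1 : ‖m₁ s‖ ^ 2 ≤ K₁ * edgeSq h s j := hb₁ A s j h
    have e2 : ‖m₂ s‖ ^ 2 ≤ K₂ * edgeSq h s (j - 1) := hb₂ A s (j - 1) h
    have e3 : ‖m₃ s‖ ^ 2 ≤ K₁ * edgeSq h s (j - 1) := hb₁ A s (j - 1) h
    have p1 := edgeSq_nonneg h s j
    have p2 := edgeSq_nonneg h s (j - 1)
    have e4 : (‖m₁ s‖ + S * ‖m₂ s‖ + C * ‖m₃ s‖) ^ 2 ≤
        3 * (‖m₁ s‖ ^ 2 + S ^ 2 * ‖m₂ s‖ ^ 2 + C ^ 2 * ‖m₃ s‖ ^ 2) := by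
      nlinarith [sq_nonneg (‖m₁ s‖ - S * ‖m₂ s‖), sq_nonneg (‖m₁ s‖ - C * ‖m₃ s‖),
        sq_nonneg (S * ‖m₂ s‖ - C * ‖m₃ s‖)]
    have e5 := mul_le_mul_of_nonneg_left e2 (sq_nonneg S)
    have e6 := mul_le_mul_of_nonneg_left e3 (sq_nonneg C)
    have q1 := mul_nonneg hK₁.le p2
    have q2 : 0 ≤ S ^ 2 * K₂ * edgeSq h s j := by positivity
    have q3 : 0 ≤ C ^ 2 * K₁ * edgeSq h s j := by positivity
    nlinarith
  have h3 : (1 / 2 * ∑ s, (‖m₁ s‖ + S * ‖m₂ s‖ + C * ‖m₃ s‖)) ^ 2 ≤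
      ∑ s, (‖m₁ s‖ + S * ‖m₂ s‖ + C * ‖m₃ s‖) ^ 2 := by
    simp only [Fin.sum_univ_two]
    nlinarith [sq_nonneg (‖m₁ 0‖ + S * ‖m₂ 0‖ + C * ‖m₃ 0‖ - (‖m₁ 1‖ + S * ‖m₂ 1‖ + C * ‖m₃ 1‖)),
      sq_nonneg (‖m₁ 0‖ + S * ‖m₂ 0‖ + C * ‖m₃ 0‖), sq_nonneg (‖m₁ 1‖ + S * ‖m₂ 1‖ + C * ‖m₃ 1‖)]
  calc ‖sourceTerm A z h j‖ ^ 2 ≤ (1 / 2 * ∑ s, (‖m₁ s‖ + S * ‖m₂ s‖ + C * ‖m₃ s‖)) ^ 2 := by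
        gcongr
    _ ≤ _ := h3.trans (Finset.sum_le_sum fun s _ => h2 s)
    _ = _ := by rw [← Finset.mul_sum, Finset.sum_add_distrib]

theorem hasSum_edgeSq_pred (h : L2Graph) :
    HasSum (fun j => ∑ s, edgeSq h s (j - 1)) (‖h‖ ^ 2) :=
  ((Equiv.subRight (1 : ℤ)).hasSum_iff (f := fun j => ∑ s, edgeSq h s j)).2 (hasSum_edgeSq h)

theorem summable_sourceTerm (A : ℝ) (z : ℂ) (h : L2Graph) :
    Summable fun j => ‖sourceTerm A z h j‖ ^ 2 := by
  obtain ⟨K, -, hb⟩ := exists_sourceTerm_bound A z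
  exact Summable.of_nonneg_of_le (fun _ => sq_nonneg _) (hb h)
    (((hasSum_edgeSq h).add (hasSum_edgeSq_pred h)).summable.mul_left K)

/-- The map from sources to right-hand sides of the equation for the vertex values. -/
def sourceₗ (A : ℝ) (z : ℂ) : L2Graph →ₗ[ℂ] Seq where
  toFun h := Seq.mk (sourceTerm A z h) (summable_sourceTerm A z h)
  map_add' h h' := Seq.ext fun j => by
    rw [Seq.add_apply]
    simp only [Seq.mk_apply, sourceTerm, Fin.sum_univ_two, moment_add A (continuous_ssol z),
      moment_add A (continuous_csol z)]
    ring
  map_smul' c h := Seq.ext fun j => by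
    rw [RingHom.id_apply, Seq.smul_apply]
    simp only [Seq.mk_apply, sourceTerm, Fin.sum_univ_two, moment_smul]
    ring

theorem exists_source_norm_le (A : ℝ) (z : ℂ) : ∃ K : ℝ, ∀ h, ‖sourceₗ A z h‖ ≤ K * ‖h‖ := by
  obtain ⟨K, hK, hb⟩ := exists_sourceTerm_bound A z
  refine ⟨Real.sqrt (2 * K), fun h => ?_⟩
  have h1 : ‖sourceₗ A z h‖ ^ 2 ≤ K * (‖h‖ ^ 2 + ‖h‖ ^ 2) :=
    hasSum_le (hb h) (Seq.hasSum (sourceₗ A z h))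
      (((hasSum_edgeSq h).add (hasSum_edgeSq_pred h)).mul_left K)
  refine abs_le_of_sq_le_sq' ?_ (by positivity) |>.2
  rw [mul_pow, Real.sq_sqrt (by positivity)]
  linarith

/-- The map from sources to right-hand sides of the equation for the vertex values. -/
def source (A : ℝ) (z : ℂ) : L2Graph →L[ℂ] Seq :=
  (sourceₗ A z).mkContinuousOfExistsBound (exists_source_norm_le A z)

theorem source_apply (A : ℝ) (z : ℂ) (h : L2Graph) (j : ℤ) :
    source A z h j = sourceTerm A z h j := rfl

theorem IsWitness.summable_trace (w : IsWitness A α f g u p) :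
    Summable fun j => ‖u 0 j (vertex j)‖ ^ 2 := by
  obtain ⟨K, -, hb⟩ := exists_trace_sq_bound
  exact Summable.of_nonneg_of_le (fun _ => sq_nonneg _) (hb A α f g u p w)
    (((hasSum_edge_sq (f 0)).summable.add (hasSum_edge_sq (g 0)).summable).mul_left K)

/-- The sequence of vertex values. -/
def IsWitness.trace (w : IsWitness A α f g u p) : Seq :=
  Seq.mk (fun j => u 0 j (vertex j)) w.summable_trace

theorem IsWitness.trace_apply (w : IsWitness A α f g u p) (j : ℤ) :
    w.trace j = u 0 j (vertex j) := rfl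

theorem exists_trace_norm_bound : ∃ K : ℝ, 0 < K ∧ ∀ (A : ℝ) (α : ℤ → ℝ) (f g : L2Graph)
    (u p : Fin 2 → ℤ → ℝ → ℂ) (w : IsWitness A α f g u p),
      ‖w.trace‖ ^ 2 ≤ K * (‖f‖ ^ 2 + ‖g‖ ^ 2) := by
  obtain ⟨K, hK, hb⟩ := exists_trace_sq_bound
  refine ⟨K, hK, fun A α f g u p w => ?_⟩
  refine hasSum_le (fun j => (hb A α f g u p w j).trans ?_) (Seq.hasSum w.trace)
    (((hasSum_edgeSq f).add (hasSum_edgeSq g)).mul_left K)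
  refine mul_le_mul_of_nonneg_left ?_ hK.le
  exact add_le_add (edgeSq_le_sum f 0 j) (edgeSq_le_sum g 0 j)

theorem IsWitness.jacobi_trace {α γ : ℝ} (hz : sinEnd z ≠ 0)
    (w : IsWitness A (impurityCoupling α γ) f (z • f + h) u p) :
    jacobi A α γ z w.trace = source A z h := by
  refine Seq.ext fun j => ?_
  rw [jacobi_apply, source_apply]
  exact ((vertexEquations_iff hz).1 w.vertexEquations).2 j

theorem exists_witness_of_jacobi {α γ : ℝ} (hz : sinEnd z ≠ 0) {x : Seq}
    (hx : jacobi A α γ z x = source A z h) :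
    ∃ f u p, ∃ w : IsWitness A (impurityCoupling α γ) f (z • f + h) u p, w.trace = x := by
  have V : VertexEquations A (impurityCoupling α γ) z h x (slope A z h x) := by
    refine (vertexEquations_iff hz).2 ⟨rfl, fun j => ?_⟩
    rw [← source_apply, ← hx, jacobi_apply]
  obtain ⟨K, -, hb⟩ := exists_slope_bound z
  have hq : ∀ s, Summable fun j => ‖slope A z h x s j‖ ^ 2 := by
    intro s
    refine Summable.of_nonneg_of_le (fun _ => sq_nonneg _) (hb A h x s) (Summable.mul_left K ?_)
    exact ((Seq.hasSum x).summable.add (summable_shift 1 x)).add (hasSum_edge_sq (h s)).summable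
  obtain ⟨f, u, p, w, hP, -⟩ := exists_witness V (Seq.hasSum x).summable hq
  exact ⟨f, u, p, w, Seq.ext hP⟩

/-- Off the Dirichlet eigenvalues, a solution is controlled edge by edge by its vertex values and
the source. -/
theorem exists_local_bound {z : ℂ} (hz : sinEnd z ≠ 0) : ∃ K : ℝ, 0 < K ∧ ∀ (A : ℝ) (α : ℤ → ℝ)
    (f h : L2Graph) (u p : Fin 2 → ℤ → ℝ → ℂ) (w : IsWitness A α f (z • f + h) u p) (j : ℤ),
      ∑ s, edgeSq f s j
        ≤ K * (‖w.trace j‖ ^ 2 + ‖w.trace (j + 1)‖ ^ 2 + ∑ s, edgeSq h s j) := by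
  obtain ⟨K₁, hK₁, hb₁⟩ := exists_edgeSq_bound z
  obtain ⟨K₂, hK₂, hb₂⟩ := exists_slope_bound z
  refine ⟨2 * (K₁ * (1 + K₂)), by positivity, fun A α f h u p w j => ?_⟩
  have hs : ∀ s, edgeSq f s j ≤ K₁ * (1 + K₂) * (‖w.trace j‖ ^ 2 + ‖w.trace (j + 1)‖ ^ 2
      + edgeSq h s j) := by
    intro s
    have e1 := hb₁ A α f h u p w s j
    have e2 := congrFun (congrFun ((vertexEquations_iff hz).1 w.vertexEquations).1 s) j
    have e3 := hb₂ A h w.trace s j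
    have e2' : p s j (vertex j) = slope A z h w.trace s j := e2
    rw [e2', ← w.trace_apply] at e1
    have n1 := edgeSq_nonneg h s j
    refine e1.trans ?_
    rw [mul_assoc]
    refine mul_le_mul_of_nonneg_left ?_ hK₁.le
    nlinarith [sq_nonneg ‖w.trace (j + 1)‖]
  have h1 := Finset.sum_le_sum fun s (_ : s ∈ Finset.univ) => hs s
  refine h1.trans ?_
  have n0 := edgeSq_nonneg h 0 j
  have n1 := edgeSq_nonneg h 1 j
  simp only [Fin.sum_univ_two]
  have : 0 ≤ K₁ * (1 + K₂) := by positivity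
  have m0 := mul_nonneg this n0
  have m1 := mul_nonneg this n1
  nlinarith

theorem exists_norm_bound {z : ℂ} (hz : sinEnd z ≠ 0) : ∃ K : ℝ, 0 < K ∧ ∀ (A : ℝ) (α : ℤ → ℝ)
    (f h : L2Graph) (u p : Fin 2 → ℤ → ℝ → ℂ) (w : IsWitness A α f (z • f + h) u p),
      ‖f‖ ^ 2 ≤ K * (2 * ‖w.trace‖ ^ 2 + ‖h‖ ^ 2) := by
  obtain ⟨K, hK, hb⟩ := exists_local_bound hz
  refine ⟨K, hK, fun A α f h u p w => ?_⟩
  have h2 : HasSum (fun j => ‖w.trace (j + 1)‖ ^ 2) (‖w.trace‖ ^ 2) :=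
    ((Equiv.addRight (1 : ℤ)).hasSum_iff (f := fun j => ‖w.trace j‖ ^ 2)).2 (Seq.hasSum w.trace)
  have := hasSum_le (hb A α f h u p w) (hasSum_edgeSq f)
    ((((Seq.hasSum w.trace).add h2).add (hasSum_edgeSq h)).mul_left K)
  rwa [← two_mul] at this

end Reduction

section Resolvent

/-! ### Closed operators and Weyl sequences -/

section Abstract

open Filter Topology

variable {H : Type*} [NormedAddCommGroup H] [InnerProductSpace ℂ H]

theorem shifted_apply (T : H →ₗ.[ℂ] H) (z : ℂ) (x : T.domain) :
    shifted T z x = T x - z • (x : H) := rfl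

theorem isClosed_graph_of_resolvent {T : H →ₗ.[ℂ] H} {z : ℂ}
    (hb : Function.Bijective (shifted T z))
    (hC : ∃ C : ℝ, ∀ x : T.domain, ‖(x : H)‖ ≤ C * ‖shifted T z x‖) :
    IsClosed (T.graph : Set (H × H)) := by
  obtain ⟨C, hC⟩ := hC
  set e := LinearEquiv.ofBijective (shifted T z) hb with he
  have hes : ∀ x, shifted T z (e.symm x) = x := fun x => e.apply_symm_apply x
  set R : H →L[ℂ] H := (T.domain.subtype ∘ₗ e.symm.toLinearMap).mkContinuous C fun x => by
    have := hC (e.symm x)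
    rwa [hes] at this with hR
  have hRa : ∀ x, R x = (e.symm x : H) := fun x => rfl
  have hset : (T.graph : Set (H × H)) = {x | x.1 = R (x.2 - z • x.1)} := by
    ext ⟨f, g⟩
    simp only [SetLike.mem_coe, LinearPMap.mem_graph_iff, mem_ofPred_eq, hRa]
    constructor
    · rintro ⟨y, rfl, rfl⟩
      have : e y = T y - z • (y : H) := rfl
      rw [← this, e.symm_apply_apply]
    · intro h
      refine ⟨e.symm (g - z • f), h.symm, ?_⟩
      have := hes (g - z • f)
      rw [shifted_apply, ← h] at this
      exact sub_left_injective this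
  rw [hset]
  exact isClosed_eq (by fun_prop) (by fun_prop)

theorem mem_spectrumSet_of_approx {T : H →ₗ.[ℂ] H} {z : ℂ} {f : ℕ → T.domain}
    (hf : ∀ᶠ n in atTop, (f n : H) ≠ 0)
    (hr : Tendsto (fun n => ‖shifted T z (f n)‖ / ‖(f n : H)‖) atTop (𝓝 0)) :
    z ∈ spectrumSet T := by
  rintro ⟨-, C, hC⟩
  have h1 : Tendsto (fun n => C * (‖shifted T z (f n)‖ / ‖(f n : H)‖)) atTop (𝓝 0) := by
    simpa using hr.const_mul C
  obtain ⟨n, h2, h3⟩ := ((h1.eventually (gt_mem_nhds one_pos)).and hf).exists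
  have h4 : 0 < ‖(f n : H)‖ := norm_pos_iff.2 h3
  rw [← mul_div_assoc, div_lt_one h4] at h2
  exact absurd (hC (f n)) (not_le.2 h2)

theorem mem_essentialSpectrum_of_weyl [CompleteSpace H] {T : H →ₗ.[ℂ] H} {z : ℂ}
    (hT : IsClosed (T.graph : Set (H × H))) {f : ℕ → T.domain}
    (hf : ∀ᶠ n in atTop, (f n : H) ≠ 0)
    (ho : ∀ m n, m ≠ n → inner ℂ (f m : H) (f n : H) = 0)
    (hr : Tendsto (fun n => ‖shifted T z (f n)‖ / ‖(f n : H)‖) atTop (𝓝 0)) :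
    z ∈ essentialSpectrum T := by
  rintro ⟨hker, hcl, -⟩
  have hcg : CompleteSpace T.graph := hT.completeSpace_coe
  have hcr : CompleteSpace (LinearMap.range (shifted T z)) := hcl.completeSpace_coe
  have hmem : ∀ x : T.graph, (x : H × H).2 - z • (x : H × H).1 ∈ LinearMap.range (shifted T z) := by
    rintro ⟨⟨f, g⟩, hx⟩
    obtain ⟨y, rfl, rfl⟩ := (T.mem_graph_iff).1 hx
    exact ⟨y, rfl⟩
  set Φ : T.graph →L[ℂ] LinearMap.range (shifted T z) :=
    ((ContinuousLinearMap.snd ℂ H H - z • ContinuousLinearMap.fst ℂ H H).comp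
      T.graph.subtypeL).codRestrict _ hmem with hΦ
  have hsurj : Function.Surjective Φ := by
    rintro ⟨_, ⟨y, rfl⟩⟩
    exact ⟨⟨((y : H), T y), T.mem_graph y⟩, rfl⟩
  obtain ⟨C, hC, hpre⟩ := Φ.exists_preimage_norm_le hsurj
  have hk : ∀ n, ∃ k : T.domain, shifted T z k = 0 ∧
      ‖(f n : H) - k‖ ≤ C * ‖shifted T z (f n)‖ := by
    intro n
    obtain ⟨⟨⟨a, b⟩, hx⟩, hx1, hx2⟩ := hpre ⟨shifted T z (f n), ⟨f n, rfl⟩⟩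
    obtain ⟨y, rfl, rfl⟩ := (T.mem_graph_iff).1 hx
    have e : shifted T z y = shifted T z (f n) := congrArg Subtype.val hx1
    refine ⟨f n - y, by rw [map_sub, e, sub_self], ?_⟩
    have : ((f n : H) - ((f n - y : T.domain) : H)) = y := by simp
    rw [this]
    exact (norm_fst_le ((y : H), T y)).trans hx2
  choose k hk1 hk2 using hk
  set V : Submodule ℂ H := (LinearMap.ker (shifted T z)).map T.domain.subtype with hV
  have hVfin : FiniteDimensional ℂ V := inferInstance
  set e : ℕ → H := fun n => ((‖(f n : H)‖⁻¹ : ℝ) : ℂ) • (f n : H) with he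
  set κ : ℕ → V := fun n => ((‖(f n : H)‖⁻¹ : ℝ) : ℂ) •
    ⟨(k n : H), ⟨k n, LinearMap.mem_ker.2 (hk1 n), rfl⟩⟩ with hκ
  have hd : ∀ n, ‖e n - κ n‖ ≤ C * (‖shifted T z (f n)‖ / ‖(f n : H)‖) := by
    intro n
    have : e n - κ n = ((‖(f n : H)‖⁻¹ : ℝ) : ℂ) • ((f n : H) - k n) := by
      rw [smul_sub]
      rfl
    rw [this, norm_smul, Complex.norm_real, norm_inv, norm_norm, div_eq_inv_mul, mul_left_comm]
    exact mul_le_mul_of_nonneg_left (hk2 n) (by positivity)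
  have hd0 : Tendsto (fun n => e n - κ n) atTop (𝓝 0) := by
    refine squeeze_zero_norm hd ?_
    simpa using hr.const_mul C
  have hen : ∀ᶠ n in atTop, ‖e n‖ = 1 := by
    filter_upwards [hf] with n hn
    have : ‖(f n : H)‖ ≠ 0 := norm_ne_zero_iff.2 hn
    simp only [he, norm_smul, Complex.norm_real, norm_inv, norm_norm]
    field_simp
  have hκb : ∃ᶠ n in atTop, κ n ∈ Metric.closedBall (0 : V) 2 := by
    refine Eventually.frequently ?_
    filter_upwards [hen, hd0.norm.eventually (gt_mem_nhds (by simp : ‖(0 : H)‖ < 1))] with n h1 h2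
    rw [mem_closedBall_zero_iff]
    have h3 : ‖(κ n : H)‖ ≤ ‖e n‖ + ‖e n - κ n‖ := by
      have := norm_sub_le (e n) (e n - κ n)
      simpa using this
    have h4 : ‖κ n‖ = ‖(κ n : H)‖ := rfl
    linarith
  have hprop : ProperSpace V := FiniteDimensional.proper ℂ V
  obtain ⟨a, -, φ, hφ, hlim⟩ := tendsto_subseq_of_frequently_bounded
    (Metric.isBounded_closedBall) hκb
  have hlim' : Tendsto (fun n => (κ (φ n) : H)) atTop (𝓝 (a : H)) :=
    (continuous_subtype_val.tendsto a).comp hlim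
  have hle : Tendsto (fun n => e (φ n)) atTop (𝓝 (a : H)) := by
    have := (hd0.comp hφ.tendsto_atTop).add hlim'
    simpa using this
  have hle1 : Tendsto (fun n => e (φ (n + 1))) atTop (𝓝 (a : H)) :=
    hle.comp (tendsto_add_atTop_nat 1)
  have hdiff : Tendsto (fun n => ‖e (φ (n + 1)) - e (φ n)‖ ^ 2) atTop (𝓝 0) := by
    have := ((hle1.sub hle).norm).pow 2
    simpa using this
  have h2 : ∀ᶠ n in atTop, ‖e (φ (n + 1)) - e (φ n)‖ ^ 2 = 2 := by
    have t1 := hφ.tendsto_atTop.eventually hen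
    have t2 := (hφ.tendsto_atTop.comp (tendsto_add_atTop_nat 1)).eventually hen
    filter_upwards [t1, t2] with n n1 n2
    have n2' : ‖e (φ (n + 1))‖ = 1 := n2
    have horth : inner ℂ (e (φ (n + 1))) (e (φ n)) = 0 := by
      simp only [he, inner_smul_left, inner_smul_right]
      rw [ho _ _ (hφ.injective.ne (Nat.succ_ne_self n))]
      simp
    rw [@norm_sub_sq ℂ, horth, n1, n2']
    norm_num
  have h3 : Tendsto (fun n => ‖e (φ (n + 1)) - e (φ n)‖ ^ 2) atTop (𝓝 2) :=
    tendsto_const_nhds.congr' (h2.mono fun _ h => h.symm)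
  exact two_ne_zero (tendsto_nhds_unique h3 hdiff)

end Abstract

/-! ### The resolvent set -/

theorem shifted_hamiltonian_iff {A : ℝ} {α : ℤ → ℝ} {z : ℂ} {f h : L2Graph} :
    (∃ x : (hamiltonian A α).domain, (x : L2Graph) = f ∧ shifted (hamiltonian A α) z x = h) ↔
      IsHamiltonianPair A α f (z • f + h) := by
  rw [← mem_graph_hamiltonian, LinearPMap.mem_graph_iff]
  refine exists_congr fun x => and_congr_right fun hx => ?_
  rw [shifted_apply, hx, sub_eq_iff_eq_add, add_comm]

theorem exists_witness_of_shifted {A : ℝ} {α : ℤ → ℝ} {z : ℂ} (x : (hamiltonian A α).domain) :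
    ∃ u p, IsWitness A α (x : L2Graph)
      (z • (x : L2Graph) + shifted (hamiltonian A α) z x) u p :=
  isHamiltonianPair_iff.1 (shifted_hamiltonian_iff.1 ⟨x, rfl, rfl⟩)

theorem IsWitness.exists_shifted {A : ℝ} {α : ℤ → ℝ} {z : ℂ} {f h : L2Graph}
    {u p : Fin 2 → ℤ → ℝ → ℂ} (w : IsWitness A α f (z • f + h) u p) :
    ∃ x : (hamiltonian A α).domain, (x : L2Graph) = f ∧ shifted (hamiltonian A α) z x = h :=
  shifted_hamiltonian_iff.2 (isHamiltonianPair_iff.2 ⟨u, p, w⟩)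

variable {A α γ : ℝ} {z : ℂ}

theorem IsWitness.eq_zero_of_trace {β : ℤ → ℝ} {f : L2Graph} {u p : Fin 2 → ℤ → ℝ → ℂ}
    (hz : sinEnd z ≠ 0) (w : IsWitness A β f (z • f + 0) u p) (h : w.trace = 0) : f = 0 := by
  obtain ⟨K, -, hb⟩ := exists_norm_bound hz
  have := hb A β f 0 u p w
  rw [h] at this
  simp only [norm_zero, ne_eq, OfNat.ofNat_ne_zero, not_false_eq_true, zero_pow, mul_zero,
    add_zero] at this
  exact norm_eq_zero.1 (pow_eq_zero_iff two_ne_zero |>.1 (le_antisymm this (sq_nonneg _)))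

theorem bijective_shifted_of_isUnit (hz : sinEnd z ≠ 0) (hJ : IsUnit (jacobi A α γ z)) :
    Function.Bijective (shifted (hamiltonian A (impurityCoupling α γ)) z) ∧
      ∃ C : ℝ, ∀ x : (hamiltonian A (impurityCoupling α γ)).domain,
        ‖(x : L2Graph)‖ ≤ C * ‖shifted (hamiltonian A (impurityCoupling α γ)) z x‖ := by
  obtain ⟨J, hJ⟩ := hJ
  set G : Seq →L[ℂ] Seq := ↑J⁻¹ with hG
  have hGJ : ∀ x, G (jacobi A α γ z x) = x := fun x => by
    rw [← hJ]
    exact congrArg (fun T : Seq →L[ℂ] Seq => T x) J.inv_mul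
  have hJG : ∀ x, jacobi A α γ z (G x) = x := fun x => by
    rw [← hJ]
    exact congrArg (fun T : Seq →L[ℂ] Seq => T x) J.mul_inv
  have hker : ∀ x : (hamiltonian A (impurityCoupling α γ)).domain,
      shifted (hamiltonian A (impurityCoupling α γ)) z x = 0 → x = 0 := by
    intro x hx
    obtain ⟨u, p, w⟩ := exists_witness_of_shifted (z := z) x
    rw [hx] at w
    have h1 := w.jacobi_trace hz
    rw [map_zero] at h1
    have h2 := hGJ w.trace
    rw [h1, map_zero] at h2
    exact Subtype.ext (w.eq_zero_of_trace hz h2.symm)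
  refine ⟨⟨(injective_iff_map_eq_zero _).2 hker, fun h => ?_⟩, ?_⟩
  · obtain ⟨f, u, p, w, -⟩ := exists_witness_of_jacobi (A := A) (α := α) (γ := γ) (h := h) hz
      (hJG (source A z h))
    obtain ⟨x, -, hx⟩ := w.exists_shifted
    exact ⟨x, hx⟩
  · obtain ⟨K, hK, hb⟩ := exists_norm_bound hz
    set M := ‖G.comp (source A z)‖ with hM
    refine ⟨Real.sqrt (K * (2 * M ^ 2 + 1)), fun x => ?_⟩
    obtain ⟨u, p, w⟩ := exists_witness_of_shifted (z := z) x
    set h := shifted (hamiltonian A (impurityCoupling α γ)) z x with hh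
    have h1 : ‖w.trace‖ ≤ M * ‖h‖ := by
      have e := hGJ w.trace
      rw [w.jacobi_trace hz] at e
      rw [← e]
      exact (G.comp (source A z)).le_opNorm h
    have h2 := hb A _ _ _ u p w
    have h3 : ‖w.trace‖ ^ 2 ≤ (M * ‖h‖) ^ 2 := by gcongr
    refine (abs_le_of_sq_le_sq' ?_ (by positivity)).2
    rw [mul_pow, Real.sq_sqrt (by positivity)]
    refine h2.trans ?_
    rw [mul_assoc]
    refine mul_le_mul_of_nonneg_left ?_ hK.le
    nlinarith

theorem impurityCoupling_zero (α : ℝ) : impurityCoupling α 0 = periodicCoupling α := by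
  funext j
  simp [impurityCoupling, periodicCoupling]

theorem sinEnd_ne_zero_of_notMem (hz : z ∉ bandSet A α) : sinEnd z ≠ 0 := fun h => hz (Or.inl h)

theorem spectrumSet_subset : spectrumSet (hamiltonian A (periodicCoupling α)) ⊆ bandSet A α := by
  intro z hz
  by_contra h
  rw [← impurityCoupling_zero] at hz
  exact hz (bijective_shifted_of_isUnit (sinEnd_ne_zero_of_notMem h) (isUnit_jacobi h))

/-- The inverse of the Jacobi operator of the periodic chain. -/
def green (A α : ℝ) (z : ℂ) : Seq →L[ℂ] Seq := Ring.inverse (jacobi A α 0 z)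

theorem green_jacobi (hz : z ∉ bandSet A α) (x : Seq) : green A α z (jacobi A α 0 z x) = x :=
  congrArg (fun T : Seq →L[ℂ] Seq => T x) (Ring.inverse_mul_cancel _ (isUnit_jacobi hz))

theorem jacobi_green (hz : z ∉ bandSet A α) (x : Seq) : jacobi A α 0 z (green A α z x) = x :=
  congrArg (fun T : Seq →L[ℂ] Seq => T x) (Ring.mul_inverse_cancel _ (isUnit_jacobi hz))

/-- The sequence concentrated at the impurity. -/
def unitSeq : Seq := lp.single 2 1 1

theorem proj_eq (x : Seq) : proj x = x 1 • unitSeq := by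
  refine Seq.ext fun j => ?_
  rw [proj_apply_apply, Seq.smul_apply, unitSeq, lp.single_apply]
  by_cases h : j = 1
  · subst h
    simp
  · simp [h]

theorem unitSeq_one : unitSeq 1 = 1 := lp.single_apply_self 2 1 1

theorem jacobi_apply_eq (x : Seq) :
    jacobi A α γ z x = jacobi A α 0 z x - (γ / 2 * sinEnd z * x 1) • unitSeq := by
  have h : jacobi A α γ z x = jacobi A α 0 z x - (γ / 2 * sinEnd z) • proj x := by
    rw [jacobi_eq_sub A α γ z]
    rfl
  rw [h, proj_eq, smul_smul]

/-- The diagonal element of the inverse of the Jacobi operator at the impurity. -/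
def greenDiag (A α : ℝ) (z : ℂ) : ℂ := green A α z unitSeq 1

theorem jacobi_eq_iff (hz : z ∉ bandSet A α) (x b : Seq) :
    jacobi A α γ z x = b ↔
      x = green A α z b + (γ / 2 * sinEnd z * x 1) • green A α z unitSeq := by
  rw [jacobi_apply_eq, sub_eq_iff_eq_add]
  constructor
  · intro h
    have := green_jacobi hz x
    rw [h, map_add, map_smul] at this
    exact this.symm
  · intro h
    have := congrArg (jacobi A α 0 z) h
    rwa [map_add, map_smul, jacobi_green hz, jacobi_green hz] at this

theorem mem_range_shifted_iff (hz : sinEnd z ≠ 0) (h : L2Graph) :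
    h ∈ LinearMap.range (shifted (hamiltonian A (impurityCoupling α γ)) z) ↔
      ∃ x, jacobi A α γ z x = source A z h := by
  constructor
  · rintro ⟨x, rfl⟩
    obtain ⟨u, p, w⟩ := exists_witness_of_shifted (z := z) x
    exact ⟨w.trace, w.jacobi_trace hz⟩
  · rintro ⟨x, hx⟩
    obtain ⟨f, u, p, w, -⟩ := exists_witness_of_jacobi hz hx
    obtain ⟨y, -, hy⟩ := w.exists_shifted
    exact ⟨y, hy⟩

theorem range_shifted_eq (hz : z ∉ bandSet A α) :
    LinearMap.range (shifted (hamiltonian A (impurityCoupling α γ)) z) = ⊤ ∨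
      ∃ ℓ : L2Graph →L[ℂ] ℂ,
        LinearMap.range (shifted (hamiltonian A (impurityCoupling α γ)) z)
          = LinearMap.ker ℓ.toLinearMap := by
  have hS := sinEnd_ne_zero_of_notMem hz
  set k := γ / 2 * sinEnd z with hk
  by_cases h : k * greenDiag A α z = 1
  · right
    refine ⟨(lp.evalCLM ℂ (fun _ : ℤ => ℂ) 2 1).comp ((green A α z).comp (source A z)), ?_⟩
    ext b
    rw [mem_range_shifted_iff hS, LinearMap.mem_ker]
    change _ ↔ green A α z (source A z b) 1 = 0
    constructor
    · rintro ⟨x, hx⟩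
      have e := congrArg (fun y : Seq => y 1) ((jacobi_eq_iff hz _ _).1 hx)
      simp only [Seq.add_apply, Seq.smul_apply] at e
      have e' : green A α z unitSeq 1 = greenDiag A α z := rfl
      rw [e', ← hk] at e
      linear_combination -e - x 1 * h
    · intro h0
      refine ⟨green A α z (source A z b), (jacobi_eq_iff hz _ _).2 ?_⟩
      rw [h0, mul_zero, zero_smul, add_zero]
  · left
    rw [eq_top_iff]
    intro b _
    rw [mem_range_shifted_iff hS]
    have h1 : 1 - k * greenDiag A α z ≠ 0 := sub_ne_zero.2 (Ne.symm h)
    set y := green A α z (source A z b) with hy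
    refine ⟨y + (k * y 1 / (1 - k * greenDiag A α z)) • green A α z unitSeq,
      (jacobi_eq_iff hz _ _).2 ?_⟩
    congr 2
    rw [Seq.add_apply, Seq.smul_apply]
    have e' : green A α z unitSeq 1 = greenDiag A α z := rfl
    rw [e', ← hk]
    field_simp
    ring

theorem IsWitness.add_smul {β : ℤ → ℝ} {f g f' g' : L2Graph} {u p u' p' : Fin 2 → ℤ → ℝ → ℂ}
    (w : IsWitness A β f g u p) (w' : IsWitness A β f' g' u' p') (c : ℂ) :
    IsWitness A β (f + c • f') (g + c • g') (u + c • u') (p + c • p') := by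
  have hcoe : ∀ (f f' : L2Graph) (s : Fin 2), ((f + c • f') s : ℝ → ℂ) =ᵐ[volume]
      fun x => (f s : ℝ → ℂ) x + c * (f' s : ℝ → ℂ) x := by
    intro f f' s
    rw [add_comm f]
    filter_upwards [coe_smul_add_ae c f' f s] with x hx
    rw [hx, add_comm]
  refine ⟨fun s j => ?_, fun s j => (w.2.1 s j).add ((w'.2.1 s j).smul c), fun s j => ?_,
    fun s j => ?_, fun j => ?_⟩
  · filter_upwards [ae_restrict_of_ae (hcoe f f' s), w.1 s j, w'.1 s j] with x h1 h2 h3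
    rw [h1, h2, h3]
    rfl
  · refine ((w.2.2.1 s j).add ((w'.2.2.1 s j).smul c)).congr ?_
    filter_upwards [hcoe g g' s] with x h1
    rw [h1]
    simp only [Pi.add_apply, Pi.smul_apply, smul_eq_mul]
    ring
  · simp only [Pi.add_apply, Pi.smul_apply]
    rw [(w.2.2.2.1 s j).1, (w.2.2.2.1 s j).2, (w'.2.2.2.1 s j).1, (w'.2.2.2.1 s j).2]
    exact ⟨rfl, rfl⟩
  · have e1 := w.2.2.2.2 j
    have e2 := w'.2.2.2.2 j
    simp only [Fin.sum_univ_two, Pi.add_apply, Pi.smul_apply, smul_eq_mul] at e1 e2 ⊢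
    linear_combination e1 + c * e2

theorem exists_witness_of_mem_eigenspace {β : ℤ → ℝ} {x : (hamiltonian A β).domain}
    (hx : x ∈ eigenspace (hamiltonian A β) z) :
    ∃ u p, IsWitness A β (x : L2Graph) (z • (x : L2Graph) + 0) u p := by
  have h := exists_witness_of_shifted (z := z) x
  rwa [LinearMap.mem_ker.1 hx] at h

/-- An eigenfunction vanishing at the impurity vanishes. -/
theorem IsWitness.eq_zero_of_trace_one {f : L2Graph} {u p : Fin 2 → ℤ → ℝ → ℂ}
    (hz : z ∉ bandSet A α) (w : IsWitness A (impurityCoupling α γ) f (z • f + 0) u p)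
    (h : w.trace 1 = 0) : f = 0 := by
  have hS := sinEnd_ne_zero_of_notMem hz
  refine w.eq_zero_of_trace hS ?_
  have h1 := (jacobi_eq_iff hz _ _).1 (w.jacobi_trace hS)
  rw [h, map_zero, map_zero, mul_zero, zero_smul] at h1
  exact h1.trans (add_zero 0)

theorem eigenspace_le_span (hz : z ∉ bandSet A α) :
    ∃ v ∈ eigenspace (hamiltonian A (impurityCoupling α γ)) z,
      eigenspace (hamiltonian A (impurityCoupling α γ)) z ≤ Submodule.span ℂ {v} := by
  set T := hamiltonian A (impurityCoupling α γ) with hT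
  by_cases hne : eigenspace T z = ⊥
  · exact ⟨0, Submodule.zero_mem _, by rw [hne]; exact bot_le⟩
  obtain ⟨v, hv, hv0⟩ := Submodule.exists_mem_ne_zero_of_ne_bot hne
  refine ⟨v, hv, fun x hx => ?_⟩
  obtain ⟨u, p, w⟩ := exists_witness_of_mem_eigenspace hv
  obtain ⟨u', p', w'⟩ := exists_witness_of_mem_eigenspace hx
  have ht : w.trace 1 ≠ 0 := fun h => hv0 (Subtype.ext (w.eq_zero_of_trace_one hz h))
  set c := w'.trace 1 / w.trace 1 with hc
  have w2 := w'.add_smul w (-c)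
  have e : z • (x : L2Graph) + 0 + -c • (z • (v : L2Graph) + 0)
      = z • ((x : L2Graph) + -c • (v : L2Graph)) + 0 := by
    rw [add_zero, add_zero, add_zero, smul_add, smul_comm]
  rw [e] at w2
  have h0 : w2.trace 1 = 0 := by
    change w'.trace 1 + -c * w.trace 1 = 0
    rw [hc]
    field_simp
    ring
  have h1 := w2.eq_zero_of_trace_one hz h0
  rw [Submodule.mem_span_singleton]
  refine ⟨c, Subtype.ext ?_⟩
  rw [neg_smul, ← sub_eq_add_neg, sub_eq_zero] at h1
  exact h1.symm

theorem essentialSpectrum_subset :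
    essentialSpectrum (hamiltonian A (impurityCoupling α γ)) ⊆ bandSet A α := by
  intro z hz
  by_contra h
  refine hz ⟨?_, ?_, ?_⟩
  · obtain ⟨v, -, hv⟩ := eigenspace_le_span (γ := γ) h
    exact Submodule.finiteDimensional_of_le hv
  · rcases range_shifted_eq (γ := γ) h with hr | ⟨ℓ, hr⟩
    · rw [hr]
      exact isClosed_univ
    · rw [hr]
      exact ℓ.isClosed_ker
  · rcases range_shifted_eq (γ := γ) h with hr | ⟨ℓ, hr⟩
    · rw [hr]
      infer_instance
    · rw [hr]
      exact LinearEquiv.finiteDimensional ℓ.toLinearMap.quotKerEquivRange.symm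

theorem eigenspace_ne_bot_iff (hz : z ∉ bandSet A α) :
    eigenspace (hamiltonian A (impurityCoupling α γ)) z ≠ ⊥ ↔
      γ / 2 * sinEnd z * greenDiag A α z = 1 := by
  have hS := sinEnd_ne_zero_of_notMem hz
  have e' : green A α z unitSeq 1 = greenDiag A α z := rfl
  constructor
  · intro hne
    obtain ⟨v, hv, hv0⟩ := Submodule.exists_mem_ne_zero_of_ne_bot hne
    obtain ⟨u, p, w⟩ := exists_witness_of_mem_eigenspace hv
    have ht : w.trace 1 ≠ 0 := fun h => hv0 (Subtype.ext (w.eq_zero_of_trace_one hz h))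
    have h1 := (jacobi_eq_iff hz _ _).1 (w.jacobi_trace hS)
    rw [map_zero, map_zero, zero_add] at h1
    have h2 := congrArg (fun y : Seq => y 1) h1
    simp only [Seq.smul_apply] at h2
    rw [e'] at h2
    refine mul_right_cancel₀ ht ?_
    linear_combination -h2
  · intro h
    have hJ : jacobi A α γ z (green A α z unitSeq) = source A z 0 := by
      rw [map_zero, jacobi_eq_iff hz, map_zero, zero_add, e', h, one_smul]
    obtain ⟨f, u, p, w, hw⟩ := exists_witness_of_jacobi hS hJ
    obtain ⟨x, hx1, hx2⟩ := w.exists_shifted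
    refine (Submodule.ne_bot_iff _).2 ⟨x, LinearMap.mem_ker.2 hx2, fun hx0 => ?_⟩
    have hf : f = 0 := by rw [← hx1, hx0]; rfl
    obtain ⟨K, -, hb⟩ := exists_trace_norm_bound
    have h1 := hb A _ f _ u p w
    have h2 : w.trace = 0 := by
      have h0 : K * (‖f‖ ^ 2 + ‖z • f + 0‖ ^ 2) = 0 := by simp [hf]
      rw [h0] at h1
      exact norm_eq_zero.1 (pow_eq_zero_iff two_ne_zero |>.1 (le_antisymm h1 (sq_nonneg _)))
    have h3 : greenDiag A α z = 0 := by
      rw [← e', ← hw, h2]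
      rfl
    rw [h3, mul_zero] at h
    exact zero_ne_one h

theorem finrank_eigenspace (hz : z ∉ bandSet A α)
    (hne : eigenspace (hamiltonian A (impurityCoupling α γ)) z ≠ ⊥) :
    Module.finrank ℂ (eigenspace (hamiltonian A (impurityCoupling α γ)) z) = 1 := by
  obtain ⟨v, hv, hle⟩ := eigenspace_le_span (γ := γ) hz
  have heq : eigenspace (hamiltonian A (impurityCoupling α γ)) z = Submodule.span ℂ {v} :=
    le_antisymm hle ((Submodule.span_singleton_le_iff_mem _ _).2 hv)
  rw [heq]
  refine finrank_span_singleton fun h0 => hne ?_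
  rw [heq, h0, Submodule.span_zero_singleton]

end Resolvent

section Weyl

/-! ### Weyl sequences on the bands -/

open Filter Topology

theorem ae_zero_of_edgeSq {f : L2Graph} {s : Fin 2} {j : ℤ} (h : edgeSq f s j = 0) :
    ∀ᵐ x, x ∈ edge j → (f s : ℝ → ℂ) x = 0 := by
  rw [← ae_restrict_iff' (measurableSet_edge j)]
  have := (integral_eq_zero_iff_of_nonneg (fun x => sq_nonneg ‖(f s : ℝ → ℂ) x‖)
    (integrable_sq (f s)).integrableOn).1 h
  filter_upwards [this] with x hx
  simpa using hx

theorem inner_eq_zero_of_edgeSq {f g : L2Graph}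
    (h : ∀ j, ∑ s, edgeSq f s j = 0 ∨ ∑ s, edgeSq g s j = 0) : inner ℂ f g = 0 := by
  have hz : ∀ f : L2Graph, ∀ j, ∑ s, edgeSq f s j = 0 → ∀ s, edgeSq f s j = 0 :=
    fun f j hj s => (Finset.sum_eq_zero_iff_of_nonneg fun s _ => edgeSq_nonneg f s j).1 hj s
      (Finset.mem_univ s)
  rw [PiLp.inner_apply]
  refine Finset.sum_eq_zero fun s _ => ?_
  rw [L2.inner_def]
  refine integral_eq_zero_of_ae ?_
  have hall : ∀ᵐ x, ∀ j, x ∈ edge j → (f s : ℝ → ℂ) x = 0 ∨ (g s : ℝ → ℂ) x = 0 := by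
    rw [ae_all_iff]
    intro j
    rcases h j with hj | hj
    · filter_upwards [ae_zero_of_edgeSq (hz f j hj s)] with x hx hxm using Or.inl (hx hxm)
    · filter_upwards [ae_zero_of_edgeSq (hz g j hj s)] with x hx hxm using Or.inr (hx hxm)
  filter_upwards [hall] with x hx
  obtain ⟨j, hj⟩ := exists_mem_edge x
  rcases hx j hj with h0 | h0 <;> simp [h0]

theorem inner_eq_zero_of_support {f : ℕ → L2Graph} {a b : ℕ → ℤ} (hab : ∀ m n, m < n → b m < a n)
    (hf : ∀ n j, j ∉ Icc (a n) (b n) → ∑ s, edgeSq (f n) s j = 0) (m n : ℕ) (hmn : m ≠ n) :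
    inner ℂ (f m) (f n) = 0 := by
  refine inner_eq_zero_of_edgeSq fun j => ?_
  by_cases hm : j ∈ Icc (a m) (b m)
  · refine Or.inr (hf n j fun hn => ?_)
    rcases lt_or_gt_of_ne hmn with hlt | hlt
    · exact absurd (hm.2.trans_lt (hab _ _ hlt)) (not_lt.2 hn.1)
    · exact absurd (hn.2.trans_lt (hab _ _ hlt)) (not_lt.2 hm.1)
  · exact Or.inl (hf m j hm)

/-- A Weyl sequence: orthogonal approximate eigenfunctions. -/
def HasWeylSequence (A : ℝ) (β : ℤ → ℝ) (z : ℂ) : Prop :=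
  ∃ f : ℕ → (hamiltonian A β).domain, (∀ᶠ n in atTop, (f n : L2Graph) ≠ 0) ∧
    (∀ m n, m ≠ n → inner ℂ (f m : L2Graph) (f n : L2Graph) = 0) ∧
    Tendsto (fun n => ‖shifted (hamiltonian A β) z (f n)‖ / ‖(f n : L2Graph)‖) atTop (𝓝 0)

variable {A α γ : ℝ} {z : ℂ}

theorem moment_zero (A : ℝ) (χ : ℝ → ℂ) (s : Fin 2) (j : ℤ) : moment A χ s j 0 = 0 := by
  have := moment_smul A χ s j 0 0
  simpa using this

theorem IsWitness.deriv_eq_zero {β : ℤ → ℝ} {g : L2Graph} {u p : Fin 2 → ℤ → ℝ → ℂ}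
    (w : IsWitness A β 0 g u p) (s : Fin 2) (j : ℤ) : p s j (vertex j) = 0 := by
  have hu : ∀ x ∈ edge j, u s j x = 0 := by
    have e : u s j =ᵐ[volume.restrict (edge j)] 0 :=
      (w.1 s j).symm.trans (ae_restrict_of_ae (Lp.coeFn_zero ℂ 2 volume))
    exact Measure.eqOn_Icc_of_ae_eq volume (vertex_lt j).ne e (w.2.1 s j).1 continuousOn_const
  exact Measure.eqOn_Icc_of_ae_eq volume (vertex_lt j).ne ((w.2.1 s j).ae_zero hu)
    (w.2.2.1 s j).1 continuousOn_const (left_mem_edge j)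

theorem edgeSq_zero (s : Fin 2) (j : ℤ) : edgeSq 0 s j = 0 := by
  have h1 := (hasSum_edgeSq 0).summable.le_tsum j
    fun i _ => Finset.sum_nonneg fun s _ => edgeSq_nonneg 0 s i
  rw [(hasSum_edgeSq 0).tsum_eq] at h1
  have h2 := edgeSq_le_sum 0 s j
  have h3 := edgeSq_nonneg 0 s j
  simp only [norm_zero, ne_eq, OfNat.ofNat_ne_zero, not_false_eq_true, zero_pow] at h1
  linarith

/-- The slopes of an eigenfunction living on the rings `N` and `N + 1`. -/
def flatSlope (A : ℝ) (z : ℂ) (N : ℤ) (s : Fin 2) (j : ℤ) : ℂ :=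
  if j = N then ![1, -1] s else if j = N + 1 then
    ![-(phase (-potential A 1) Real.pi * cosEnd z), phase (-potential A 0) Real.pi * cosEnd z] s
  else 0

theorem flatSlope_equations (hz : sinEnd z = 0) (β : ℤ → ℝ) (N : ℤ) :
    VertexEquations A β z 0 0 (flatSlope A z N) := by
  refine ⟨fun s j => by simp [hz, moment_zero], fun j => ?_⟩
  simp only [hz, moment_zero, Fin.sum_univ_two, Pi.zero_apply, mul_zero, neg_zero, zero_add,
    sub_zero, flatSlope]
  rcases eq_or_ne j N with rfl | h1
  · simp [show j - 1 ≠ j + 1 by omega]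
  rcases eq_or_ne j (N + 1) with rfl | h2
  · simp
    ring
  rcases eq_or_ne j (N + 1 + 1) with rfl | h3
  · simp [show N + 1 + 1 ≠ N by omega]
    ring
  · simp [h1, h2, show j - 1 ≠ N by omega, show j - 1 ≠ N + 1 by omega]

theorem hasWeylSequence_of_sinEnd (hz : sinEnd z = 0) (β : ℤ → ℝ) : HasWeylSequence A β z := by
  have hsum : ∀ (N : ℤ) (s : Fin 2), Summable fun j => ‖flatSlope A z N s j‖ ^ 2 := by
    intro N s
    refine summable_of_ne_finset_zero (s := {N, N + 1}) fun j hj => ?_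
    simp only [Finset.mem_insert, Finset.mem_singleton, not_or] at hj
    simp [flatSlope, hj.1, hj.2]
  have hex := fun n : ℕ => exists_witness (flatSlope_equations (A := A) hz β (2 * n))
    (by simp) (hsum (2 * n))
  choose f u p w hP hq using hex
  choose x hx1 hx2 using fun n => (w n).exists_shifted
  obtain ⟨K, -, hb⟩ := exists_edgeSq_bound z
  refine ⟨x, Eventually.of_forall fun n h0 => ?_, fun m n hmn => ?_, ?_⟩
  · have w' := w n
    rw [← hx1, h0] at w'
    have h1 := w'.deriv_eq_zero 0 (2 * n)
    rw [hq] at h1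
    simp [flatSlope] at h1
  · rw [hx1, hx1]
    refine inner_eq_zero_of_support (a := fun n => 2 * n) (b := fun n => 2 * n + 1)
      (fun m n hmn => by omega) (fun n j hj => ?_) m n hmn
    refine Finset.sum_eq_zero fun s _ => le_antisymm ?_ (edgeSq_nonneg _ _ _)
    refine (hb A β (f n) 0 (u n) (p n) (w n) s j).trans (le_of_eq ?_)
    have hj1 : j ≠ 2 * n := fun h => hj ⟨h.ge, by omega⟩
    have hj2 : j ≠ 2 * n + 1 := fun h => hj ⟨by omega, h.le⟩
    rw [hP, hq, edgeSq_zero]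
    simp [flatSlope, hj1, hj2]
  · simp [hx2]

theorem hasQuasiDeriv_of_hasDerivAt (a : ℝ) (j : ℤ) {w w' : ℝ → ℂ}
    (hw : ∀ x, HasDerivAt w (w' x) x) (hw' : Continuous w') :
    HasQuasiDeriv a j (fun x => phase (-a) (x - vertex j) * w (x - vertex j))
      (fun x => phase (-a) (x - vertex j) * w' (x - vertex j)) := by
  have hwc : Continuous w := continuous_iff_continuousAt.2 fun x => (hw x).continuousAt
  have hph := continuous_phase (-a)
  have h1 : Continuous fun x => phase (-a) (x - vertex j) * w (x - vertex j) := by fun_prop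
  have h2 : Continuous fun x => phase (-a) (x - vertex j) * w' (x - vertex j) := by fun_prop
  refine ⟨h1.continuousOn, h2.intervalIntegrable _ _, fun x _ => ?_⟩
  have h3 : Continuous fun x => phase (-a) (x - vertex j) * w' (x - vertex j)
      + Complex.I * a * (phase (-a) (x - vertex j) * w (x - vertex j)) := by fun_prop
  rw [intervalIntegral.integral_eq_sub_of_hasDerivAt
    (f := fun x => phase (-a) (x - vertex j) * w (x - vertex j)) (fun t _ => ?_)
    (h3.intervalIntegrable _ _)]
  · simp
  · refine ((hasDerivAt_phase (-a) (vertex j) t).mul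
      ((hw _).comp_sub_const t (vertex j))).congr_deriv ?_
    push_cast
    ring

/-- Every square summable right-hand side comes from a source supported on the same edges. -/
theorem exists_source_preimage (A : ℝ) (hz : sinEnd z ≠ 0) : ∃ K : ℝ, 0 < K ∧ ∀ b : ℤ → ℂ,
    (Summable fun j => ‖b j‖ ^ 2) → ∃ h : L2Graph, (∀ j, sourceTerm A z h j = b j) ∧
      ∀ j, ∑ s, edgeSq h s j ≤ K * ‖b j‖ ^ 2 := by
  set a := potential A 0 with ha
  set κ : ℂ := -2 / (sinEnd z * (Real.pi : ℂ) ^ 2) with hκ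
  have hb := continuous_bump
  have hb'' := continuous_bump''
  have hph := continuous_phase (-a)
  set ρ : ℝ → ℂ := fun x => -(bump'' x + z * bump x) with hρ
  have hρc : Continuous ρ := by fun_prop
  obtain ⟨M, hM⟩ := isCompact_Icc.exists_bound_of_continuousOn
    hρc.continuousOn (s := Icc 0 Real.pi)
  have hπ := Real.pi_pos
  have hM0 : 0 ≤ M := (norm_nonneg _).trans (hM 0 ⟨le_rfl, hπ.le⟩)
  have hmem : ∀ j, ∀ t ∈ edge j, t - vertex j ∈ Icc 0 Real.pi := by
    intro j t ht
    have h1 := ht.1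
    have h2 := ht.2
    have := vertex_succ_sub j
    constructor <;> linarith
  refine ⟨Real.pi * (‖κ‖ ^ 2 * M ^ 2) + 1, by positivity, fun b hbs => ?_⟩
  set v : ℤ → ℝ → ℂ := fun j x => phase (-a) (x - vertex j) * (b j * κ * ρ (x - vertex j)) with hv
  have hvb : ∀ j, ∀ x ∈ edge j, ‖v j x‖ ^ 2 ≤ ‖κ‖ ^ 2 * M ^ 2 * ‖b j‖ ^ 2 := by
    intro j x hx
    rw [hv]
    simp only [norm_mul, norm_phase, one_mul]
    have := hM _ (hmem j x hx)
    calc (‖b j‖ * ‖κ‖ * ‖ρ (x - vertex j)‖) ^ 2 ≤ (‖b j‖ * ‖κ‖ * M) ^ 2 := by gcongr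
      _ = _ := by ring
  obtain ⟨g, hg⟩ := exists_glue (u := v) (fun j => by
    simp only [hv]
    fun_prop) (hbs.mul_left _) hvb
  set h : L2Graph := WithLp.toLp 2 ![g, 0] with hh
  have h0 : h 0 = g := rfl
  have h1 : h 1 = 0 := rfl
  have hmom1 : ∀ χ j, moment A χ 1 j h = 0 := by
    intro χ j
    have : moment A χ 1 j h = moment A χ 1 j 0 := by
      unfold moment
      rw [h1]
      rfl
    rw [this, moment_zero]
  have hsol : ∀ j, HasQuasiDeriv a j
      (fun x => phase (-a) (x - vertex j) * (b j * κ * bump (x - vertex j)))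
      (fun x => phase (-a) (x - vertex j) * (b j * κ * bump' (x - vertex j))) := fun j =>
    hasQuasiDeriv_of_hasDerivAt a j (w := fun x => b j * κ * bump x)
      (w' := fun x => b j * κ * bump' x) (fun x => (hasDerivAt_bump x).const_mul _)
      (continuous_const.mul continuous_bump')
  have hsol' : ∀ j, HasQuasiDeriv a j
      (fun x => phase (-a) (x - vertex j) * (b j * κ * bump' (x - vertex j)))
      (fun x => -(z * (phase (-a) (x - vertex j) * (b j * κ * bump (x - vertex j)))
        + (h 0 : ℝ → ℂ) x)) := fun j => by
    refine (hasQuasiDeriv_of_hasDerivAt a j (w := fun x => b j * κ * bump' x)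
      (w' := fun x => b j * κ * bump'' x) (fun x => (hasDerivAt_bump' x).const_mul _)
      (continuous_const.mul continuous_bump'')).congr_edge ?_
    filter_upwards [hg j] with x hx
    rw [h0, hx]
    simp only [hv, hρ]
    ring
  have e0 : bump 0 = 0 := by simp [bump]
  have e1 : bump Real.pi = 0 := by simp [bump]
  have e2 : bump' Real.pi = 0 := by simp [bump']
  have e3 : bump' 0 = (Real.pi : ℂ) ^ 2 := by simp [bump']
  have hmS : ∀ j, moment A (ssol z) 0 j h = b j * κ * (Real.pi : ℂ) ^ 2 * sinEnd z := by
    intro j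
    have e := solution_value (hsol j) (hsol' j) (right_mem_edge j)
    simp only [vertex_succ_sub, sub_self, e0, e1, e3, phase_zero, mul_zero, zero_mul, zero_add,
      one_mul] at e
    have hm : moment A (ssol z) 0 j h = ∫ t in vertex j..vertex (j + 1),
      phase a (t - vertex j) * (h 0 : ℝ → ℂ) t * ssol z (vertex (j + 1) - t) := rfl
    rw [← hm] at e
    rw [sinEnd]
    linear_combination e
  have hmC : ∀ j, moment A (csol z) 0 j h = b j * κ * (Real.pi : ℂ) ^ 2 * cosEnd z := by
    intro j
    have e := solution_deriv (hsol j) (hsol' j) (right_mem_edge j)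
    simp only [vertex_succ_sub, sub_self, e0, e2, e3, phase_zero, mul_zero, zero_mul, zero_add,
      one_mul, neg_zero] at e
    have hm : moment A (csol z) 0 j h = ∫ t in vertex j..vertex (j + 1),
      phase a (t - vertex j) * (h 0 : ℝ → ℂ) t * csol z (vertex (j + 1) - t) := rfl
    rw [← hm] at e
    rw [cosEnd]
    linear_combination e
  refine ⟨h, fun j => ?_, fun j => ?_⟩
  · rw [sourceTerm, Fin.sum_univ_two, hmom1, hmom1, hmom1, hmS, hmS, hmC]
    have hκ' : κ * (Real.pi : ℂ) ^ 2 * sinEnd z = -2 := by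
      have : (Real.pi : ℂ) ≠ 0 := by exact_mod_cast hπ.ne'
      rw [hκ]
      field_simp
    linear_combination -(1 / 2) * b j * hκ'
  · have k0 := edgeSq_le_of_bound (f := h) (s := 0) (hg j) (hvb j)
    have k1 : edgeSq h 1 j = 0 := by
      have : edgeSq h 1 j = edgeSq 0 1 j := by
        unfold edgeSq
        rw [h1]
        rfl
      rw [this, edgeSq_zero]
    rw [Fin.sum_univ_two, k1, add_zero]
    refine k0.trans ?_
    nlinarith [sq_nonneg ‖b j‖]

theorem exists_multiplier {A t : ℝ} (ht : |t| ≤ |Real.cos (A * Real.pi)|) :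
    ∃ l : ℂ, ‖l‖ = 1 ∧ (Real.cos (A * Real.pi) : ℂ) * (l + l⁻¹) = 2 * t := by
  set c := Real.cos (A * Real.pi) with hc
  by_cases h0 : c = 0
  · refine ⟨1, norm_one, ?_⟩
    rw [h0, abs_zero] at ht
    rw [h0, abs_nonpos_iff.1 ht]
    simp
  · have hx : |t / c| ≤ 1 := by
      rw [abs_div]
      exact div_le_one_of_le₀ ht (abs_nonneg _)
    refine ⟨Complex.exp (Real.arccos (t / c) * Complex.I), Complex.norm_exp_ofReal_mul_I _, ?_⟩
    rw [← Complex.exp_neg, ← neg_mul, ← Complex.two_cos, ← Complex.ofReal_cos,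
      Real.cos_arccos (abs_le.1 hx).1 (abs_le.1 hx).2]
    have h0' : (c : ℂ) ≠ 0 := by exact_mod_cast h0
    push_cast
    field_simp

/-- The plane wave with multiplier `l` cut off to `[N, N + L)`. -/
def cutWave (l : ℂ) (N L : ℤ) (j : ℤ) : ℂ := if N ≤ j ∧ j < N + L then l ^ j else 0

theorem norm_cutWave_le {l : ℂ} (hl : ‖l‖ = 1) (N L j : ℤ) : ‖cutWave l N L j‖ ≤ 1 := by
  unfold cutWave
  split_ifs
  · rw [norm_zpow, hl, one_zpow]
  · simp

theorem hasSum_cutWave {l : ℂ} (hl : ‖l‖ = 1) (N : ℤ) (L : ℕ) :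
    HasSum (fun j => ‖cutWave l N L j‖ ^ 2) L := by
  have h := hasSum_sum_of_ne_finset_zero (f := fun j => ‖cutWave l N L j‖ ^ 2)
    (s := Finset.Ico N (N + L)) (L := .unconditional ℤ) (fun j hj => by
      rw [Finset.mem_Ico] at hj
      simp [cutWave, hj])
  convert h using 1
  rw [Finset.sum_congr rfl (g := fun _ => (1 : ℝ))]
  · simp
  · intro j hj
    rw [Finset.mem_Ico] at hj
    rw [cutWave, if_pos hj, norm_zpow, hl, one_zpow, one_pow]

theorem hasWeylSequence_of_discr (hS : sinEnd z ≠ 0) {t : ℝ}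
    (ht : |t| ≤ |Real.cos (A * Real.pi)|) (hd : discr α z = t) :
    HasWeylSequence A (impurityCoupling α γ) z := by
  obtain ⟨l, hl, hlc⟩ := exists_multiplier ht
  have hl0 : l ≠ 0 := norm_ne_zero_iff.1 (by rw [hl]; exact one_ne_zero)
  set c := Real.cos (A * Real.pi) with hc
  obtain ⟨K₁, hK₁, hpre⟩ := exists_source_preimage A hS
  obtain ⟨K₂, hK₂, hloc⟩ := exists_local_bound hS
  obtain ⟨K₃, hK₃, htr⟩ := exists_trace_norm_bound
  set N : ℕ → ℤ := fun n => (n + 2) ^ 2 with hN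
  set L : ℕ → ℕ := fun n => n + 1 with hL
  set x : ℕ → Seq := fun n => Seq.mk (cutWave l (N n) (L n)) (hasSum_cutWave hl _ _).summable
    with hx
  have hxa : ∀ n j, x n j = cutWave l (N n) (L n) j := fun n j => rfl
  have hN4 : ∀ n, 4 ≤ N n := fun n => by
    have : (0 : ℤ) ≤ n := Int.natCast_nonneg n
    simp only [hN]
    nlinarith
  set b : ℕ → Seq := fun n => jacobi A α γ z (x n) with hb
  have hba : ∀ n j, b n j = c * (x n (j + 1) + x n (j - 1)) - 2 * t * x n j := by
    intro n j
    simp only [hb]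
    rw [jacobi_apply, ← hc]
    by_cases h1 : j = 1
    · have e : x n j = 0 := by
        have := hN4 n
        rw [hxa, cutWave, if_neg (by omega)]
      rw [e, mul_zero, mul_zero]
    · rw [impurityCoupling, if_neg h1, ← hd, discr]
      ring
  have hb0 : ∀ n j, j ∉ ({N n - 1, N n, N n + L n - 1, N n + L n} : Finset ℤ) → b n j = 0 := by
    intro n j hj
    simp only [Finset.mem_insert, Finset.mem_singleton, not_or] at hj
    rw [hba, hxa, hxa, hxa]
    unfold cutWave
    by_cases hin : N n ≤ j ∧ j < N n + L n
    · rw [if_pos (by omega), if_pos (by omega), if_pos hin, zpow_add_one₀ hl0, zpow_sub_one₀ hl0]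
      linear_combination l ^ j * hlc
    · rw [if_neg (by omega), if_neg (by omega), if_neg hin]
      simp
  set B : ℝ := |c| * 2 + 2 * |t| with hB
  have hbB : ∀ n j, ‖b n j‖ ≤ B := by
    intro n j
    rw [hba, hxa, hxa, hxa]
    have w := norm_cutWave_le hl (N n) (L n)
    refine (norm_sub_le _ _).trans ?_
    rw [norm_mul, norm_mul, norm_mul, Complex.norm_real, Complex.norm_real, Complex.norm_two,
      Real.norm_eq_abs, Real.norm_eq_abs]
    refine add_le_add (mul_le_mul_of_nonneg_left ?_ (abs_nonneg c)) ?_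
    · refine (norm_add_le _ _).trans ?_
      linarith [w (j + 1), w (j - 1)]
    · exact mul_le_of_le_one_right (by positivity) (w j)
  have hbn : ∀ n, ‖b n‖ ^ 2 ≤ 4 * B ^ 2 := by
    intro n
    have h1 := hasSum_sum_of_ne_finset_zero (f := fun j => ‖b n j‖ ^ 2)
      (s := {N n - 1, N n, N n + L n - 1, N n + L n}) (L := .unconditional ℤ) (fun j hj => by
        rw [hb0 n j hj]
        simp)
    rw [(Seq.hasSum (b n)).unique h1]
    have h2 := Finset.sum_le_card_nsmul {N n - 1, N n, N n + L n - 1, N n + L n}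
      (fun j => ‖b n j‖ ^ 2) (B ^ 2) (fun j _ => pow_le_pow_left₀ (norm_nonneg _) (hbB n j) 2)
    refine h2.trans ?_
    rw [nsmul_eq_mul]
    refine mul_le_mul_of_nonneg_right ?_ (sq_nonneg B)
    exact_mod_cast Finset.card_le_four
  choose h hh1 hh2 using fun n => hpre (b n) (Seq.hasSum (b n)).summable
  have hhn : ∀ n, ‖h n‖ ^ 2 ≤ K₁ * (4 * B ^ 2) := by
    intro n
    refine (hasSum_le (hh2 n) (hasSum_edgeSq (h n)) ((Seq.hasSum (b n)).mul_left K₁)).trans ?_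
    exact mul_le_mul_of_nonneg_left (hbn n) hK₁.le
  have hJ : ∀ n, jacobi A α γ z (x n) = source A z (h n) := fun n =>
    Seq.ext fun j => by rw [source_apply, hh1]
  choose f u p w hw using fun n => exists_witness_of_jacobi hS (hJ n)
  choose y hy1 hy2 using fun n => (w n).exists_shifted
  set Hc : ℝ := K₁ * (4 * B ^ 2) with hHc
  have hHc0 : 0 ≤ Hc := by positivity
  have hgrow : ∀ n : ℕ, (n : ℝ) ≤ K₃ * (1 + 2 * ‖z‖ ^ 2) * ‖f n‖ ^ 2 + 2 * K₃ * Hc := by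
    intro n
    have h1 := htr A _ _ _ _ _ (w n)
    rw [hw n] at h1
    have h2 : ‖x n‖ ^ 2 = (L n : ℝ) := (Seq.hasSum (x n)).unique (hasSum_cutWave hl _ _)
    have h3 : ‖z • f n + h n‖ ^ 2 ≤ 2 * ‖z‖ ^ 2 * ‖f n‖ ^ 2 + 2 * Hc := by
      have h4 : ‖z • f n + h n‖ ≤ ‖z‖ * ‖f n‖ + ‖h n‖ := by
        rw [← norm_smul]
        exact norm_add_le _ _
      have h5 : ‖z • f n + h n‖ ^ 2 ≤ (‖z‖ * ‖f n‖ + ‖h n‖) ^ 2 := by gcongr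
      nlinarith [sq_nonneg (‖z‖ * ‖f n‖ - ‖h n‖), hhn n]
    rw [h2] at h1
    have h6 : (n : ℝ) ≤ L n := by
      simp only [hL]
      push_cast
      linarith
    nlinarith
  have hK : 0 < K₃ * (1 + 2 * ‖z‖ ^ 2) := by positivity
  have hf2 : Tendsto (fun n => ‖f n‖ ^ 2) atTop atTop := by
    have h1 : Tendsto (fun n : ℕ => ((n : ℝ) - 2 * K₃ * Hc) / (K₃ * (1 + 2 * ‖z‖ ^ 2)))
        atTop atTop :=
      (tendsto_atTop_add_const_right _ (-(2 * K₃ * Hc)) tendsto_natCast_atTop_atTop).atTop_div_const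
        hK
    refine tendsto_atTop_mono (fun n => ?_) h1
    rw [div_le_iff₀ hK]
    linarith [hgrow n]
  have hf1 : Tendsto (fun n => ‖f n‖) atTop atTop := by
    have := Real.tendsto_sqrt_atTop.comp hf2
    refine this.congr fun n => ?_
    exact Real.sqrt_sq (norm_nonneg _)
  refine ⟨y, ?_, fun m n hmn => ?_, ?_⟩
  · filter_upwards [hf1.eventually_gt_atTop 0] with n hn
    rw [hy1]
    exact norm_pos_iff.1 hn
  · rw [hy1, hy1]
    refine inner_eq_zero_of_support (a := fun n => N n - 1) (b := fun n => N n + L n)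
      (fun m n hmn => ?_) (fun n j hj => ?_) m n hmn
    · simp only [hN, hL]
      have : (m : ℤ) + 1 ≤ n := by exact_mod_cast hmn
      push_cast
      nlinarith
    · refine le_antisymm ?_ (Finset.sum_nonneg fun s _ => edgeSq_nonneg _ _ _)
      refine (hloc A _ _ _ _ _ (w n) j).trans ?_
      have hj' : ¬ (N n - 1 ≤ j ∧ j ≤ N n + L n) := hj
      have e1 : x n j = 0 := by
        rw [hxa, cutWave, if_neg (by omega)]
      have e2 : x n (j + 1) = 0 := by
        rw [hxa, cutWave, if_neg (by omega)]
      have e3 : b n j = 0 := hb0 n j (by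
        simp only [Finset.mem_insert, Finset.mem_singleton, not_or]
        omega)
      have e4 := hh2 n j
      rw [e3] at e4
      rw [hw n, e1, e2]
      simp only [norm_zero, ne_eq, OfNat.ofNat_ne_zero, not_false_eq_true, zero_pow, mul_zero,
        add_zero, zero_add] at e4 ⊢
      exact mul_nonpos_of_nonneg_of_nonpos hK₂.le e4
  · refine squeeze_zero (fun n => by positivity) (fun n => ?_)
      (hf1.const_div_atTop (Real.sqrt Hc))
    rw [hy1, hy2]
    refine div_le_div_of_nonneg_right ?_ (norm_nonneg _)
    exact Real.le_sqrt_of_sq_le (hhn n)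

theorem hasWeylSequence_of_mem (hz : z ∈ bandSet A α) :
    HasWeylSequence A (impurityCoupling α γ) z := by
  by_cases hS : sinEnd z = 0
  · exact hasWeylSequence_of_sinEnd hS _
  · rcases hz with h | ⟨t, ht, hd⟩
    · exact absurd h hS
    · exact hasWeylSequence_of_discr hS ht hd

theorem spectrumSet_periodic (A α : ℝ) :
    spectrumSet (hamiltonian A (periodicCoupling α)) = bandSet A α := by
  refine subset_antisymm spectrumSet_subset fun z hz => ?_
  have h := hasWeylSequence_of_mem (γ := 0) hz
  rw [impurityCoupling_zero] at h
  obtain ⟨f, h1, -, h3⟩ := h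
  exact mem_spectrumSet_of_approx h1 h3

end Weyl

/-! ### The discriminant on the real line -/

/-- The value of `cosEnd` at a real energy. -/
def cosR (E : ℝ) : ℝ :=
  if 0 ≤ E then Real.cos (Real.pi * √E) else Real.cosh (Real.pi * √(-E))

/-- The value of `sinEnd` at a real energy. -/
def sinR (E : ℝ) : ℝ :=
  if 0 ≤ E then Real.pi * dslope Real.sin 0 (Real.pi * √E)
  else Real.pi * dslope Real.sinh 0 (Real.pi * √(-E))

theorem continuous_dslope_zero {f : ℝ → ℝ} (hf : Differentiable ℝ f) : Continuous (dslope f 0) := by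
  rw [continuous_iff_continuousAt]
  intro x
  rcases eq_or_ne x 0 with rfl | h
  · exact continuousAt_dslope_same.2 hf.differentiableAt
  · exact (continuousAt_dslope_of_ne h).2 hf.continuous.continuousAt

theorem continuous_cosR : Continuous cosR := by
  unfold cosR
  refine Continuous.if_le (by fun_prop) (by fun_prop) continuous_const continuous_id ?_
  rintro E rfl
  simp

theorem continuous_sinR : Continuous sinR := by
  have h1 := continuous_dslope_zero Real.differentiable_sin
  have h2 := continuous_dslope_zero Real.differentiable_sinh
  unfold sinR
  refine Continuous.if_le (by fun_prop) (by fun_prop) continuous_const continuous_id ?_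
  rintro E rfl
  simp [dslope_same]

theorem cosR_of_nonneg {E : ℝ} (h : 0 ≤ E) : cosR E = Real.cos (Real.pi * √E) := if_pos h

theorem cosR_of_neg {E : ℝ} (h : E < 0) : cosR E = Real.cosh (Real.pi * √(-E)) :=
  if_neg (not_le.2 h)

theorem sqrt_mul_sinR {E : ℝ} (h : 0 ≤ E) : √E * sinR E = Real.sin (Real.pi * √E) := by
  have := sub_smul_dslope Real.sin 0 (Real.pi * √E)
  rw [sub_zero, Real.sin_zero, sub_zero, smul_eq_mul] at this
  rw [sinR, if_pos h, ← this]
  ring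

theorem sqrt_neg_mul_sinR {E : ℝ} (h : E < 0) : √(-E) * sinR E = Real.sinh (Real.pi * √(-E)) := by
  have := sub_smul_dslope Real.sinh 0 (Real.pi * √(-E))
  rw [sub_zero, Real.sinh_zero, sub_zero, smul_eq_mul] at this
  rw [sinR, if_neg (not_le.2 h), ← this]
  ring

theorem sinR_zero : sinR 0 = Real.pi := by simp [sinR, dslope_same]

theorem cosEnd_ofReal (E : ℝ) : cosEnd (E : ℂ) = cosR E := by
  rcases le_or_gt 0 E with h | h
  · have hk : ((√E : ℝ) : ℂ) ^ 2 = E := by exact_mod_cast Real.sq_sqrt h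
    rw [cosEnd, csol_eq hk, cosR_of_nonneg h, mul_comm]
    push_cast
    rfl
  · have hk : (((√(-E) : ℝ) : ℂ) * Complex.I) ^ 2 = E := by
      rw [mul_pow, Complex.I_sq]
      have : ((√(-E) : ℝ) : ℂ) ^ 2 = ((-E : ℝ) : ℂ) := by exact_mod_cast Real.sq_sqrt (by linarith)
      rw [this]
      push_cast
      ring
    rw [cosEnd, csol_eq hk, cosR_of_neg h, mul_right_comm, Complex.cos_mul_I, mul_comm]
    push_cast
    rfl

theorem sinEnd_ofReal (E : ℝ) : sinEnd (E : ℂ) = sinR E := by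
  rcases lt_trichotomy 0 E with h | h | h
  · have hk : ((√E : ℝ) : ℂ) ^ 2 = E := by exact_mod_cast Real.sq_sqrt h.le
    have hk0 : ((√E : ℝ) : ℂ) ≠ 0 := by exact_mod_cast (Real.sqrt_pos.2 h).ne'
    refine mul_left_cancel₀ hk0 ?_
    rw [sinEnd, ssol_eq hk]
    have := congrArg (fun x : ℝ => (x : ℂ)) (sqrt_mul_sinR h.le)
    simp only [Complex.ofReal_mul, Complex.ofReal_sin] at this
    rw [this, mul_comm]
  · rw [← h, sinR_zero, sinEnd, ssol, if_pos]
    have := root_sq ((0 : ℝ) : ℂ)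
    rw [Complex.ofReal_zero] at this ⊢
    exact pow_eq_zero_iff two_ne_zero |>.1 this
  · have hk : (((√(-E) : ℝ) : ℂ) * Complex.I) ^ 2 = E := by
      rw [mul_pow, Complex.I_sq]
      have : ((√(-E) : ℝ) : ℂ) ^ 2 = ((-E : ℝ) : ℂ) := by exact_mod_cast Real.sq_sqrt (by linarith)
      rw [this]
      push_cast
      ring
    have hk0 : ((√(-E) : ℝ) : ℂ) * Complex.I ≠ 0 :=
      mul_ne_zero (by exact_mod_cast (Real.sqrt_pos.2 (by linarith)).ne') Complex.I_ne_zero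
    refine mul_left_cancel₀ hk0 ?_
    rw [sinEnd, ssol_eq hk]
    have := congrArg (fun x : ℝ => (x : ℂ)) (sqrt_neg_mul_sinR h)
    simp only [Complex.ofReal_mul, Complex.ofReal_sinh] at this
    have e : ((√(-E) : ℝ) : ℂ) * Complex.I * Real.pi
        = (Real.pi * ((√(-E) : ℝ) : ℂ)) * Complex.I := by ring
    rw [e, Complex.sin_mul_I, ← this]
    ring

/-- The discriminant at a real energy. -/
def discrR (α E : ℝ) : ℝ := cosR E + α / 4 * sinR E

theorem discr_ofReal (α E : ℝ) : discr α (E : ℂ) = discrR α E := by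
  rw [discr, cosEnd_ofReal, sinEnd_ofReal, discrR]
  push_cast
  ring

theorem continuous_discrR (α : ℝ) : Continuous (discrR α) :=
  continuous_cosR.add (continuous_const.mul continuous_sinR)

theorem ofReal_mem_bandSet {A α E : ℝ} :
    (E : ℂ) ∈ bandSet A α ↔ sinR E = 0 ∨ |discrR α E| ≤ |Real.cos (A * Real.pi)| := by
  rw [bandSet, mem_ofPred_eq, sinEnd_ofReal, discr_ofReal, Complex.ofReal_eq_zero]
  refine or_congr Iff.rfl ⟨?_, fun h => ⟨_, h, rfl⟩⟩
  rintro ⟨t, ht, he⟩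
  rwa [Complex.ofReal_injective he]

/-- The energies between consecutive Dirichlet eigenvalues of an edge. -/
def window (m : ℕ) : Set ℝ := {E | (m = 0 ∨ (m : ℝ) ^ 2 < E) ∧ E < ((m : ℝ) + 1) ^ 2}

theorem ordConnected_window (m : ℕ) : (window m).OrdConnected :=
  ⟨fun _ hx _ hy _ hz => ⟨hx.1.imp id fun h => h.trans_le hz.1, hz.2.trans_lt hy.2⟩⟩

theorem sinR_sq (m : ℕ) : sinR (((m : ℝ) + 1) ^ 2) = 0 := by
  have hm : (0 : ℝ) < (m : ℝ) + 1 := by positivity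
  have h := sqrt_mul_sinR (E := ((m : ℝ) + 1) ^ 2) (by positivity)
  rw [Real.sqrt_sq hm.le] at h
  have h2 : Real.sin (Real.pi * ((m : ℝ) + 1)) = 0 := by
    rw [mul_comm]
    exact_mod_cast Real.sin_nat_mul_pi (m + 1)
  rw [h2] at h
  exact (mul_eq_zero.1 h).resolve_left hm.ne'

theorem cosR_sq (m : ℕ) : cosR ((m : ℝ) ^ 2) = (-1) ^ m := by
  rw [cosR_of_nonneg (by positivity), Real.sqrt_sq (by positivity), mul_comm]
  exact Real.cos_nat_mul_pi m

theorem sinR_pos_of_nonpos {E : ℝ} (h : E ≤ 0) : 0 < sinR E := by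
  rcases h.eq_or_lt with rfl | h
  · rw [sinR_zero]
    exact Real.pi_pos
  · have hk : 0 < √(-E) := Real.sqrt_pos.2 (by linarith)
    have h1 := sqrt_neg_mul_sinR h
    have h2 : 0 < Real.sinh (Real.pi * √(-E)) := Real.sinh_pos_iff.2 (by positivity)
    rw [← h1] at h2
    exact pos_of_mul_pos_right h2 hk.le

theorem sinR_sign {m : ℕ} {E : ℝ} (hE : E ∈ window m) : 0 < (-1) ^ m * sinR E := by
  rcases le_or_gt E 0 with h | h
  · rcases hE.1 with rfl | h1
    · simpa using sinR_pos_of_nonpos h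
    · exact absurd h (not_le.2 ((sq_nonneg _).trans_lt h1))
  · have hπ := Real.pi_pos
    have hk : 0 < √E := Real.sqrt_pos.2 h
    have h1 : (m : ℝ) < √E := by
      rcases hE.1 with rfl | h1
      · simpa using hk
      · exact Real.lt_sqrt_of_sq_lt h1
    have h2 : √E < m + 1 := by
      rw [Real.sqrt_lt' (by positivity)]
      exact hE.2
    have h3 : 0 < Real.sin (Real.pi * √E - m * Real.pi) :=
      Real.sin_pos_of_pos_of_lt_pi (by nlinarith) (by nlinarith)
    rw [Real.sin_sub_nat_mul_pi, ← sqrt_mul_sinR h.le] at h3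
    have : (-1 : ℝ) ^ m * (√E * sinR E) = √E * ((-1) ^ m * sinR E) := by ring
    rw [this] at h3
    exact pos_of_mul_pos_right h3 hk.le

theorem sinR_ne_zero {m : ℕ} {E : ℝ} (hE : E ∈ window m) : sinR E ≠ 0 := fun h => by
  have := sinR_sign hE
  rw [h, mul_zero] at this
  exact lt_irrefl _ this

theorem exists_window (E : ℝ) : (∃ m, E ∈ window m) ∨ ∃ m : ℕ, E = ((m : ℝ) + 1) ^ 2 := by
  rcases lt_or_ge E 1 with h | h
  · exact Or.inl ⟨0, Or.inl rfl, by simpa using h⟩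
  · have hE : 0 ≤ E := by linarith
    have h1 : 1 ≤ √E := by rwa [Real.one_le_sqrt]
    have h2 : 1 ≤ ⌊√E⌋₊ := Nat.le_floor (by simpa using h1)
    have h3 := Nat.floor_le (Real.sqrt_nonneg E)
    have h4 := Nat.lt_floor_add_one √E
    have h5 : E < ((⌊√E⌋₊ : ℝ) + 1) ^ 2 := by
      rw [← Real.sqrt_lt' (by positivity)]
      exact h4
    rcases h3.eq_or_lt with h6 | h6
    · right
      refine ⟨⌊√E⌋₊ - 1, ?_⟩
      rw [Nat.cast_sub h2, Nat.cast_one, sub_add_cancel, h6, Real.sq_sqrt hE]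
    · left
      exact ⟨⌊√E⌋₊, Or.inr (by rwa [Real.lt_sqrt (by positivity)] at h6), h5⟩

theorem window_lt {m n : ℕ} (h : m < n) {y : ℝ} (hy : y ∈ window n) :
    ((m : ℝ) + 1) ^ 2 < y := by
  rcases hy.1 with h0 | h1
  · omega
  · refine lt_of_le_of_lt ?_ h1
    have : (m : ℝ) + 1 ≤ n := by exact_mod_cast h
    gcongr

/-- Far to the left the cosine-like solution dominates. -/
theorem exists_dominated (B : ℝ) : ∃ E₀ < 0, ∀ E ≤ E₀, B * sinR E + B ≤ cosR E := by
  refine ⟨-(2 * |B| + 1) ^ 2, by nlinarith [abs_nonneg B, sq_nonneg (2 * |B|)], fun E hE => ?_⟩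
  have hE0 : E < 0 := by nlinarith [abs_nonneg B, sq_nonneg (2 * |B|)]
  have hk : 2 * |B| + 1 ≤ √(-E) := Real.le_sqrt_of_sq_le (by linarith)
  have hk0 : 0 < √(-E) := by linarith [abs_nonneg B]
  have h1 := sqrt_neg_mul_sinR hE0
  have hS := sinR_pos_of_nonpos hE0.le
  have h2 : √(-E) * sinR E ≤ cosR E := by
    rw [h1, cosR_of_neg hE0]
    exact (Real.sinh_lt_cosh _).le
  have h3 : Real.pi * √(-E) ≤ √(-E) * sinR E := by
    rw [h1]
    exact Real.self_le_sinh_iff.2 (by positivity)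
  have h4 : 1 ≤ sinR E := by
    have : Real.pi ≤ sinR E := by nlinarith
    linarith [Real.pi_gt_three]
  have h5 : B ≤ |B| := le_abs_self B
  nlinarith [abs_nonneg B]

theorem deriv_sign_trig {θ σ : ℝ} (hθ : 0 < θ) (hs : Real.sin θ ≠ 0) (h1 : -1 < σ) (h2 : σ < 1) :
    (Real.cos θ + σ) * Real.sin θ - θ * (1 + σ * Real.cos θ) < 0 := by
  have hsq := Real.sin_sq_add_cos_sq θ
  have hs2 : 0 < Real.sin θ ^ 2 := by positivity
  have c1 : Real.cos θ < 1 := by nlinarith [Real.cos_le_one θ, Real.neg_one_le_cos θ]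
  have c2 : -1 < Real.cos θ := by nlinarith [Real.cos_le_one θ, Real.neg_one_le_cos θ]
  have t1 : Real.sin θ < θ := Real.sin_lt hθ
  have t2 : -θ < Real.sin θ := by
    rcases le_or_gt θ 1 with h | h
    · linarith [Real.sin_pos_of_pos_of_le_one hθ h]
    · linarith [Real.neg_one_le_sin θ]
  have p1 : 0 < (1 + σ) * (1 + Real.cos θ) * (θ - Real.sin θ) := by
    apply mul_pos (mul_pos _ _) <;> linarith
  have p2 : 0 < (1 - σ) * (1 - Real.cos θ) * (Real.sin θ + θ) := by
    apply mul_pos (mul_pos _ _) <;> linarith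
  linarith

theorem deriv_sign_hyp {θ σ : ℝ} (hθ : 0 < θ) (h1 : -1 < σ) (h2 : σ < 1) :
    0 < (Real.cosh θ + σ) * Real.sinh θ - θ * (1 + σ * Real.cosh θ) := by
  have c1 : 1 < Real.cosh θ := Real.one_lt_cosh.2 hθ.ne'
  have t1 : θ < Real.sinh θ := Real.self_lt_sinh_iff.2 hθ
  have p1 : 0 < (1 + σ) * (1 + Real.cosh θ) * (Real.sinh θ - θ) := by
    apply mul_pos (mul_pos _ _) <;> linarith
  have p2 : 0 < (1 - σ) * (Real.cosh θ - 1) * (Real.sinh θ + θ) := by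
    apply mul_pos (mul_pos _ _) <;> linarith
  linarith

/-- The Weyl type function whose zeros are the band edges. -/
def edgeFun (α σ E : ℝ) : ℝ := (cosR E + σ) / sinR E + α / 4

theorem sinR_of_pos {E : ℝ} (h : 0 < E) : sinR E = Real.sin (Real.pi * √E) / √E := by
  rw [← sqrt_mul_sinR h.le, mul_div_cancel_left₀ _ (Real.sqrt_pos.2 h).ne']

theorem sinR_of_neg {E : ℝ} (h : E < 0) : sinR E = Real.sinh (Real.pi * √(-E)) / √(-E) := by
  rw [← sqrt_neg_mul_sinR h, mul_div_cancel_left₀ _ (Real.sqrt_pos.2 (by linarith)).ne']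

theorem deriv_edgeFun_neg_of_pos {α σ E : ℝ} (h1 : -1 < σ) (h2 : σ < 1) (hE : 0 < E)
    (hS : sinR E ≠ 0) : deriv (edgeFun α σ) E < 0 := by
  have hk : 0 < √E := Real.sqrt_pos.2 hE
  have hπ := Real.pi_pos
  have hs : Real.sin (Real.pi * √E) ≠ 0 := by
    rw [← sqrt_mul_sinR hE.le]
    exact mul_ne_zero hk.ne' hS
  have hev : edgeFun α σ =ᶠ[nhds E] fun x =>
      (Real.cos (Real.pi * √x) + σ) / (Real.sin (Real.pi * √x) / √x) + α / 4 := by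
    filter_upwards [lt_mem_nhds hE] with x hx
    rw [edgeFun, cosR_of_nonneg hx.le, sinR_of_pos hx]
  have d0 : HasDerivAt (fun x => √x) (1 / (2 * √E)) E := Real.hasDerivAt_sqrt hE.ne'
  have d1 := d0.const_mul Real.pi
  have d2 := ((d1.cos.add_const σ).div (d1.sin.div d0 hk.ne') (div_ne_zero hs hk.ne')).add_const
    (α / 4)
  rw [hev.deriv_eq]
  have key := deriv_sign_trig (θ := Real.pi * √E) (by positivity) hs h1 h2
  refine lt_of_eq_of_lt d2.deriv ?_
  simp only [Pi.div_apply]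
  have hsq := Real.sin_sq_add_cos_sq (Real.pi * √E)
  set s := Real.sin (Real.pi * √E) with hsdef
  set c := Real.cos (Real.pi * √E) with hcdef
  set k := √E with hkdef
  have e : (-s * (Real.pi * (1 / (2 * k))) * (s / k) - (c + σ) *
      ((c * (Real.pi * (1 / (2 * k))) * k - s * (1 / (2 * k))) / k ^ 2)) / (s / k) ^ 2
      = ((c + σ) * s - Real.pi * k * (s ^ 2 + c ^ 2 + σ * c)) / (2 * k * s ^ 2) := by
    field_simp
    ring
  rw [e, hsq]
  exact div_neg_of_neg_of_pos key (by positivity)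

theorem deriv_edgeFun_neg_of_neg {α σ E : ℝ} (h1 : -1 < σ) (h2 : σ < 1) (hE : E < 0) :
    deriv (edgeFun α σ) E < 0 := by
  have hk : 0 < √(-E) := Real.sqrt_pos.2 (by linarith)
  have hπ := Real.pi_pos
  have hs : 0 < Real.sinh (Real.pi * √(-E)) := Real.sinh_pos_iff.2 (by positivity)
  have hev : edgeFun α σ =ᶠ[nhds E] fun x =>
      (Real.cosh (Real.pi * √(-x)) + σ) / (Real.sinh (Real.pi * √(-x)) / √(-x)) + α / 4 := by
    filter_upwards [gt_mem_nhds hE] with x hx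
    rw [edgeFun, cosR_of_neg hx, sinR_of_neg hx]
  have d0 : HasDerivAt (fun x => √(-x)) (-1 / (2 * √(-E))) E :=
    (hasDerivAt_neg E).sqrt (by linarith)
  have d1 := d0.const_mul Real.pi
  have d2 := ((d1.cosh.add_const σ).div (d1.sinh.div d0 hk.ne') (div_ne_zero hs.ne' hk.ne')).add_const
    (α / 4)
  rw [hev.deriv_eq]
  have key := deriv_sign_hyp (θ := Real.pi * √(-E)) (by positivity) h1 h2
  refine lt_of_eq_of_lt d2.deriv ?_
  simp only [Pi.div_apply]
  have hsq := Real.cosh_sq (Real.pi * √(-E))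
  set s := Real.sinh (Real.pi * √(-E)) with hsdef
  set c := Real.cosh (Real.pi * √(-E)) with hcdef
  set k := √(-E) with hkdef
  have e : (s * (Real.pi * (-1 / (2 * k))) * (s / k) - (c + σ) *
      ((c * (Real.pi * (-1 / (2 * k))) * k - s * (-1 / (2 * k))) / k ^ 2)) / (s / k) ^ 2
      = -(((c + σ) * s - Real.pi * k * (c ^ 2 - s ^ 2 + σ * c)) / (2 * k * s ^ 2)) := by
    field_simp
    ring
  rw [e, neg_lt_zero]
  have : c ^ 2 - s ^ 2 = 1 := by linarith
  rw [this]
  exact div_pos key (by positivity)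

theorem continuousOn_edgeFun (α σ : ℝ) (m : ℕ) : ContinuousOn (edgeFun α σ) (window m) :=
  ((continuous_cosR.add continuous_const).continuousOn.div continuous_sinR.continuousOn
    fun _ hE => sinR_ne_zero hE).add continuousOn_const

theorem strictAntiOn_edgeFun (α : ℝ) {σ : ℝ} (h1 : -1 < σ) (h2 : σ < 1) (m : ℕ) :
    StrictAntiOn (edgeFun α σ) (window m) := by
  have hc := continuousOn_edgeFun α σ m
  rcases Nat.eq_zero_or_pos m with rfl | hm
  · have e : window 0 = Iic 0 ∪ Ico 0 1 := by
      rw [Iic_union_Ico_eq_Iio zero_lt_one]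
      ext E
      simp [window]
    rw [e] at hc ⊢
    refine StrictAntiOn.union (c := 0) ?_ ?_ isGreatest_Iic (isLeast_Ico zero_lt_one)
    · refine strictAntiOn_of_deriv_neg (convex_Iic 0) (hc.mono subset_union_left) fun E hE => ?_
      rw [interior_Iic] at hE
      exact deriv_edgeFun_neg_of_neg h1 h2 hE
    · refine strictAntiOn_of_deriv_neg (convex_Ico 0 1) (hc.mono subset_union_right) fun E hE => ?_
      rw [interior_Ico] at hE
      refine deriv_edgeFun_neg_of_pos h1 h2 hE.1 (sinR_ne_zero (m := 0) ?_)
      rw [e]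
      exact Or.inr ⟨hE.1.le, hE.2⟩
  · have e : window m = Ioo ((m : ℝ) ^ 2) (((m : ℝ) + 1) ^ 2) := by
      ext E
      simp [window, hm.ne']
    rw [e] at hc ⊢
    refine strictAntiOn_of_deriv_neg (convex_Ioo _ _) hc fun E hE => ?_
    rw [interior_Ioo] at hE
    refine deriv_edgeFun_neg_of_pos h1 h2 ((sq_nonneg _).trans_lt hE.1) (sinR_ne_zero (m := m) ?_)
    rwa [e]

theorem edgeFun_mul_sinR {α σ E : ℝ} (hS : sinR E ≠ 0) :
    edgeFun α σ E * sinR E = discrR α E + σ := by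
  rw [edgeFun, discrR]
  field_simp
  ring

/-! ### Band edges and gaps -/

theorem exists_left_point (α γ : ℝ) {c : ℝ} (hc : |c| < 1) {m : ℕ} {e : ℝ}
    (h1 : m = 0 ∨ (m : ℝ) ^ 2 < e) (h2 : e ≤ ((m : ℝ) + 1) ^ 2) :
    ∃ l < e, Ioo l e ⊆ window m ∧ |c| + |γ| / 4 * |sinR l| < (-1) ^ m * discrR α l := by
  rcases Nat.eq_zero_or_pos m with rfl | hm
  · obtain ⟨E₀, h0, hE⟩ := exists_dominated (|α| / 4 + |γ| / 4 + |c| + 1)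
    refine ⟨min E₀ (e - 1), (min_le_right _ _).trans_lt (by linarith),
      fun x hx => ⟨Or.inl rfl, hx.2.trans_le h2⟩, ?_⟩
    have hd := hE _ (min_le_left E₀ (e - 1))
    have hS := sinR_pos_of_nonpos ((min_le_left E₀ (e - 1)).trans h0.le)
    rw [abs_of_pos hS, discrR, pow_zero, one_mul]
    nlinarith [neg_abs_le α, abs_nonneg α, abs_nonneg γ, abs_nonneg c]
  · obtain ⟨k, rfl⟩ := Nat.exists_eq_succ_of_ne_zero hm.ne'
    have hl := h1.resolve_left (Nat.succ_ne_zero k)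
    refine ⟨_, hl, fun x hx => ⟨Or.inr hx.1, hx.2.trans_le h2⟩, ?_⟩
    have hS : sinR (((k.succ : ℕ) : ℝ) ^ 2) = 0 := by
      rw [Nat.succ_eq_add_one]
      push_cast
      exact sinR_sq k
    rw [discrR, cosR_sq, hS, abs_zero, mul_zero, mul_zero, add_zero, add_zero, ← mul_pow]
    simpa using hc

theorem discrR_sq (α : ℝ) (m : ℕ) : (-1) ^ m * discrR α (((m : ℝ) + 1) ^ 2) = -1 := by
  have := cosR_sq (m + 1)
  push_cast at this
  rw [discrR, sinR_sq, mul_zero, add_zero, this, pow_succ, ← mul_assoc, ← mul_pow]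
  simp

theorem sq_lt_succ_sq (m : ℕ) : (m : ℝ) ^ 2 < ((m : ℝ) + 1) ^ 2 := by
  have : (0 : ℝ) ≤ m := m.cast_nonneg
  nlinarith

theorem exists_zero_edgeFun (α : ℝ) {σ : ℝ} (hσ : |σ| < 1) (m : ℕ) :
    ∃ a ∈ window m, edgeFun α σ a = 0 := by
  obtain ⟨l, hl, hw, hF⟩ := exists_left_point α 0 hσ (Or.inr (sq_lt_succ_sq m)) le_rfl
  have hcont : Continuous fun E => (-1) ^ m * (discrR α E + σ) :=
    continuous_const.mul ((continuous_discrR α).add continuous_const)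
  have hs : |(-1) ^ m * σ| = |σ| := by simp [abs_mul]
  have b1 := neg_abs_le ((-1) ^ m * σ)
  have b2 := le_abs_self ((-1) ^ m * σ)
  rw [hs] at b1 b2
  rw [abs_zero, zero_div, zero_mul, add_zero] at hF
  have h0 : (0 : ℝ) ∈ Ioo ((-1) ^ m * (discrR α (((m : ℝ) + 1) ^ 2) + σ))
      ((-1) ^ m * (discrR α l + σ)) := by
    have := discrR_sq α m
    constructor <;> rw [mul_add] <;> linarith
  obtain ⟨a, ha, ha0⟩ := intermediate_value_Ioo' hl.le hcont.continuousOn h0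
  refine ⟨a, hw ha, ?_⟩
  have hS := sinR_ne_zero (hw ha)
  have h1 : discrR α a + σ = 0 := (mul_eq_zero.1 ha0).resolve_left (by simp)
  rw [← edgeFun_mul_sinR hS] at h1
  exact (mul_eq_zero.1 h1).resolve_right hS

theorem edgeFun_mul_edgeFun {α c E : ℝ} (hS : sinR E ≠ 0) :
    edgeFun α c E * edgeFun α (-c) E * sinR E ^ 2 = discrR α E ^ 2 - c ^ 2 := by
  have h1 := edgeFun_mul_sinR (α := α) (σ := c) hS
  have h2 := edgeFun_mul_sinR (α := α) (σ := -c) hS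
  calc _ = (edgeFun α c E * sinR E) * (edgeFun α (-c) E * sinR E) := by ring
    _ = _ := by rw [h1, h2]; ring

theorem edgeFun_add_edgeFun {α c E : ℝ} (hS : sinR E ≠ 0) :
    (edgeFun α c E + edgeFun α (-c) E) * sinR E ^ 2 = 2 * (discrR α E * sinR E) := by
  have h1 := edgeFun_mul_sinR (α := α) (σ := c) hS
  have h2 := edgeFun_mul_sinR (α := α) (σ := -c) hS
  linear_combination sinR E * h1 + sinR E * h2

/-- `e₁` and `e₂` are the edges of the band in the window number `m`. -/
structure IsBand (α c : ℝ) (m : ℕ) (e₁ e₂ : ℝ) : Prop where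
  left_mem : e₁ ∈ window m
  right_mem : e₂ ∈ window m
  le : e₁ ≤ e₂
  left_eq : discrR α e₁ ^ 2 = c ^ 2
  right_eq : discrR α e₂ ^ 2 = c ^ 2
  lt_iff : ∀ E ∈ window m, E < e₁ ↔ 0 < edgeFun α c E ∧ 0 < edgeFun α (-c) E
  gt_iff : ∀ E ∈ window m, e₂ < E ↔ edgeFun α c E < 0 ∧ edgeFun α (-c) E < 0

theorem exists_isBand (α : ℝ) {c : ℝ} (hc : |c| < 1) (m : ℕ) : ∃ e₁ e₂, IsBand α c m e₁ e₂ := by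
  obtain ⟨a, ha, ha0⟩ := exists_zero_edgeFun α hc m
  obtain ⟨b, hb, hb0⟩ := exists_zero_edgeFun α (σ := -c) (by rwa [abs_neg]) m
  obtain ⟨c1, c2⟩ := abs_lt.1 hc
  have m1 := strictAntiOn_edgeFun α c1 c2 m
  have m2 := strictAntiOn_edgeFun α (σ := -c) (by linarith) (by linarith) m
  have ea : discrR α a ^ 2 = c ^ 2 := by
    have := edgeFun_mul_edgeFun (α := α) (c := c) (sinR_ne_zero ha)
    rw [ha0] at this
    linarith
  have eb : discrR α b ^ 2 = c ^ 2 := by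
    have := edgeFun_mul_edgeFun (α := α) (c := c) (sinR_ne_zero hb)
    rw [hb0] at this
    linarith
  refine ⟨min a b, max a b, ?_, ?_, min_le_max, ?_, ?_, fun E hE => ?_, fun E hE => ?_⟩
  · rcases min_choice a b with h | h <;> rwa [h]
  · rcases max_choice a b with h | h <;> rwa [h]
  · rcases min_choice a b with h | h <;> rwa [h]
  · rcases max_choice a b with h | h <;> rwa [h]
  · rw [lt_min_iff, ← m1.lt_iff_gt ha hE, ← m2.lt_iff_gt hb hE, ha0, hb0]
  · rw [max_lt_iff, ← m1.lt_iff_gt hE ha, ← m2.lt_iff_gt hE hb, ha0, hb0]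

theorem IsBand.notMem_bandSet_iff {A α : ℝ} {m : ℕ} {e₁ e₂ E : ℝ}
    (h : IsBand α (Real.cos (A * Real.pi)) m e₁ e₂) (hE : E ∈ window m) :
    (E : ℂ) ∉ bandSet A α ↔ E < e₁ ∨ e₂ < E := by
  have hS := sinR_ne_zero hE
  have hS2 : 0 < sinR E ^ 2 := by positivity
  rw [ofReal_mem_bandSet, or_iff_right hS, not_le, ← sq_lt_sq, ← sub_pos, ← edgeFun_mul_edgeFun hS,
    mul_pos_iff_of_pos_right hS2, mul_pos_iff, h.lt_iff E hE, h.gt_iff E hE]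

/-- The gaps in their order from the left to the right. -/
def gap (e₁ e₂ : ℕ → ℝ) (n : ℕ) : Set ℝ :=
  if Even n then {E ∈ window (n / 2) | E < e₁ (n / 2)} else {E ∈ window (n / 2) | e₂ (n / 2) < E}

/-- A point of the spectrum which ends the gap number `n`. -/
def gapEnd (e₁ : ℕ → ℝ) (n : ℕ) : ℝ :=
  if Even n then e₁ (n / 2) else (((n / 2 : ℕ) : ℝ) + 1) ^ 2

theorem isGapEnumeration_of_separated {S : Set ℂ} {G : ℕ → Set ℝ} {b : ℕ → ℝ}
    (hne : ∀ n, (G n).Nonempty) (hG : ∀ n, (G n).OrdConnected)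
    (hS : ∀ y : ℝ, (y : ℂ) ∉ S ↔ ∃ n, y ∈ G n) (hb : ∀ n, (b n : ℂ) ∈ S)
    (hlt : ∀ n, ∀ x ∈ G n, x < b n) (hgt : ∀ n k, n < k → ∀ y ∈ G k, b n < y) :
    IsGapEnumeration S G := by
  have key : ∀ n, ∀ x ∈ G n, connectedComponentIn {y : ℝ | (y : ℂ) ∉ S} x = G n := by
    intro n x hx
    refine subset_antisymm (fun y hy => ?_) ((hG n).isPreconnected.subset_connectedComponentIn hx
      fun y hy => (hS y).2 ⟨n, hy⟩)
    have hxm : x ∈ connectedComponentIn {y : ℝ | (y : ℂ) ∉ S} x :=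
      mem_connectedComponentIn ((hS x).2 ⟨n, hx⟩)
    have hoc := (isPreconnected_connectedComponentIn
      (F := {y : ℝ | (y : ℂ) ∉ S}) (x := x)).ordConnected
    have hsub := connectedComponentIn_subset {y : ℝ | (y : ℂ) ∉ S} x
    obtain ⟨k, hk⟩ := (hS y).1 (hsub hy)
    rcases lt_trichotomy n k with h | rfl | h
    · exact absurd (hb n) (hsub (hoc.out hxm hy ⟨(hlt n x hx).le, (hgt n k h y hk).le⟩))
    · exact hk
    · exact absurd (hb k) (hsub (hoc.out hy hxm ⟨(hlt k y hk).le, (hgt k n h x hx).le⟩))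
  refine ⟨fun I => ⟨?_, ?_⟩, fun m n h x hx y hy => (hlt m x hx).trans (hgt m n h y hy)⟩
  · rintro ⟨x, hx, rfl⟩
    obtain ⟨n, hn⟩ := (hS x).1 hx
    exact ⟨n, key n x hn⟩
  · rintro ⟨n, rfl⟩
    obtain ⟨x, hx⟩ := hne n
    exact ⟨x, (hS x).2 ⟨n, hx⟩, (key n x hx).symm⟩

theorem mem_bandSet_sq (A α : ℝ) (m : ℕ) : (((((m : ℝ) + 1) ^ 2 : ℝ)) : ℂ) ∈ bandSet A α :=
  ofReal_mem_bandSet.2 (Or.inl (sinR_sq m))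

theorem isGapEnumeration_gap {A α : ℝ} (hc : |Real.cos (A * Real.pi)| < 1) {e₁ e₂ : ℕ → ℝ}
    (h : ∀ m, IsBand α (Real.cos (A * Real.pi)) m (e₁ m) (e₂ m)) :
    IsGapEnumeration (bandSet A α) (gap e₁ e₂) := by
  refine isGapEnumeration_of_separated (b := gapEnd e₁) (fun n => ?_) (fun n => ?_) (fun y => ?_)
    (fun n => ?_) (fun n x hx => ?_) (fun n k hnk y hy => ?_)
  · have hb := h (n / 2)
    unfold gap
    split_ifs with hn
    · obtain ⟨l, hl, hw, -⟩ := exists_left_point α 0 hc hb.left_mem.1 hb.left_mem.2.le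
      obtain ⟨x, hx⟩ := exists_between hl
      exact ⟨x, hw hx, hx.2⟩
    · obtain ⟨x, hx⟩ := exists_between hb.right_mem.2
      exact ⟨x, ⟨hb.right_mem.1.imp id fun h => h.trans hx.1, hx.2⟩, hx.1⟩
  · unfold gap
    split_ifs with hn
    · exact (ordConnected_window _).inter ordConnected_Iio
    · exact (ordConnected_window _).inter ordConnected_Ioi
  · constructor
    · intro hy
      rcases exists_window y with ⟨m, hm⟩ | ⟨m, rfl⟩
      · rcases ((h m).notMem_bandSet_iff hm).1 hy with h1 | h1
        · refine ⟨2 * m, ?_⟩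
          rw [gap, if_pos (even_two_mul m), Nat.mul_div_cancel_left m two_pos]
          exact ⟨hm, h1⟩
        · refine ⟨2 * m + 1, ?_⟩
          have e : (2 * m + 1) / 2 = m := by omega
          rw [gap, if_neg (Nat.not_even_iff_odd.2 (odd_two_mul_add_one m)), e]
          exact ⟨hm, h1⟩
      · exact absurd (mem_bandSet_sq A α m) hy
    · rintro ⟨n, hn⟩
      unfold gap at hn
      split_ifs at hn
      · exact ((h _).notMem_bandSet_iff hn.1).2 (Or.inl hn.2)
      · exact ((h _).notMem_bandSet_iff hn.1).2 (Or.inr hn.2)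
  · unfold gapEnd
    split_ifs with hn
    · exact ofReal_mem_bandSet.2 (Or.inr (sq_le_sq.1 (h _).left_eq.le))
    · exact mem_bandSet_sq A α _
  · unfold gap at hx
    unfold gapEnd
    split_ifs at hx ⊢
    · exact hx.2
    · exact hx.1.2
  · have hyw : y ∈ window (k / 2) := by
      unfold gap at hy
      split_ifs at hy <;> exact hy.1
    rcases (Nat.div_le_div_right hnk.le : n / 2 ≤ k / 2).lt_or_eq with hlt | heq
    · refine lt_of_le_of_lt ?_ (window_lt hlt hyw)
      unfold gapEnd
      split_ifs
      · exact (h _).left_mem.2.le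
      · exact le_rfl
    · have hn : Even n := by
        rw [Nat.even_iff]
        omega
      have hk : ¬ Even k := by
        rw [Nat.even_iff]
        omega
      rw [gap, if_neg hk] at hy
      rw [gapEnd, if_pos hn, heq]
      exact (h _).le.trans_lt hy.2

/-! ### The eigenvalue equation -/

theorem summable_pow_natAbs {l : ℝ} (hl : |l| < 1) :
    Summable fun j : ℤ => ‖((l ^ (j - 1).natAbs : ℝ) : ℂ)‖ ^ 2 := by
  have hg : Summable fun n : ℕ => (l ^ 2) ^ n :=
    summable_geometric_of_lt_one (sq_nonneg l) ((sq_lt_one_iff_abs_lt_one l).2 hl)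
  have h0 : Summable fun j : ℤ => (l ^ 2) ^ j.natAbs := by
    refine Summable.of_nat_of_neg ?_ ?_ <;> simpa using hg
  refine ((Equiv.subRight (1 : ℤ)).summable_iff.2 h0).congr fun j => ?_
  simp only [Function.comp, Equiv.subRight_apply, Complex.norm_real, Real.norm_eq_abs, sq_abs]
  rw [← pow_mul, ← pow_mul, mul_comm]

theorem greenDiag_mul_eq_one {A α E l : ℝ} (hE : (E : ℂ) ∉ bandSet A α) (hl : |l| < 1)
    (heq : Real.cos (A * Real.pi) * l ^ 2 - 2 * discrR α E * l + Real.cos (A * Real.pi) = 0) :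
    greenDiag A α E * ((2 * (Real.cos (A * Real.pi) * l - discrR α E) : ℝ) : ℂ) = 1 := by
  set c := Real.cos (A * Real.pi) with hc
  set x : Seq := Seq.mk (fun j => ((l ^ (j - 1).natAbs : ℝ) : ℂ)) (summable_pow_natAbs hl) with hx
  have hxj : ∀ j, x j = ((l ^ (j - 1).natAbs : ℝ) : ℂ) := fun j => rfl
  have hJ : jacobi A α 0 E x = ((2 * (c * l - discrR α E) : ℝ) : ℂ) • unitSeq := by
    refine Seq.ext fun j => ?_
    have e : (2 * cosEnd E + impurityCoupling α 0 j / 2 * sinEnd E : ℂ)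
        = ((2 * discrR α E : ℝ) : ℂ) := by
      rw [impurityCoupling_zero, periodicCoupling, cosEnd_ofReal, sinEnd_ofReal, discrR]
      push_cast
      ring
    rw [jacobi_apply, Seq.smul_apply, e, hxj, hxj, hxj, ← hc]
    rcases eq_or_ne j 1 with rfl | hj
    · rw [unitSeq_one]
      norm_num
      ring
    · have hu : unitSeq j = 0 := lp.single_apply_ne 2 1 1 hj
      rw [hu, mul_zero]
      have hcases : ∃ n : ℕ, (j - 1).natAbs = n + 1 ∧
          ((j + 1 - 1).natAbs = n + 2 ∧ (j - 1 - 1).natAbs = n ∨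
            (j + 1 - 1).natAbs = n ∧ (j - 1 - 1).natAbs = n + 2) :=
        ⟨(j - 1).natAbs - 1, by omega, by omega⟩
      have heq' : (c : ℂ) * l ^ 2 - 2 * discrR α E * l + c = 0 := by exact_mod_cast heq
      obtain ⟨n, h1, ⟨h2, h3⟩ | ⟨h2, h3⟩⟩ := hcases <;>
      · rw [h1, h2, h3]
        push_cast
        linear_combination (l : ℂ) ^ n * heq'
  have h1 := green_jacobi hE x
  rw [hJ, map_smul] at h1
  have h2 := congrArg (fun y : Seq => y 1) h1
  simp only [Seq.smul_apply] at h2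
  rw [hxj] at h2
  rw [greenDiag, mul_comm]
  simpa using h2

theorem exists_decaying_root {c η : ℝ} (h : c ^ 2 < η ^ 2) :
    ∃ l : ℝ, |l| < 1 ∧ c * l ^ 2 - 2 * η * l + c = 0 := by
  have hd : 0 < η ^ 2 - c ^ 2 := by linarith
  have hw := Real.sqrt_pos.2 hd
  have hw2 := Real.sq_sqrt hd.le
  have hη : 0 < |η| := abs_pos.2 (by rintro rfl; nlinarith [sq_nonneg c])
  set w := √(η ^ 2 - c ^ 2)
  have hcη : |c| < |η| := sq_lt_sq.1 h
  have main : ∀ η : ℝ, 0 < η → |c| < η → w ^ 2 = η ^ 2 - c ^ 2 →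
      |c / (η + w)| < 1 ∧ c * (c / (η + w)) ^ 2 - 2 * η * (c / (η + w)) + c = 0 := by
    intro η h0 h1 h2
    have hr : 0 < η + w := by linarith
    refine ⟨?_, ?_⟩
    · rw [abs_div, abs_of_pos hr, div_lt_one hr]
      linarith
    · field_simp
      linear_combination c * h2
  rcases le_or_gt 0 η with h0 | h0
  · rw [abs_of_nonneg h0] at hη hcη
    exact ⟨_, main η hη hcη hw2⟩
  · rw [abs_of_neg h0] at hη hcη
    obtain ⟨h1, h2⟩ := main (-η) hη hcη (by rw [hw2]; ring)
    exact ⟨-(c / (-η + w)), by rwa [abs_neg], by linear_combination h2⟩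

theorem eigenspace_ne_bot_iff_sq {A α γ E : ℝ} (hE : (E : ℂ) ∉ bandSet A α)
    (hsign : γ * (discrR α E * sinR E) < 0) :
    eigenspace (hamiltonian A (impurityCoupling α γ)) (E : ℂ) ≠ ⊥ ↔
      (γ / 4) ^ 2 * sinR E ^ 2 = discrR α E ^ 2 - Real.cos (A * Real.pi) ^ 2 := by
  have hnot := hE
  rw [ofReal_mem_bandSet, not_or, not_le, ← sq_lt_sq] at hnot
  obtain ⟨l, hl, heq⟩ := exists_decaying_root hnot.2
  have hg := greenDiag_mul_eq_one hE hl heq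
  rw [eigenspace_ne_bot_iff hE, sinEnd_ofReal]
  set c := Real.cos (A * Real.pi) with hc
  set η := discrR α E with hη
  have hD2 : (c * l - η) ^ 2 = η ^ 2 - c ^ 2 := by linear_combination c * heq
  have hD : η * (c * l - η) < 0 := by
    have h1 : |c| < |η| := sq_lt_sq.1 hnot.2
    have h2 : η * (c * l) ≤ |η| * |c| := by
      refine (le_abs_self _).trans ?_
      rw [abs_mul, abs_mul]
      exact mul_le_mul_of_nonneg_left (mul_le_of_le_one_right (abs_nonneg c) hl.le) (abs_nonneg η)
    have h3 : |η| * |c| < |η| * |η| := mul_lt_mul_of_pos_left h1 ((abs_nonneg c).trans_lt h1)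
    rw [abs_mul_abs_self] at h3
    linarith
  have hD0 : ((2 * (c * l - η) : ℝ) : ℂ) ≠ 0 := fun h0 => by
    rw [h0, mul_zero] at hg
    exact zero_ne_one hg
  have hiff : ((γ : ℂ) / 2 * (sinR E : ℂ) * greenDiag A α E = 1) ↔ γ / 4 * sinR E = c * l - η := by
    rw [← mul_left_inj' hD0, mul_assoc, hg, mul_one, one_mul]
    constructor
    · intro h
      have : γ / 2 * sinR E = 2 * (c * l - η) := by exact_mod_cast h
      linarith
    · intro h
      have : γ / 2 * sinR E = 2 * (c * l - η) := by linarith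
      exact_mod_cast this
  rw [hiff, ← mul_pow, ← hD2, sq_eq_sq_iff_eq_or_eq_neg]
  refine ⟨Or.inl, fun h => h.resolve_right fun h => ?_⟩
  have : η * (γ / 4 * sinR E) < 0 := by linarith
  rw [h] at this
  linarith

theorem IsBand.discr_pos {α c E : ℝ} {m : ℕ} {e₁ e₂ : ℝ} (h : IsBand α c m e₁ e₂)
    (hE : E ∈ window m) (hlt : E < e₁) : 0 < discrR α E * sinR E := by
  obtain ⟨h1, h2⟩ := (h.lt_iff E hE).1 hlt
  have hS := sinR_ne_zero hE
  have h3 := edgeFun_add_edgeFun (α := α) (c := c) hS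
  have : 0 < (edgeFun α c E + edgeFun α (-c) E) * sinR E ^ 2 := by positivity
  linarith

theorem IsBand.discr_neg {α c E : ℝ} {m : ℕ} {e₁ e₂ : ℝ} (h : IsBand α c m e₁ e₂)
    (hE : E ∈ window m) (hgt : e₂ < E) : discrR α E * sinR E < 0 := by
  obtain ⟨h1, h2⟩ := (h.gt_iff E hE).1 hgt
  have hS := sinR_ne_zero hE
  have h3 := edgeFun_add_edgeFun (α := α) (c := c) hS
  have : (edgeFun α c E + edgeFun α (-c) E) * sinR E ^ 2 < 0 :=
    mul_neg_of_neg_of_pos (by linarith) (by positivity)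
  linarith

/-- The function whose zeros in the gaps are the eigenvalues. -/
def impurityFun (α γ c E : ℝ) : ℝ := discrR α E ^ 2 - c ^ 2 - (γ / 4) ^ 2 * sinR E ^ 2

theorem continuous_impurityFun (α γ c : ℝ) : Continuous (impurityFun α γ c) :=
  (((continuous_discrR α).pow 2).sub continuous_const).sub
    (continuous_const.mul (continuous_sinR.pow 2))

theorem impurityFun_neg {α γ c e : ℝ} {m : ℕ} (hγ : γ ≠ 0) (he : e ∈ window m)
    (h : discrR α e ^ 2 = c ^ 2) : impurityFun α γ c e < 0 := by
  have hS := sinR_ne_zero he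
  have : 0 < (γ / 4) ^ 2 * sinR e ^ 2 := by positivity
  rw [impurityFun, h]
  linarith

theorem IsBand.exists_lt {α γ c : ℝ} (hc : |c| < 1) (hγ : γ ≠ 0) {m : ℕ} {e₁ e₂ : ℝ}
    (h : IsBand α c m e₁ e₂) : ∃ E ∈ window m, E < e₁ ∧ impurityFun α γ c E = 0 := by
  obtain ⟨l, hl, hw, hF⟩ := exists_left_point α γ hc h.left_mem.1 h.left_mem.2.le
  have hpos : 0 < impurityFun α γ c l := by
    have h0 : 0 ≤ |γ| / 4 * |sinR l| := by positivity
    have h1 := mul_self_lt_mul_self (by positivity) hF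
    have h2 : (-1 : ℝ) ^ m * discrR α l * ((-1) ^ m * discrR α l) = discrR α l ^ 2 := by
      rw [mul_mul_mul_comm, ← mul_pow]
      simp [sq]
    have h3 : (|c| + |γ| / 4 * |sinR l|) * (|c| + |γ| / 4 * |sinR l|)
        = c ^ 2 + (γ / 4) ^ 2 * sinR l ^ 2 + 2 * |c| * (|γ| / 4 * |sinR l|) := by
      rw [← sq_abs c, ← sq_abs (sinR l), div_pow, ← sq_abs γ]
      ring
    have h4 : 0 ≤ 2 * |c| * (|γ| / 4 * |sinR l|) := by positivity
    rw [impurityFun]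
    linarith
  obtain ⟨E, hE, hE0⟩ := intermediate_value_Ioo' hl.le
    (continuous_impurityFun α γ c).continuousOn
    ⟨impurityFun_neg hγ h.left_mem h.left_eq, hpos⟩
  exact ⟨E, hw hE, hE.2, hE0⟩

theorem IsBand.exists_gt {α γ c : ℝ} (hc : |c| < 1) (hγ : γ ≠ 0) {m : ℕ} {e₁ e₂ : ℝ}
    (h : IsBand α c m e₁ e₂) : ∃ E ∈ window m, e₂ < E ∧ impurityFun α γ c E = 0 := by
  have hpos : 0 < impurityFun α γ c (((m : ℝ) + 1) ^ 2) := by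
    have h1 : discrR α (((m : ℝ) + 1) ^ 2) ^ 2 = 1 := by
      have := congrArg (fun x : ℝ => x ^ 2) (discrR_sq α m)
      simpa [mul_pow, ← pow_mul] using this
    have h2 := (sq_lt_one_iff_abs_lt_one c).2 hc
    rw [impurityFun, h1, sinR_sq]
    linarith
  obtain ⟨E, hE, hE0⟩ := intermediate_value_Ioo h.right_mem.2.le
    (continuous_impurityFun α γ c).continuousOn
    ⟨impurityFun_neg hγ h.right_mem h.right_eq, hpos⟩
  exact ⟨E, ⟨h.right_mem.1.imp id fun h => h.trans hE.1, hE.2⟩, hE.1, hE0⟩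

theorem impurityFun_eq_zero_iff {α γ c E : ℝ} (hS : sinR E ≠ 0) :
    impurityFun α γ c E = 0 ↔ edgeFun α c E * edgeFun α (-c) E = (γ / 4) ^ 2 := by
  have h := edgeFun_mul_edgeFun (α := α) (c := c) hS
  rw [impurityFun, ← h, ← sub_mul, mul_eq_zero, sub_eq_zero, or_iff_left (pow_ne_zero 2 hS)]

theorem IsBand.injOn_lt {α γ c : ℝ} (hc : |c| < 1) {m : ℕ} {e₁ e₂ : ℝ} (h : IsBand α c m e₁ e₂)
    {E E' : ℝ} (hE : E ∈ window m) (hE' : E' ∈ window m) (hl : E < e₁) (hl' : E' < e₁)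
    (h0 : impurityFun α γ c E = 0) (h0' : impurityFun α γ c E' = 0) : E' = E := by
  obtain ⟨c1, c2⟩ := abs_lt.1 hc
  have m1 := strictAntiOn_edgeFun α c1 c2 m
  have m2 := strictAntiOn_edgeFun α (σ := -c) (by linarith) (by linarith) m
  have anti : StrictAntiOn (fun E => edgeFun α c E * edgeFun α (-c) E) {E ∈ window m | E < e₁} := by
    intro x hx y hy hxy
    obtain ⟨p1, p2⟩ := (h.lt_iff y hy.1).1 hy.2
    exact mul_lt_mul'' (m1 hx.1 hy.1 hxy) (m2 hx.1 hy.1 hxy) p1.le p2.le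
  rw [impurityFun_eq_zero_iff (sinR_ne_zero hE)] at h0
  rw [impurityFun_eq_zero_iff (sinR_ne_zero hE')] at h0'
  exact anti.injOn ⟨hE', hl'⟩ ⟨hE, hl⟩ (h0'.trans h0.symm)

theorem IsBand.injOn_gt {α γ c : ℝ} (hc : |c| < 1) {m : ℕ} {e₁ e₂ : ℝ} (h : IsBand α c m e₁ e₂)
    {E E' : ℝ} (hE : E ∈ window m) (hE' : E' ∈ window m) (hl : e₂ < E) (hl' : e₂ < E')
    (h0 : impurityFun α γ c E = 0) (h0' : impurityFun α γ c E' = 0) : E' = E := by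
  obtain ⟨c1, c2⟩ := abs_lt.1 hc
  have m1 := strictAntiOn_edgeFun α c1 c2 m
  have m2 := strictAntiOn_edgeFun α (σ := -c) (by linarith) (by linarith) m
  have mono : StrictMonoOn (fun E => edgeFun α c E * edgeFun α (-c) E)
      {E ∈ window m | e₂ < E} := by
    intro x hx y hy hxy
    obtain ⟨p1, p2⟩ := (h.gt_iff x hx.1).1 hx.2
    have q1 := m1 hx.1 hy.1 hxy
    have q2 := m2 hx.1 hy.1 hxy
    have := mul_lt_mul'' (neg_lt_neg q1) (neg_lt_neg q2) (by linarith) (by linarith)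
    simpa using this
  rw [impurityFun_eq_zero_iff (sinR_ne_zero hE)] at h0
  rw [impurityFun_eq_zero_iff (sinR_ne_zero hE')] at h0'
  exact mono.injOn ⟨hE', hl'⟩ ⟨hE, hl⟩ (h0'.trans h0.symm)

theorem hasUniqueSimpleEigenvalueIn_of_zero {A α γ : ℝ} {G : Set ℝ}
    (hG : ∀ E ∈ G, (E : ℂ) ∉ bandSet A α) (hsign : ∀ E ∈ G, γ * (discrR α E * sinR E) < 0)
    (hex : ∃ E ∈ G, impurityFun α γ (Real.cos (A * Real.pi)) E = 0)
    (huniq : ∀ E ∈ G, ∀ E' ∈ G, impurityFun α γ (Real.cos (A * Real.pi)) E = 0 →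
      impurityFun α γ (Real.cos (A * Real.pi)) E' = 0 → E' = E) :
    HasUniqueSimpleEigenvalueIn (hamiltonian A (impurityCoupling α γ)) G := by
  have hiff : ∀ E ∈ G, eigenspace (hamiltonian A (impurityCoupling α γ)) (E : ℂ) ≠ ⊥ ↔
      impurityFun α γ (Real.cos (A * Real.pi)) E = 0 := fun E hE => by
    rw [eigenspace_ne_bot_iff_sq (hG E hE) (hsign E hE), impurityFun, sub_eq_zero, eq_comm]
  obtain ⟨E, hE, h0⟩ := hex
  exact ⟨E, hE, finrank_eigenspace (hG E hE) ((hiff E hE).2 h0),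
    fun E' hE' hne => huniq E hE E' hE' h0 ((hiff E' hE').1 hne)⟩

theorem IsBand.hasUniqueSimpleEigenvalueIn_lt {A α γ : ℝ} (hc : |Real.cos (A * Real.pi)| < 1)
    (hγ : γ < 0) {m : ℕ} {e₁ e₂ : ℝ} (h : IsBand α (Real.cos (A * Real.pi)) m e₁ e₂) :
    HasUniqueSimpleEigenvalueIn (hamiltonian A (impurityCoupling α γ)) {E ∈ window m | E < e₁} := by
  refine hasUniqueSimpleEigenvalueIn_of_zero
    (fun E hE => (h.notMem_bandSet_iff hE.1).2 (Or.inl hE.2))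
    (fun E hE => mul_neg_of_neg_of_pos hγ (h.discr_pos hE.1 hE.2)) ?_
    fun E hE E' hE' => h.injOn_lt hc hE.1 hE'.1 hE.2 hE'.2
  obtain ⟨E, h1, h2, h3⟩ := h.exists_lt hc hγ.ne
  exact ⟨E, ⟨h1, h2⟩, h3⟩

theorem IsBand.hasUniqueSimpleEigenvalueIn_gt {A α γ : ℝ} (hc : |Real.cos (A * Real.pi)| < 1)
    (hγ : 0 < γ) {m : ℕ} {e₁ e₂ : ℝ} (h : IsBand α (Real.cos (A * Real.pi)) m e₁ e₂) :
    HasUniqueSimpleEigenvalueIn (hamiltonian A (impurityCoupling α γ)) {E ∈ window m | e₂ < E} := by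
  refine hasUniqueSimpleEigenvalueIn_of_zero
    (fun E hE => (h.notMem_bandSet_iff hE.1).2 (Or.inr hE.2))
    (fun E hE => mul_neg_of_pos_of_neg hγ (h.discr_neg hE.1 hE.2)) ?_
    fun E hE E' hE' => h.injOn_gt hc hE.1 hE'.1 hE.2 hE'.2
  obtain ⟨E, h1, h2, h3⟩ := h.exists_gt hc hγ.ne'
  exact ⟨E, ⟨h1, h2⟩, h3⟩

/-! ### The essential spectrum -/

theorem isClosed_graph_hamiltonian (A α γ : ℝ) :
    IsClosed ((hamiltonian A (impurityCoupling α γ)).graph : Set (L2Graph × L2Graph)) := by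
  set c := Real.cos (A * Real.pi) with hc
  obtain ⟨E, hE0, hE⟩ := exists_dominated (|α| / 4 + |γ| / 2 * ‖proj‖ + |c| + 1)
  have hd := hE E le_rfl
  have hS := sinR_pos_of_nonpos hE0.le
  have hz : sinEnd (E : ℂ) ≠ 0 := by
    rw [sinEnd_ofReal]
    exact_mod_cast hS.ne'
  have hp : 0 ≤ ‖proj‖ := norm_nonneg _
  have hJ : IsUnit (jacobi A α γ (E : ℂ)) := by
    refine isUnit_jacobi_of_large ?_
    have e1 : (γ / 2 * sinEnd (E : ℂ) : ℂ) = ((γ / 2 * sinR E : ℝ) : ℂ) := by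
      rw [sinEnd_ofReal]
      push_cast
      rfl
    have e2 : 2 * discr α (E : ℂ) = ((2 * discrR α E : ℝ) : ℂ) := by
      rw [discr_ofReal]
      push_cast
      rfl
    rw [e1, e2, Complex.norm_real, Complex.norm_real, Real.norm_eq_abs, Real.norm_eq_abs, abs_mul,
      abs_div, abs_two, abs_of_pos hS, ← hc]
    refine lt_of_lt_of_le ?_ (le_abs_self _)
    rw [discrR]
    have h1 : -(|α| * sinR E) ≤ α * sinR E := by
      rw [← neg_mul]
      exact mul_le_mul_of_nonneg_right (neg_abs_le α) hS.le
    have h2 : 0 ≤ |γ| / 2 * ‖proj‖ * sinR E := by positivity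
    have h3 : 0 ≤ (|c| + 1) * sinR E := by positivity
    have h4 : 0 ≤ |γ| / 2 * ‖proj‖ := by positivity
    nlinarith [abs_nonneg α]
  obtain ⟨hb, hC⟩ := bijective_shifted_of_isUnit hz hJ
  exact isClosed_graph_of_resolvent hb hC

theorem essentialSpectrum_eq (A α γ : ℝ) :
    essentialSpectrum (hamiltonian A (impurityCoupling α γ)) = bandSet A α := by
  refine subset_antisymm essentialSpectrum_subset fun z hz => ?_
  obtain ⟨f, hf, ho, hr⟩ := hasWeylSequence_of_mem (γ := γ) hz
  exact mem_essentialSpectrum_of_weyl (isClosed_graph_hamiltonian A α γ) hf ho hr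

theorem abs_cos_mul_pi_lt_one {A : ℝ} (hA : ∀ n : ℤ, A ≠ n) : |Real.cos (A * Real.pi)| < 1 := by
  rw [← sq_lt_one_iff_abs_lt_one]
  have h : Real.sin (A * Real.pi) ≠ 0 := by
    rw [Real.sin_ne_zero_iff]
    intro n hn
    exact hA n (mul_right_cancel₀ Real.pi_ne_zero hn).symm
  have h2 : 0 < Real.sin (A * Real.pi) ^ 2 := by positivity
  linarith [Real.sin_sq_add_cos_sq (A * Real.pi)]

end RingChain

end

theorem mainTheorem5 (A α γ : ℝ) (hA : ∀ n : ℤ, A ≠ n) :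
    RingChain.essentialSpectrum (RingChain.hamiltonian A (RingChain.impurityCoupling α γ)) =
        RingChain.spectrumSet (RingChain.hamiltonian A (RingChain.periodicCoupling α)) ∧
      ∃ G : ℕ → Set ℝ,
        RingChain.IsGapEnumeration
          (RingChain.essentialSpectrum
            (RingChain.hamiltonian A (RingChain.impurityCoupling α γ))) G ∧
        (γ < 0 → ∀ n : ℕ, Odd (n + 1) →
          RingChain.HasUniqueSimpleEigenvalueIn
            (RingChain.hamiltonian A (RingChain.impurityCoupling α γ)) (G n)) ∧
        (0 < γ → ∀ n : ℕ, Even (n + 1) →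
          RingChain.HasUniqueSimpleEigenvalueIn
            (RingChain.hamiltonian A (RingChain.impurityCoupling α γ)) (G n)) := by
  have hc := RingChain.abs_cos_mul_pi_lt_one hA
  choose e₁ e₂ h using RingChain.exists_isBand α hc
  rw [RingChain.essentialSpectrum_eq, RingChain.spectrumSet_periodic]
  refine ⟨rfl, RingChain.gap e₁ e₂, RingChain.isGapEnumeration_gap hc h, fun hγ n hn => ?_,
    fun hγ n hn => ?_⟩
  · have hn' : Even n := by
      rw [Nat.even_iff]
      rw [Nat.odd_iff] at hn
      omega
    rw [RingChain.gap, if_pos hn']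
    exact (h _).hasUniqueSimpleEigenvalueIn_lt hc hγ
  · have hn' : ¬ Even n := by
      rw [Nat.even_iff]
      rw [Nat.even_iff] at hn
      omega
    rw [RingChain.gap, if_neg hn']
    exact (h _).hasUniqueSimpleEigenvalueIn_gt hc hγ
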